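/- Let $n\ge 2$, let $M^n$ be a smooth manifold without boundary (Hausdorff, second countable), and let $h$ be a smooth background Riemannian metric on $M$, with Levi-Civita connection $\tilde\nabla$, Riemannian measure $\mu_h$ and Ricci tensor $\widetilde{\mathrm{Ric}}$; Hausdorff measures $\mathcal H^s$ are taken with respect to the distance of $h$. For a metric $g\in C^0\cap W^{1,2}_{loc}(M)$ and a compactly supported $\varphi\in C^\infty(M)$, the distributional scalar curvature of $g$ is $$\langle R_g,\varphi\rangle:=\int_M\Big(-V\cdot\tilde\nabla\big(\varphi\tfrac{d\mu_g}{d\mu_h}\big)+F\varphi\tfrac{d\mu_g}{d\mu_h}\Big)d\mu_h ,$$ where all derivatives of $g$ and of $\frac{d\mu_g}{d\mu_h}$ are weak ones and $$\Gamma_{ij}^k:=\tfrac12 g^{kl}\big(\tilde\nabla_i g_{jl}+\tilde\nabla_j g_{il}-\tilde\nabla_l g_{ij}\big),\qquad V^k:=g^{ij}\Gamma_{ij}^k-g^{ik}\Gamma_{ji}^j,$$ $$F:=\mathrm{tr}_g\widetilde{\mathrm{Ric}}-\tilde\nabla_kg^{ij}\,\Gamma_{ij}^k+\tilde\nabla_kg^{ik}\,\Gamma_{ji}^j+g^{ij}\big(\Gamma_{kl}^k\Gamma_{ij}^l-\Gamma_{jl}^k\Gamma_{ik}^l\big),\qquad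 \tilde\nabla_kg^{ij}=-g^{ia}g^{jb}\tilde\nabla_kg_{ab}.$$ For a constant $a$ write $\langle R_g-a,\varphi\rangle:=\langle R_g,\varphi\rangle-a\int_M\varphi\,d\mu_g$. Let $n\le p\le\infty$ and let $g\in C^0\cap W^{1,p}_{loc}(M)$ be a Riemannian metric on $M$ that is smooth away from a closed subset $\Sigma\subset M$. Assume that $\mathcal H^{\,n-\frac{p}{p-1}}(\Sigma)<\infty$ if $p<\infty$, or $\mathcal H^{\,n-1}(\Sigma)=0$ if $p=\infty$, and that $R_g\ge a$ on $M\setminus\Sigma$ for some constant $a\in\mathbb R$. Then for every nonnegative compactly supported $u\in C^\infty(M)$ (hence for every nonnegative $u\in C^\infty(M)$ if $M$ is compact), the weak differential of $u\frac{d\mu_g}{d\mu_h}$ exists, the integrands of $\langle R_g,u\rangle$ and of $\int_M u\,d\mu_g$ are integrable, and $$\langle R_g-a,u\rangle\ge 0 .$$ -/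

import Mathlib

open MeasureTheory Manifold Bundle
open scoped ContDiff ENNReal

noncomputable section

/-- The model space `ℝⁿ` with its Euclidean norm and Lebesgue measure. -/
abbrev Euc (n : ℕ) : Type := EuclideanSpace ℝ (Fin n)

/-! ### Calculus on open subsets of `ℝⁿ` -/

/-- The partial derivative `∂ₖ f (y)`. -/
def partialDeriv {n : ℕ} (f : Euc n → ℝ) (k : Fin n) (y : Euc n) : ℝ :=
  fderiv ℝ f y (EuclideanSpace.single k 1)

/-- `w` is the weak partial derivative `∂ₖ f` on the open set `U`. -/
def HasWeakPartialDeriv {n : ℕ} (U : Set (Euc n)) (f : Euc n → ℝ) (k : Fin n)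
    (w : Euc n → ℝ) : Prop :=
  LocallyIntegrableOn f U volume ∧ LocallyIntegrableOn w U volume ∧
    ∀ φ : Euc n → ℝ, ContDiff ℝ ∞ φ → HasCompactSupport φ → tsupport φ ⊆ U →
      ∫ y, f y * partialDeriv φ k y = - ∫ y, w y * φ y

/-- `f ∈ L^p_loc(U)`. -/
def MemLpLocOn {n : ℕ} (p : ℝ≥0∞) (U : Set (Euc n)) (f : Euc n → ℝ) : Prop :=
  ∀ K ⊆ U, IsCompact K → MemLp f p (volume.restrict K)

/-- The Christoffel symbols `Γ^k_{ij}` at `y` of a metric with coefficient matrix `G`. -/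
def christoffel {n : ℕ} (G : Euc n → Matrix (Fin n) (Fin n) ℝ) (y : Euc n)
    (k i j : Fin n) : ℝ :=
  (1 / 2 : ℝ) * ∑ l, (G y)⁻¹ k l *
    (partialDeriv (fun z => G z j l) i y + partialDeriv (fun z => G z i l) j y
      - partialDeriv (fun z => G z i j) l y)

/-- The Ricci tensor `R_{ij} = ∂ₖ Γ^k_{ij} - ∂ⱼ Γ^k_{ik} + Γ^k_{kl} Γ^l_{ij} - Γ^k_{jl} Γ^l_{ik}`
at `y` of a metric with coefficient matrix `G`. -/
def ricciCoord {n : ℕ} (G : Euc n → Matrix (Fin n) (Fin n) ℝ) (y : Euc n) (i j : Fin n) : ℝ :=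
  ∑ k, (partialDeriv (fun z => christoffel G z k i j) k y
      - partialDeriv (fun z => christoffel G z k i k) j y
      + ∑ l, (christoffel G y k k l * christoffel G y l i j
        - christoffel G y k j l * christoffel G y l i k))

/-! ### Tensor fields and their components in charts

`M` is a manifold without boundary modelled on `ℝⁿ`.  Tensor fields are arbitrary (not necessarily
continuous) sections, given fibrewise. -/

section Manifold

variable {n : ℕ} {M : Type*} [TopologicalSpace M] [ChartedSpace (Euc n) M]

/-- Fields of covectors. -/
abbrev CovectorField (n : ℕ) (M : Type*) [TopologicalSpace M] [ChartedSpace (Euc n) M] :=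
  ∀ x : M, TangentSpace (𝓡 n) x →L[ℝ] ℝ

/-- Fields of bilinear forms on the tangent spaces. -/
abbrev BilinField (n : ℕ) (M : Type*) [TopologicalSpace M] [ChartedSpace (Euc n) M] :=
  ∀ x : M, TangentSpace (𝓡 n) x →L[ℝ] TangentSpace (𝓡 n) x →L[ℝ] ℝ

/-- Fields of trilinear forms on the tangent spaces. -/
abbrev TrilinField (n : ℕ) (M : Type*) [TopologicalSpace M] [ChartedSpace (Euc n) M] :=
  ∀ x : M, TangentSpace (𝓡 n) x →L[ℝ] TangentSpace (𝓡 n) x →L[ℝ] TangentSpace (𝓡 n) x →L[ℝ] ℝ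

/-- The coordinate vector `∂ᵢ`, in the chart at `c`, at the point with coordinates `y`. -/
def coordVec (c : M) (y : Euc n) (i : Fin n) :
    TangentSpace (𝓡 n) ((extChartAt (𝓡 n) c).symm y) :=
  mfderiv 𝓘(ℝ, Euc n) (𝓡 n) (extChartAt (𝓡 n) c).symm y (EuclideanSpace.single i (1 : ℝ))

/-- The components `αₖ` of a covector field in the chart at `c`. -/
def comp₁ (α : CovectorField n M) (c : M) (y : Euc n) (k : Fin n) : ℝ :=
  α _ (coordVec c y k)

/-- The components `T_{ij}` of a field of bilinear forms in the chart at `c`. -/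
def comp₂ (T : BilinField n M) (c : M) (y : Euc n) : Matrix (Fin n) (Fin n) ℝ :=
  Matrix.of fun i j => T _ (coordVec c y i) (coordVec c y j)

/-- The components `D_{kij}` of a field of trilinear forms in the chart at `c`. -/
def comp₃ (D : TrilinField n M) (c : M) (y : Euc n) (k i j : Fin n) : ℝ :=
  D _ (coordVec c y k) (coordVec c y i) (coordVec c y j)

/-! ### Volume and classical scalar curvature of a metric -/

/-- The Riemannian measure `μ_g` of a metric `g`: the least measure that dominates, for every
chart, the coordinate volume `√(det g_{ij}) dy` of that chart.  (Each coordinate volume is the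
restriction of `μ_g` to the chart domain, and countably many chart domains cover `M`.) -/
def riemannianVolume [MeasurableSpace M] (g : BilinField n M) : Measure M :=
  ⨆ c : M, Measure.map (extChartAt (𝓡 n) c).symm
    ((volume.restrict (extChartAt (𝓡 n) c).target).withDensity
      fun y => ENNReal.ofReal (Real.sqrt (comp₂ g c y).det))

/-- The continuous density `dμ_g/dμ_h = √(det g_{ij} / det h_{ij})`. -/
def volumeDensity (h g : BilinField n M) (x : M) : ℝ :=
  Real.sqrt ((comp₂ g x (extChartAt (𝓡 n) x x)).det / (comp₂ h x (extChartAt (𝓡 n) x x)).det)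

/-- The classical scalar curvature `R_g = g^{ij} R_{ij}` at a point near which `g` is smooth. -/
def scalarCurvature (g : BilinField n M) (x : M) : ℝ :=
  ∑ i, ∑ j, (comp₂ g x (extChartAt (𝓡 n) x x))⁻¹ i j *
    ricciCoord (comp₂ g x) (extChartAt (𝓡 n) x x) i j

/-! ### Weak derivatives on the manifold -/

/-- The covector field `α` is the weak differential of the function `f`. -/
def HasWeakDifferential (f : M → ℝ) (α : CovectorField n M) : Prop :=
  ∀ (c : M) (k : Fin n), HasWeakPartialDeriv (extChartAt (𝓡 n) c).target
    (fun y => f ((extChartAt (𝓡 n) c).symm y)) k (fun y => comp₁ α c y k)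

/-- The weak differential of `f`, unique up to null sets (`0` if there is none). -/
def weakDifferential (n : ℕ) {M : Type*} [TopologicalSpace M] [ChartedSpace (Euc n) M]
    (f : M → ℝ) : CovectorField n M :=
  haveI := Classical.propDecidable (∃ α : CovectorField n M, HasWeakDifferential f α)
  if hf : ∃ α : CovectorField n M, HasWeakDifferential f α then hf.choose else fun _ => 0

/-- `D` is the weak covariant derivative of `g` for the Levi-Civita connection of the smooth
metric `h`, i.e. `∂ₖ g_{ij} = D_{kij} + Γ^l_{ki} g_{lj} + Γ^l_{kj} g_{il}` weakly in every chart,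
where `Γ` are the Christoffel symbols of `h`. -/
def HasWeakCovDeriv (h g : BilinField n M) (D : TrilinField n M) : Prop :=
  ∀ (c : M) (k i j : Fin n), HasWeakPartialDeriv (extChartAt (𝓡 n) c).target
    (fun y => comp₂ g c y i j) k
    (fun y => comp₃ D c y k i j
      + ∑ l, christoffel (comp₂ h c) y l k i * comp₂ g c y l j
      + ∑ l, christoffel (comp₂ h c) y l k j * comp₂ g c y i l)

/-- The weak covariant derivative of `g`, unique up to null sets (`0` if there is none). -/
def weakCovDeriv (h g : BilinField n M) : TrilinField n M :=
  haveI := Classical.propDecidable (∃ D : TrilinField n M, HasWeakCovDeriv h g D)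
  if hg : ∃ D : TrilinField n M, HasWeakCovDeriv h g D then hg.choose else fun _ => 0

/-- `g ∈ W^{1,p}_loc(M)`. -/
def MemW1pLoc (h g : BilinField n M) (p : ℝ≥0∞) : Prop :=
  (∀ (c : M) (i j : Fin n), MemLpLocOn p (extChartAt (𝓡 n) c).target
    fun y => comp₂ g c y i j) ∧
  ∃ D : TrilinField n M, HasWeakCovDeriv h g D ∧
    ∀ (c : M) (k i j : Fin n), MemLpLocOn p (extChartAt (𝓡 n) c).target
      fun y => comp₃ D c y k i j

/-! ### Distributional scalar curvature

In the following definitions `D` stands for the weak covariant derivative of `g`, and everything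
is written in the components of the chart at `c`, at the point with coordinates `y`. -/

/-- `Γ^k_{ij} = ½ g^{kl} (∇ᵢ g_{jl} + ∇ⱼ g_{il} - ∇ₗ g_{ij})`. -/
def diffGamma (g : BilinField n M) (D : TrilinField n M) (c : M) (y : Euc n)
    (k i j : Fin n) : ℝ :=
  (1 / 2 : ℝ) * ∑ l, (comp₂ g c y)⁻¹ k l *
    (comp₃ D c y i j l + comp₃ D c y j i l - comp₃ D c y l i j)

/-- `V^k = g^{ij} Γ^k_{ij} - g^{ik} Γ^j_{ji}`. -/
def vectorV (g : BilinField n M) (D : TrilinField n M) (c : M) (y : Euc n) (k : Fin n) : ℝ :=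
  ∑ i, ∑ j, ((comp₂ g c y)⁻¹ i j * diffGamma g D c y k i j
    - (comp₂ g c y)⁻¹ i k * diffGamma g D c y j j i)

/-- `∇ₖ g^{ij} = - g^{ia} g^{jb} ∇ₖ g_{ab}`, the covariant derivative of the inverse metric. -/
def covDerivInv (g : BilinField n M) (D : TrilinField n M) (c : M) (y : Euc n)
    (k i j : Fin n) : ℝ :=
  - ∑ a, ∑ b, (comp₂ g c y)⁻¹ i a * (comp₂ g c y)⁻¹ j b * comp₃ D c y k a b

/-- `F = tr_g Ric_h - ∇ₖ g^{ij} Γ^k_{ij} + ∇ₖ g^{ik} Γ^j_{ji}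
      + g^{ij} (Γ^k_{kl} Γ^l_{ij} - Γ^k_{jl} Γ^l_{ik})`. -/
def scalarF (h g : BilinField n M) (D : TrilinField n M) (c : M) (y : Euc n) : ℝ :=
  (∑ i, ∑ j, (comp₂ g c y)⁻¹ i j * ricciCoord (comp₂ h c) y i j)
  - (∑ k, ∑ i, ∑ j, covDerivInv g D c y k i j * diffGamma g D c y k i j)
  + (∑ k, ∑ i, ∑ j, covDerivInv g D c y k i k * diffGamma g D c y j j i)
  + ∑ i, ∑ j, (comp₂ g c y)⁻¹ i j * ∑ k, ∑ l,
      (diffGamma g D c y k k l * diffGamma g D c y l i j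
        - diffGamma g D c y k j l * diffGamma g D c y l i k)

/-- The integrand `- V · ∇(φ dμ_g/dμ_h) + F φ dμ_g/dμ_h` at `x`; it does not depend on the
chart used to evaluate it. -/
def distScalarIntegrand (h g : BilinField n M) (φ : M → ℝ) (x : M) : ℝ :=
  - (∑ k, vectorV g (weakCovDeriv h g) x (extChartAt (𝓡 n) x x) k *
      comp₁ (weakDifferential n fun z => φ z * volumeDensity h g z) x (extChartAt (𝓡 n) x x) k)
  + scalarF h g (weakCovDeriv h g) x (extChartAt (𝓡 n) x x) * (φ x * volumeDensity h g x)

/-- The distributional scalar curvature `⟨R_g, φ⟩` of `g`, computed with the smooth background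
metric `h`. -/
def distScalarCurvature [MeasurableSpace M] (h g : BilinField n M) (φ : M → ℝ) : ℝ :=
  ∫ x, distScalarIntegrand h g φ x ∂(riemannianVolume h)

end Manifold

/-- The metric tensor of a Riemannian manifold, as a field of bilinear forms. -/
def metricTensor (n : ℕ) (M : Type*) [TopologicalSpace M] [ChartedSpace (Euc n) M]
    [RiemannianBundle (fun x : M => TangentSpace (𝓡 n) x)] : BilinField n M :=
  (RiemannianBundle.g : RiemannianMetric (fun x : M => TangentSpace (𝓡 n) x)).inner

end

/-! Where g is smooth, its Levi-Civita connection is that of h plus the tensor Γ, and tracing the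
difference of the Ricci tensors gives R_g = div_h V + F (`contracted_ricciCoord`, resting on the
algebraic identity `contracted_ricci_sub`). Integrating by parts against the density of g shows that
⟨R_g - a, ψ⟩ is the integral of (R_g - a)ψ dμ_g for every test function ψ supported off S, hence
nonnegative when ψ is (`integral_scalar_nonneg_of_smooth`). The content of the theorem is that S is
removable for this inequality.

In coordinates the pairing reads ∫ (B^k ∂_k φ + E φ), where B = -V √det g lies in L^p_loc and E in
L^1_loc: F and the product of V with the logarithmic derivative of the density are at most quadratic
in the first derivatives of g, and p ≥ n ≥ 2. Test with (1 - η_j)φ, where η_j = 1 near S and the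
supports of η_j shrink to S. As S is Lebesgue null, dominated convergence handles every term except
∫ φ B^k ∂_k η_j. With q = p/(p-1), Hölder bounds it by the L^p norm of φB on the support of η_j
times the L^q norm of dη_j. If p < ∞ the first factor tends to zero and the second need only stay
bounded, for which finite H^{n-q} is enough; if p = ∞ the first is only bounded, and H^{n-1}(S) = 0
makes the second tend to zero. This is `integral_nonneg_of_removable`, fed by `exists_cutoff_seq`.

The cutoffs come from a finite cover by balls of radius r_i with Σ r_i^{n-q} controlled. A bump on
one ball has q-energy of order r_i^{n-q}. The bumps ζ_i are combined as a smooth step function of Σ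
ζ_i²: Cauchy-Schwarz bounds the squared gradient by a constant times Σ |dζ_i|², and because q ≤ 2
the power q/2 is subadditive, so the energies add up with no control on the overlap of the balls
(`exists_cutoff`).

The rest makes this meaningful on M. A chain rule for continuous functions with weak derivatives,
proved by mollification, supplies the weak differential of the density
(`HasWeakPartialDeriv.comp_contDiffOn`, `hasWeakPartialDeriv_density`). The integrand at x is
defined in the chart centred at x, so V·α, F and the scalar curvature must be shown invariant under
coordinate changes (`sum_contractedVector_transform`, `quadraticPart_transform`,
`contracted_ricciCoord_transform`), which yields a formula valid almost everywhere in a fixed chart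
(`distScalarIntegrand_chart_ae`). The measure of a metric is the coordinate volume on each chart
domain (`riemannianVolume_restrict_source`); charts are locally Lipschitz for the distance of h, so
the Hausdorff hypothesis descends to charts (`exists_hausdorffMeasure_chart_le`); and a partition of
unity reduces to one chart (`distScalar_global`). -/

/-! ### Pointwise tensor algebra -/

/-- `½ A^{kl} (D_{ijl} + D_{jil} - D_{lij})`. -/
noncomputable def koszul {n : ℕ} (A : Matrix (Fin n) (Fin n) ℝ) (D : Fin n → Fin n → Fin n → ℝ)
    (k i j : Fin n) : ℝ :=
  (1 / 2 : ℝ) * ∑ l, A k l * (D i j l + D j i l - D l i j)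

/-- `A^{ij} γ^k_{ij} - A^{ik} γ^j_{ji}`. -/
def contractedVector {n : ℕ} (A : Matrix (Fin n) (Fin n) ℝ) (γ : Fin n → Fin n → Fin n → ℝ)
    (k : Fin n) : ℝ :=
  ∑ i, ∑ j, (A i j * γ k i j - A i k * γ j j i)

/-- `- A^{ia} A^{jb} D_{kab}`. -/
def raisedDeriv {n : ℕ} (A : Matrix (Fin n) (Fin n) ℝ) (D : Fin n → Fin n → Fin n → ℝ)
    (k i j : Fin n) : ℝ :=
  - ∑ a, ∑ b, A i a * A j b * D k a b

/-- The part of the scalar `F` that is quadratic in the derivatives of the metric. -/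
def quadraticPart {n : ℕ} (A : Matrix (Fin n) (Fin n) ℝ) (C γ : Fin n → Fin n → Fin n → ℝ) : ℝ :=
  - (∑ k, ∑ i, ∑ j, C k i j * γ k i j) + (∑ k, ∑ i, ∑ j, C k i k * γ j j i)
  + ∑ i, ∑ j, A i j * ∑ k, ∑ l, (γ k k l * γ l i j - γ k j l * γ l i k)

/-- The Ricci tensor formula in terms of the connection coefficients `Γ k i j` and their
derivatives `dΓ m k i j`. -/
def ricciExpr {n : ℕ} (Γ : Fin n → Fin n → Fin n → ℝ) (dΓ : Fin n → Fin n → Fin n → Fin n → ℝ)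
    (i j : Fin n) : ℝ :=
  ∑ k, (dΓ k k i j - dΓ j k i k + ∑ l, (Γ k k l * Γ l i j - Γ k j l * Γ l i k))

section algebra
variable {n : ℕ}

lemma koszul_symm (A : Matrix (Fin n) (Fin n) ℝ) {D : Fin n → Fin n → Fin n → ℝ}
    (hD : ∀ k i j, D k i j = D k j i) (k i j : Fin n) : koszul A D k i j = koszul A D k j i := by
  unfold koszul
  congr 1
  refine Finset.sum_congr rfl fun l _ => ?_
  rw [hD l i j]; ring

lemma koszul_sub (A : Matrix (Fin n) (Fin n) ℝ) (D D' : Fin n → Fin n → Fin n → ℝ)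
    (k i j : Fin n) :
    koszul A (fun k i j => D k i j - D' k i j) k i j = koszul A D k i j - koszul A D' k i j := by
  unfold koszul
  rw [← mul_sub, ← Finset.sum_sub_distrib]
  congr 1
  refine Finset.sum_congr rfl fun l _ => ?_
  ring

/-- Uniqueness of the torsion-free metric connection, at one point: in the combination `D i j l + D
j i l - D l i j` symmetry of `γ` cancels all but twice the lowered `γ`, which `A` raises again.
Connections are identified below by checking symmetry and compatibility and then citing this. -/
lemma koszul_eq {A G : Matrix (Fin n) (Fin n) ℝ} (hAG : A * G = 1) (hG : ∀ i j, G i j = G j i)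
    {γ : Fin n → Fin n → Fin n → ℝ} (hγ : ∀ k i j, γ k i j = γ k j i)
    {D : Fin n → Fin n → Fin n → ℝ}
    (hD : ∀ k i j, D k i j = ∑ l, γ l k i * G l j + ∑ l, γ l k j * G i l) (k i j : Fin n) :
    koszul A D k i j = γ k i j := by
  unfold koszul
  have h1 : ∀ l, D i j l + D j i l - D l i j = 2 * ∑ m, G l m * γ m i j := by
    intro l
    rw [hD, hD, hD, Finset.mul_sum]
    simp only [← Finset.sum_add_distrib, ← Finset.sum_sub_distrib]
    refine Finset.sum_congr rfl fun m _ => ?_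
    rw [hγ m j i, hγ m l i, hγ m l j, hG l m, hG j m, hG i m]; ring
  have h2 : ∀ m, ∑ l, A k l * G l m = if k = m then 1 else 0 := by
    intro m
    rw [← Matrix.mul_apply, hAG, Matrix.one_apply]
  simp only [h1, Finset.mul_sum]
  rw [Finset.sum_comm]
  calc _ = ∑ m, (∑ l, A k l * G l m) * γ m i j := by
        refine Finset.sum_congr rfl fun m _ => ?_
        rw [Finset.sum_mul]
        refine Finset.sum_congr rfl fun l _ => ?_
        ring
    _ = _ := by simp [h2]

/-- The existence half: lowering the index of the Koszul expression leaves half of three terms in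
`D`, and in the sum over both slots the unwanted ones cancel by symmetry of `D`. -/
lemma koszul_compat {A G : Matrix (Fin n) (Fin n) ℝ} (hGA : G * A = 1)
    (hG : ∀ i j, G i j = G j i) {D : Fin n → Fin n → Fin n → ℝ}
    (hD : ∀ k i j, D k i j = D k j i) (k i j : Fin n) :
    ∑ l, koszul A D l k i * G l j + ∑ l, koszul A D l k j * G i l = D k i j := by
  have key : ∀ a b c, ∑ l, G c l * koszul A D l a b = (1 / 2 : ℝ) * (D a b c + D b a c - D c a b) := by
    intro a b c
    have h2 : ∀ m, ∑ l, G c l * A l m = if c = m then 1 else 0 := by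
      intro m
      rw [← Matrix.mul_apply, hGA, Matrix.one_apply]
    unfold koszul
    simp only [Finset.mul_sum]
    rw [Finset.sum_comm]
    calc _ = ∑ m, (∑ l, G c l * A l m) * ((1 / 2 : ℝ) * (D a b m + D b a m - D m a b)) := by
          refine Finset.sum_congr rfl fun m _ => ?_
          rw [Finset.sum_mul]
          refine Finset.sum_congr rfl fun l _ => ?_
          ring
      _ = _ := by simp [h2]
  have e1 : ∑ l, koszul A D l k i * G l j = ∑ l, G j l * koszul A D l k i :=
    Finset.sum_congr rfl fun l _ => by rw [hG l j, mul_comm]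
  have e2 : ∑ l, koszul A D l k j * G i l = ∑ l, G i l * koszul A D l k j :=
    Finset.sum_congr rfl fun l _ => by rw [mul_comm]
  rw [e1, e2, key, key, hD k i j, hD j k i, hD i k j]; ring

lemma sum_rotate₄ (f : Fin n → Fin n → Fin n → Fin n → ℝ) :
    ∑ a, ∑ b, ∑ c, ∑ d, f a b c d = ∑ d, ∑ a, ∑ b, ∑ c, f a b c d := by
  calc _ = ∑ a, ∑ d, ∑ b, ∑ c, f a b c d :=
        Finset.sum_congr rfl fun a _ => Finset.sum_comm_cycle
    _ = _ := Finset.sum_comm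

lemma sum_swap₂₃ (f : Fin n → Fin n → Fin n → Fin n → ℝ) :
    ∑ a, ∑ b, ∑ c, ∑ d, f a b c d = ∑ a, ∑ c, ∑ b, ∑ d, f a b c d :=
  Finset.sum_congr rfl fun _ _ => Finset.sum_comm

lemma sum_swap₃₄ (f : Fin n → Fin n → Fin n → Fin n → ℝ) :
    ∑ a, ∑ b, ∑ c, ∑ d, f a b c d = ∑ a, ∑ b, ∑ d, ∑ c, f a b c d :=
  Finset.sum_congr rfl fun _ _ => Finset.sum_congr rfl fun _ _ => Finset.sum_comm

lemma sum_congr₄ {f g : Fin n → Fin n → Fin n → Fin n → ℝ} (h : ∀ a b c d, f a b c d = g a b c d) :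
    ∑ a, ∑ b, ∑ c, ∑ d, f a b c d = ∑ a, ∑ b, ∑ c, ∑ d, g a b c d := by
  simp only [h]

/-- The contraction of the difference of two Ricci tensors, in terms of the difference `γ` of the
connections, the derivative `dA` of the inverse metric `A` and its covariant derivative `C`. -/
lemma contracted_ricci_sub {A : Matrix (Fin n) (Fin n) ℝ}
    {Γ γ : Fin n → Fin n → Fin n → ℝ} (hΓ : ∀ k i j, Γ k i j = Γ k j i)
    (hγ : ∀ k i j, γ k i j = γ k j i)
    {dΓ dγ : Fin n → Fin n → Fin n → Fin n → ℝ} (hdγ : ∀ m k i j, dγ m k i j = dγ m k j i)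
    {dA C : Fin n → Fin n → Fin n → ℝ}
    (hC : ∀ k i j, C k i j = dA k i j + ∑ l, Γ i k l * A l j + ∑ l, Γ j k l * A i l) :
    ∑ i, ∑ j, A i j * ricciExpr (fun k i j => Γ k i j + γ k i j)
        (fun m k i j => dΓ m k i j + dγ m k i j) i j
      = ∑ k, ∑ i, ∑ j, (dA k i j * γ k i j + A i j * dγ k k i j
          - (dA k i k * γ j j i + A i k * dγ k j j i))
        + ∑ k, (∑ j, Γ j j k) * contractedVector A γ k
        + (∑ i, ∑ j, A i j * ricciExpr Γ dΓ i j + quadraticPart A C γ) := by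
  -- Ricci is quadratic in the connection, so besides the pure `Γ` and pure `γ` parts there are
  -- mixed terms `Γ * γ`. They are matched with the `Γ`-terms contained in `C` and in the trace term
  -- `Γ^j_{jk} V^k`, while the `dA` terms cancel between `C` and the divergence. Only renaming of
  -- summation indices and symmetry are needed.
  unfold ricciExpr quadraticPart contractedVector
  simp only [hC, Finset.mul_sum, Finset.sum_mul, Finset.sum_add_distrib, Finset.sum_sub_distrib,
    mul_add, add_mul, mul_sub]
  -- divergence terms
  have d1 : ∑ i, ∑ j, ∑ k, A i j * dγ k k i j = ∑ k, ∑ i, ∑ j, A i j * dγ k k i j := by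
    rw [Finset.sum_comm_cycle]
  have d2 : ∑ i, ∑ j, ∑ k, A i j * dγ j k i k = ∑ k, ∑ i, ∑ j, A i k * dγ k j j i := by
    rw [Finset.sum_comm]
    exact Finset.sum_congr rfl fun j _ => Finset.sum_congr rfl fun i _ =>
      Finset.sum_congr rfl fun k _ => by rw [hdγ]
  -- connection terms
  have c1 : ∑ i, ∑ j, ∑ k, ∑ l, A i j * (Γ k k l * γ l i j)
      = ∑ l, ∑ i, ∑ j, ∑ k, Γ k k l * (A i j * γ l i j) := by
    rw [sum_rotate₄]
    exact sum_congr₄ fun _ _ _ _ => by ring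
  have c2 : ∑ i, ∑ j, ∑ k, ∑ l, A i j * (γ k k l * Γ l i j)
      = ∑ j, ∑ l, ∑ k, ∑ i, Γ l j i * A i j * γ k k l := by
    rw [sum_rotate₄, sum_rotate₄, sum_rotate₄, sum_swap₂₃]
    exact sum_congr₄ fun j l k i => by rw [hΓ l j i]; ring
  have c3 : ∑ k, ∑ i, ∑ j, ∑ l, Γ l l k * (A i k * γ j j i)
      = ∑ l, ∑ i, ∑ j, ∑ k, Γ l l k * A i k * γ j j i := by
    rw [sum_rotate₄, sum_swap₂₃, sum_swap₃₄]
    exact sum_congr₄ fun _ _ _ _ => by ring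
  have c4 : ∑ i, ∑ j, ∑ k, ∑ l, A i j * (γ k j l * Γ l i k)
      = ∑ k, ∑ l, ∑ j, ∑ i, Γ l k i * A i j * γ k l j := by
    rw [sum_rotate₄, sum_rotate₄, sum_swap₃₄]
    exact sum_congr₄ fun k l j i => by rw [hΓ l i k, hγ k j l]; ring
  have c5 : ∑ i, ∑ j, ∑ k, ∑ l, A i j * (Γ k j l * γ l i k)
      = ∑ l, ∑ i, ∑ k, ∑ j, Γ k l j * A i j * γ l i k := by
    rw [sum_rotate₄, sum_swap₃₄]
    exact sum_congr₄ fun l i k j => by rw [hΓ k j l]; ring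
  rw [d1, d2, c1, c2, c3, c4, c5]
  ring

end algebra

/-! ### Partial derivatives and smooth coefficient matrices -/

section calculus
variable {n : ℕ}

lemma partialDeriv_add {f g : Euc n → ℝ} {y : Euc n} (hf : DifferentiableAt ℝ f y)
    (hg : DifferentiableAt ℝ g y) (k : Fin n) :
    partialDeriv (fun z => f z + g z) k y = partialDeriv f k y + partialDeriv g k y := by
  simp [partialDeriv, fderiv_fun_add hf hg]

lemma partialDeriv_sub {f g : Euc n → ℝ} {y : Euc n} (hf : DifferentiableAt ℝ f y)
    (hg : DifferentiableAt ℝ g y) (k : Fin n) :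
    partialDeriv (fun z => f z - g z) k y = partialDeriv f k y - partialDeriv g k y := by
  simp [partialDeriv, fderiv_fun_sub hf hg]

lemma partialDeriv_mul {f g : Euc n → ℝ} {y : Euc n} (hf : DifferentiableAt ℝ f y)
    (hg : DifferentiableAt ℝ g y) (k : Fin n) :
    partialDeriv (fun z => f z * g z) k y
      = partialDeriv f k y * g y + f y * partialDeriv g k y := by
  simp [partialDeriv, fderiv_fun_mul hf hg]; ring

lemma partialDeriv_sum {ι : Type*} {s : Finset ι} {f : ι → Euc n → ℝ} {y : Euc n}
    (hf : ∀ i ∈ s, DifferentiableAt ℝ (f i) y) (k : Fin n) :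
    partialDeriv (fun z => ∑ i ∈ s, f i z) k y = ∑ i ∈ s, partialDeriv (f i) k y := by
  simp [partialDeriv, fderiv_fun_sum hf]

lemma partialDeriv_const (c : ℝ) (k : Fin n) (y : Euc n) :
    partialDeriv (fun _ => c) k y = 0 := by
  simp [partialDeriv]

lemma Filter.EventuallyEq.partialDeriv_eq {f g : Euc n → ℝ} {y : Euc n} (h : f =ᶠ[nhds y] g)
    (k : Fin n) : partialDeriv f k y = partialDeriv g k y := by
  unfold partialDeriv; rw [h.fderiv_eq]

lemma partialDeriv_congr {f g : Euc n → ℝ} {V : Set (Euc n)} (hV : IsOpen V)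
    (h : ∀ z ∈ V, f z = g z) {y : Euc n} (hy : y ∈ V) (k : Fin n) :
    partialDeriv f k y = partialDeriv g k y :=
  Filter.EventuallyEq.partialDeriv_eq (Filter.eventually_of_mem (hV.mem_nhds hy) h) k

lemma ContDiffOn.partialDeriv {f : Euc n → ℝ} {V : Set (Euc n)} (hV : IsOpen V)
    (hf : ContDiffOn ℝ ∞ f V) (k : Fin n) : ContDiffOn ℝ ∞ (partialDeriv f k) V := by
  unfold _root_.partialDeriv
  exact (hf.fderiv_of_isOpen hV (by simp)).clm_apply contDiffOn_const

lemma ContDiffOn.differentiableAt_of_isOpen {f : Euc n → ℝ} {V : Set (Euc n)} (hV : IsOpen V)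
    (hf : ContDiffOn ℝ ∞ f V) {y : Euc n} (hy : y ∈ V) : DifferentiableAt ℝ f y :=
  (hf.contDiffAt (hV.mem_nhds hy)).differentiableAt (by simp)

lemma partialDeriv_comm {f : Euc n → ℝ} {V : Set (Euc n)} (hV : IsOpen V)
    (hf : ContDiffOn ℝ ∞ f V) {y : Euc n} (hy : y ∈ V) (i j : Fin n) :
    partialDeriv (partialDeriv f i) j y = partialDeriv (partialDeriv f j) i y := by
  have h := (hf.contDiffAt (hV.mem_nhds hy)).isSymmSndFDerivAt
    (by simp only [minSmoothness_of_isRCLikeNormedField]; exact ENat.LEInfty.out)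
  have hd : DifferentiableAt ℝ (fderiv ℝ f) y :=
    ((hf.fderiv_of_isOpen hV (m := ∞) (by simp)).contDiffAt (hV.mem_nhds hy)).differentiableAt
      (by simp)
  have e : ∀ a b, _root_.partialDeriv (_root_.partialDeriv f a) b y
      = fderiv ℝ (fderiv ℝ f) y (EuclideanSpace.single b 1) (EuclideanSpace.single a 1) := by
    intro a b
    unfold _root_.partialDeriv
    rw [fderiv_clm_apply hd (differentiableAt_const _)]
    simp
  rw [e, e]
  exact h _ _

/-- The determinant as a continuous multilinear function of the rows. -/
def detMultilinear (n : ℕ) : ContinuousMultilinearMap ℝ (fun _ : Fin n => Fin n → ℝ) ℝ where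
  toMultilinearMap := (Matrix.detRowAlternating (R := ℝ) (n := Fin n)).toMultilinearMap
  cont := by
    change Continuous fun M : Matrix (Fin n) (Fin n) ℝ => M.det
    exact continuous_id.matrix_det

/-- Varying one row of the determinant and expanding along that row produces the cofactors. -/
lemma linearDeriv_detMultilinear (M E : Fin n → Fin n → ℝ) :
    (detMultilinear n).linearDeriv M E
      = ∑ i, ∑ j, (Matrix.of M).adjugate j i * E i j := by
  rw [ContinuousMultilinearMap.linearDeriv_apply]
  refine Finset.sum_congr rfl fun i _ => ?_
  have h := Matrix.det_eq_sum_mul_adjugate_row ((Matrix.of M).updateRow i (E i)) i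
  have h2 : detMultilinear n (Function.update M i (E i))
      = ((Matrix.of M).updateRow i (E i)).det := rfl
  rw [h2, h]
  refine Finset.sum_congr rfl fun j _ => ?_
  rw [Matrix.adjugate_apply, Matrix.adjugate_apply, Matrix.updateRow_idem, Matrix.updateRow_self,
    mul_comm]

/-- Jacobi's formula. -/
lemma partialDeriv_det {G : Euc n → Matrix (Fin n) (Fin n) ℝ} {y : Euc n}
    (hG : ∀ i j, DifferentiableAt ℝ (fun z => G z i j) y) (k : Fin n) :
    partialDeriv (fun z => (G z).det) k y
      = ∑ i, ∑ j, (G y).adjugate j i * partialDeriv (fun z => G z i j) k y := by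
  have h1 : HasFDerivAt (fun z => (fun i j => G z i j : Fin n → Fin n → ℝ))
      (ContinuousLinearMap.pi fun i => ContinuousLinearMap.pi fun j =>
        fderiv ℝ (fun z => G z i j) y) y := by
    rw [hasFDerivAt_pi]
    intro i
    rw [hasFDerivAt_pi]
    exact fun j => (hG i j).hasFDerivAt
  have h2 := ((detMultilinear n).hasFDerivAt (x := fun i j => G y i j)).comp y h1
  have h3 : (⇑(detMultilinear n) ∘ fun z => (fun i j => G z i j : Fin n → Fin n → ℝ))
      = fun z => (G z).det := rfl
  rw [h3] at h2
  unfold partialDeriv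
  rw [h2.fderiv, ContinuousLinearMap.comp_apply, linearDeriv_detMultilinear]
  rfl

/-- Smooth positive definite coefficient matrices on `V`. -/
structure IsSmoothMetricOn (V : Set (Euc n)) (G : Euc n → Matrix (Fin n) (Fin n) ℝ) : Prop where
  contDiffOn : ∀ i j, ContDiffOn ℝ ∞ (fun y => G y i j) V
  posDef : ∀ y ∈ V, (G y).PosDef

namespace IsSmoothMetricOn
variable {V : Set (Euc n)} {G H : Euc n → Matrix (Fin n) (Fin n) ℝ} {y : Euc n}

lemma mono {V' : Set (Euc n)} (hG : IsSmoothMetricOn V G) (h : V' ⊆ V) : IsSmoothMetricOn V' G :=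
  ⟨fun i j => (hG.contDiffOn i j).mono h, fun y hy => hG.posDef y (h hy)⟩

end IsSmoothMetricOn

lemma Matrix.PosDef.apply_symm {G : Matrix (Fin n) (Fin n) ℝ} (hG : G.PosDef) (i j : Fin n) :
    G i j = G j i := by
  have := congrFun (congrFun hG.isHermitian i) j
  simpa using this.symm

lemma Matrix.PosDef.mul_inv {G : Matrix (Fin n) (Fin n) ℝ} (hG : G.PosDef) : G * G⁻¹ = 1 :=
  Matrix.mul_nonsing_inv _ hG.det_pos.ne'.isUnit

lemma Matrix.PosDef.inv_mul {G : Matrix (Fin n) (Fin n) ℝ} (hG : G.PosDef) : G⁻¹ * G = 1 :=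
  Matrix.nonsing_inv_mul _ hG.det_pos.ne'.isUnit

lemma Matrix.PosDef.inv_symm {G : Matrix (Fin n) (Fin n) ℝ} (hG : G.PosDef) (i j : Fin n) :
    G⁻¹ i j = G⁻¹ j i := hG.inv.apply_symm i j

lemma contDiffOn_det {m : WithTop ℕ∞} {E : Type*} [NormedAddCommGroup E] [NormedSpace ℝ E]
    {V : Set E} {G : E → Matrix (Fin n) (Fin n) ℝ}
    (hG : ∀ i j, ContDiffOn ℝ m (fun y => G y i j) V) :
    ContDiffOn ℝ m (fun y => (G y).det) V := by
  simp only [Matrix.det_apply']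
  exact ContDiffOn.sum fun σ _ => contDiffOn_const.mul (contDiffOn_prod fun i _ => hG _ _)

lemma contDiffOn_adjugate {m : WithTop ℕ∞} {E : Type*} [NormedAddCommGroup E] [NormedSpace ℝ E]
    {V : Set E} {G : E → Matrix (Fin n) (Fin n) ℝ}
    (hG : ∀ i j, ContDiffOn ℝ m (fun y => G y i j) V) (i j : Fin n) :
    ContDiffOn ℝ m (fun y => (G y).adjugate i j) V := by
  simp only [Matrix.adjugate_apply]
  refine contDiffOn_det fun a b => ?_
  by_cases h : a = j
  · subst h; simp only [Matrix.updateRow_self]; exact contDiffOn_const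
  · simp only [Matrix.updateRow_ne h]; exact hG a b

lemma contDiffOn_matrix_inv {m : WithTop ℕ∞} {E : Type*} [NormedAddCommGroup E] [NormedSpace ℝ E]
    {V : Set E} {G : E → Matrix (Fin n) (Fin n) ℝ}
    (hG : ∀ i j, ContDiffOn ℝ m (fun y => G y i j) V) (hd : ∀ y ∈ V, (G y).det ≠ 0)
    (i j : Fin n) : ContDiffOn ℝ m (fun y => (G y)⁻¹ i j) V := by
  simp only [Matrix.inv_def, Matrix.smul_apply, smul_eq_mul, Ring.inverse_eq_inv]
  exact ((contDiffOn_det hG).inv hd).mul (contDiffOn_adjugate hG i j)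

namespace IsSmoothMetricOn
variable {V : Set (Euc n)} {G H : Euc n → Matrix (Fin n) (Fin n) ℝ} {y : Euc n}

lemma contDiffOn_inv_apply (hG : IsSmoothMetricOn V G) (i j : Fin n) :
    ContDiffOn ℝ ∞ (fun y => (G y)⁻¹ i j) V :=
  contDiffOn_matrix_inv hG.contDiffOn (fun y hy => (hG.posDef y hy).det_pos.ne') i j

lemma contDiffOn_sqrt_det (hG : IsSmoothMetricOn V G) :
    ContDiffOn ℝ ∞ (fun y => Real.sqrt (G y).det) V :=
  (contDiffOn_det hG.contDiffOn).sqrt fun y hy => (hG.posDef y hy).det_pos.ne'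

lemma contDiffOn_christoffel (hV : IsOpen V) (hG : IsSmoothMetricOn V G) (k i j : Fin n) :
    ContDiffOn ℝ ∞ (fun y => christoffel G y k i j) V := by
  unfold christoffel
  refine contDiffOn_const.mul (ContDiffOn.sum fun l _ => (hG.contDiffOn_inv_apply k l).mul ?_)
  exact ((ContDiffOn.partialDeriv hV (hG.contDiffOn _ _) _).add
    (ContDiffOn.partialDeriv hV (hG.contDiffOn _ _) _)).sub
    (ContDiffOn.partialDeriv hV (hG.contDiffOn _ _) _)

lemma differentiableAt (hV : IsOpen V) (hG : IsSmoothMetricOn V G) (hy : y ∈ V) (i j : Fin n) :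
    DifferentiableAt ℝ (fun z => G z i j) y :=
  (hG.contDiffOn i j).differentiableAt_of_isOpen hV hy

lemma partialDeriv_symm (hV : IsOpen V) (hG : IsSmoothMetricOn V G) (hy : y ∈ V) (k i j : Fin n) :
    partialDeriv (fun z => G z i j) k y = partialDeriv (fun z => G z j i) k y :=
  partialDeriv_congr hV (fun z hz => (hG.posDef z hz).apply_symm i j) hy k

lemma christoffel_symm (hV : IsOpen V) (hG : IsSmoothMetricOn V G) (hy : y ∈ V) (k i j : Fin n) :
    christoffel G y k i j = christoffel G y k j i :=
  koszul_symm (G y)⁻¹ (D := fun k i j => partialDeriv (fun z => G z i j) k y)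
    (fun k i j => hG.partialDeriv_symm hV hy k i j) k i j

lemma christoffel_compat (hV : IsOpen V) (hG : IsSmoothMetricOn V G) (hy : y ∈ V) (k i j : Fin n) :
    ∑ l, christoffel G y l k i * G y l j + ∑ l, christoffel G y l k j * G y i l
      = partialDeriv (fun z => G z i j) k y :=
  koszul_compat (hG.posDef y hy).mul_inv (hG.posDef y hy).apply_symm
    (D := fun k i j => partialDeriv (fun z => G z i j) k y)
    (fun k i j => hG.partialDeriv_symm hV hy k i j) k i j

/-- Differentiate `G⁻¹ * G = 1` entrywise and multiply on the right by `G⁻¹`. -/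
lemma partialDeriv_inv (hV : IsOpen V) (hG : IsSmoothMetricOn V G) (hy : y ∈ V) (k i j : Fin n) :
    partialDeriv (fun z => (G z)⁻¹ i j) k y
      = - ∑ a, ∑ b, (G y)⁻¹ i a * (G y)⁻¹ j b * partialDeriv (fun z => G z a b) k y := by
  have hA : ∀ a b, DifferentiableAt ℝ (fun z => (G z)⁻¹ a b) y := fun a b =>
    (hG.contDiffOn_inv_apply a b).differentiableAt_of_isOpen hV hy
  have hGd := fun a b => hG.differentiableAt hV hy a b
  have h1 : ∀ b, ∑ a, (partialDeriv (fun z => (G z)⁻¹ i a) k y * G y a b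
      + (G y)⁻¹ i a * partialDeriv (fun z => G z a b) k y) = 0 := by
    intro b
    have e : partialDeriv (fun z => ∑ a, (G z)⁻¹ i a * G z a b) k y = 0 := by
      rw [← partialDeriv_const ((1 : Matrix (Fin n) (Fin n) ℝ) i b) k y]
      refine partialDeriv_congr hV (fun z hz => ?_) hy k
      rw [← Matrix.mul_apply, (hG.posDef z hz).inv_mul]
    rw [partialDeriv_sum (fun a _ => (hA i a).fun_mul (hGd a b))] at e
    rw [← e]
    exact Finset.sum_congr rfl fun a _ => (partialDeriv_mul (hA i a) (hGd a b) k).symm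
  have h2 : ∑ b, (∑ a, (partialDeriv (fun z => (G z)⁻¹ i a) k y * G y a b
      + (G y)⁻¹ i a * partialDeriv (fun z => G z a b) k y)) * (G y)⁻¹ b j = 0 :=
    Finset.sum_eq_zero fun b _ => by rw [h1, zero_mul]
  simp only [Finset.sum_add_distrib, add_mul, Finset.sum_mul] at h2
  have h3 : ∑ b, ∑ a, partialDeriv (fun z => (G z)⁻¹ i a) k y * G y a b * (G y)⁻¹ b j
      = partialDeriv (fun z => (G z)⁻¹ i j) k y := by
    rw [Finset.sum_comm]
    have : ∀ a, ∑ b, partialDeriv (fun z => (G z)⁻¹ i a) k y * G y a b * (G y)⁻¹ b j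
        = partialDeriv (fun z => (G z)⁻¹ i a) k y * (1 : Matrix (Fin n) (Fin n) ℝ) a j := by
      intro a
      rw [← (hG.posDef y hy).mul_inv, Matrix.mul_apply, Finset.mul_sum]
      exact Finset.sum_congr rfl fun b _ => by ring
    simp [this, Matrix.one_apply]
  rw [h3] at h2
  rw [eq_neg_iff_add_eq_zero, ← h2, Finset.sum_comm]
  congr 1
  refine Finset.sum_congr rfl fun b _ => Finset.sum_congr rfl fun a _ => ?_
  rw [(hG.posDef y hy).inv_symm j b]; ring

lemma partialDeriv_sqrt_det (hV : IsOpen V) (hG : IsSmoothMetricOn V G) (hy : y ∈ V) (k : Fin n) :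
    partialDeriv (fun z => Real.sqrt (G z).det) k y
      = Real.sqrt (G y).det *
        ((1 / 2 : ℝ) * ∑ i, ∑ j, (G y)⁻¹ i j * partialDeriv (fun z => G z i j) k y) := by
  have hpos := (hG.posDef y hy).det_pos
  have hd : DifferentiableAt ℝ (fun z => (G z).det) y :=
    (contDiffOn_det hG.contDiffOn).differentiableAt_of_isOpen hV hy
  have e := partialDeriv_det (fun i j => hG.differentiableAt hV hy i j) k
  unfold partialDeriv at e ⊢
  rw [fderiv_sqrt hd hpos.ne', smul_apply, e, smul_eq_mul]
  have hadj : ∀ i j, (G y).adjugate j i = (G y).det * (G y)⁻¹ i j := by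
    intro i j
    rw [(hG.posDef y hy).inv_symm i j, Matrix.inv_def, Matrix.smul_apply, Ring.inverse_eq_inv,
      smul_eq_mul, mul_inv_cancel_left₀ hpos.ne']
  simp only [hadj, mul_assoc]
  simp only [← Finset.mul_sum]
  have hs : Real.sqrt (G y).det ≠ 0 := (Real.sqrt_pos.2 hpos).ne'
  have hss := Real.mul_self_sqrt hpos.le
  set s := Real.sqrt (G y).det
  rw [← hss]
  field_simp

/-- Under contraction with the symmetric inverse, two of the three derivatives in the Christoffel
symbol cancel. With `partialDeriv_sqrt_det` this makes the trace of the connection the logarithmic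
derivative of `√det G`, which turns covariant divergences into coordinate ones. -/
lemma sum_christoffel (hV : IsOpen V) (hG : IsSmoothMetricOn V G) (hy : y ∈ V) (k : Fin n) :
    (1 / 2 : ℝ) * ∑ i, ∑ j, (G y)⁻¹ i j * partialDeriv (fun z => G z i j) k y
      = ∑ j, christoffel G y j j k := by
  have hA := (hG.posDef y hy).inv_symm
  unfold christoffel
  rw [← Finset.mul_sum]
  congr 1
  simp only [mul_sub, mul_add, Finset.sum_add_distrib, Finset.sum_sub_distrib]
  have e1 : ∑ j, ∑ l, (G y)⁻¹ j l * partialDeriv (fun z => G z k l) j y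
      = ∑ j, ∑ l, (G y)⁻¹ j l * partialDeriv (fun z => G z j k) l y := by
    rw [Finset.sum_comm]
    refine Finset.sum_congr rfl fun a _ => Finset.sum_congr rfl fun b _ => ?_
    rw [hA b a, hG.partialDeriv_symm hV hy b k a]
  rw [e1]; ring

end IsSmoothMetricOn

/-! ### The difference of two Levi-Civita connections and the divergence formula for scalar
curvature -/

/-- The covariant derivative of `G` with respect to the Levi-Civita connection of `H`. -/
noncomputable def covDerivCoord (H G : Euc n → Matrix (Fin n) (Fin n) ℝ) (y : Euc n)
    (k i j : Fin n) : ℝ :=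
  partialDeriv (fun z => G z i j) k y
    - (∑ l, christoffel H y l k i * G y l j + ∑ l, christoffel H y l k j * G y i l)

/-- The difference of the Levi-Civita connections of `G` and `H`. -/
noncomputable def connectionDiff (H G : Euc n → Matrix (Fin n) (Fin n) ℝ) (y : Euc n) :
    Fin n → Fin n → Fin n → ℝ :=
  koszul (G y)⁻¹ (covDerivCoord H G y)

section difference
variable {V : Set (Euc n)} {G H : Euc n → Matrix (Fin n) (Fin n) ℝ} {y : Euc n}

lemma covDerivCoord_symm (hV : IsOpen V) (hG : IsSmoothMetricOn V G) (hy : y ∈ V) (k i j : Fin n) :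
    covDerivCoord H G y k i j = covDerivCoord H G y k j i := by
  unfold covDerivCoord
  rw [hG.partialDeriv_symm hV hy k i j]
  rw [add_comm (∑ l, christoffel H y l k i * G y l j)]
  congr 2 <;> exact Finset.sum_congr rfl fun l _ => by rw [(hG.posDef y hy).apply_symm]

/-- The Koszul expression is linear in `D`. The covariant derivative is the partial derivative minus
the two `christoffel H` terms, and on those terms the expression returns `christoffel H` by
`koszul_eq`, since that connection is symmetric. -/
lemma christoffel_eq_add (hV : IsOpen V) (hH : IsSmoothMetricOn V H) (hG : IsSmoothMetricOn V G)
    (hy : y ∈ V) (k i j : Fin n) :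
    christoffel G y k i j = christoffel H y k i j + connectionDiff H G y k i j := by
  have h := koszul_sub (G y)⁻¹ (fun k i j => partialDeriv (fun z => G z i j) k y)
    (fun k i j => ∑ l, christoffel H y l k i * G y l j + ∑ l, christoffel H y l k j * G y i l) k i j
  have h2 := koszul_eq (hG.posDef y hy).inv_mul (hG.posDef y hy).apply_symm
    (hH.christoffel_symm hV hy)
    (D := fun k i j => ∑ l, christoffel H y l k i * G y l j + ∑ l, christoffel H y l k j * G y i l)
    (fun _ _ _ => rfl) k i j
  rw [h2] at h
  have h3 : christoffel G y k i j
    = koszul (G y)⁻¹ (fun k i j => partialDeriv (fun z => G z i j) k y) k i j := rfl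
  rw [h3]
  change _ = _ + koszul (G y)⁻¹ (covDerivCoord H G y) k i j
  have h4 : covDerivCoord H G y = fun k i j => partialDeriv (fun z => G z i j) k y
    - (∑ l, christoffel H y l k i * G y l j + ∑ l, christoffel H y l k j * G y i l) := rfl
  rw [h4, h]; ring

lemma contDiffOn_connectionDiff (hV : IsOpen V) (hH : IsSmoothMetricOn V H)
    (hG : IsSmoothMetricOn V G) (k i j : Fin n) :
    ContDiffOn ℝ ∞ (fun y => connectionDiff H G y k i j) V := by
  refine ((hG.contDiffOn_christoffel hV k i j).sub (hH.contDiffOn_christoffel hV k i j)).congr ?_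
  intro z hz
  rw [christoffel_eq_add hV hH hG hz]; ring

/-- The scalar curvature of `G` is the divergence of the vector field `V` plus `F`. -/
lemma contracted_ricciCoord (hV : IsOpen V) (hH : IsSmoothMetricOn V H)
    (hG : IsSmoothMetricOn V G) (hy : y ∈ V) :
    ∑ i, ∑ j, (G y)⁻¹ i j * ricciCoord G y i j
      = ∑ k, partialDeriv (fun z => contractedVector (G z)⁻¹ (connectionDiff H G z) k) k y
        + ∑ k, (∑ j, christoffel H y j j k) * contractedVector (G y)⁻¹ (connectionDiff H G y) k
        + (∑ i, ∑ j, (G y)⁻¹ i j * ricciCoord H y i j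
          + quadraticPart (G y)⁻¹ (raisedDeriv (G y)⁻¹ (covDerivCoord H G y))
              (connectionDiff H G y)) := by
  have hdG := fun k i j => (hG.contDiffOn_christoffel hV k i j).differentiableAt_of_isOpen hV hy
  have hdH := fun k i j => (hH.contDiffOn_christoffel hV k i j).differentiableAt_of_isOpen hV hy
  have hdγ := fun k i j =>
    (contDiffOn_connectionDiff hV hH hG k i j).differentiableAt_of_isOpen hV hy
  have hdA := fun i j => (hG.contDiffOn_inv_apply i j).differentiableAt_of_isOpen hV hy
  have hγs : ∀ z ∈ V, ∀ k i j, connectionDiff H G z k i j = connectionDiff H G z k j i :=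
    fun z hz => koszul_symm _ (covDerivCoord_symm hV hG hz)
  have key := contracted_ricci_sub (A := (G y)⁻¹) (Γ := christoffel H y)
    (γ := connectionDiff H G y)
    (hH.christoffel_symm hV hy) (hγs y hy)
    (dΓ := fun m k i j => partialDeriv (fun z => christoffel H z k i j) m y)
    (dγ := fun m k i j => partialDeriv (fun z => connectionDiff H G z k i j) m y)
    (fun m k i j => partialDeriv_congr hV (fun z hz => hγs z hz k i j) hy m)
    (dA := fun k i j => partialDeriv (fun z => (G z)⁻¹ i j) k y)
    (C := raisedDeriv (G y)⁻¹ (covDerivCoord H G y)) ?_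
  · have e1 : ∀ i j, ricciCoord G y i j = ricciExpr
        (fun k i j => christoffel H y k i j + connectionDiff H G y k i j)
        (fun m k i j => partialDeriv (fun z => christoffel H z k i j) m y
          + partialDeriv (fun z => connectionDiff H G z k i j) m y) i j := by
      intro i j
      have hd : ∀ m k i j, partialDeriv (fun z => christoffel G z k i j) m y
          = partialDeriv (fun z => christoffel H z k i j) m y
            + partialDeriv (fun z => connectionDiff H G z k i j) m y := by
        intro m k i j
        rw [← partialDeriv_add (hdH k i j) (hdγ k i j)]
        exact partialDeriv_congr hV (fun z hz => christoffel_eq_add hV hH hG hz k i j) hy m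
      unfold ricciCoord ricciExpr
      simp only [hd, christoffel_eq_add hV hH hG hy]
    have e2 : ∀ k, partialDeriv (fun z => contractedVector (G z)⁻¹ (connectionDiff H G z) k) k y
        = ∑ i, ∑ j, (partialDeriv (fun z => (G z)⁻¹ i j) k y * connectionDiff H G y k i j
            + (G y)⁻¹ i j * partialDeriv (fun z => connectionDiff H G z k i j) k y
          - (partialDeriv (fun z => (G z)⁻¹ i k) k y * connectionDiff H G y j j i
            + (G y)⁻¹ i k * partialDeriv (fun z => connectionDiff H G z j j i) k y)) := by
      intro k
      unfold contractedVector
      rw [partialDeriv_sum (fun i _ => DifferentiableAt.fun_sum fun j _ =>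
        ((hdA i j).fun_mul (hdγ k i j)).fun_sub ((hdA i k).fun_mul (hdγ j j i)))]
      refine Finset.sum_congr rfl fun i _ => ?_
      rw [partialDeriv_sum (fun j _ =>
        ((hdA i j).fun_mul (hdγ k i j)).fun_sub ((hdA i k).fun_mul (hdγ j j i)))]
      refine Finset.sum_congr rfl fun j _ => ?_
      rw [partialDeriv_sub ((hdA i j).fun_mul (hdγ k i j)) ((hdA i k).fun_mul (hdγ j j i)),
        partialDeriv_mul (hdA i j) (hdγ k i j), partialDeriv_mul (hdA i k) (hdγ j j i)]
    simp only [e1, e2]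
    exact key
  · intro k i j
    have hAs := (hG.posDef y hy).inv_symm
    have hδ : ∀ j l, ∑ b, (G y)⁻¹ j b * G y l b = if j = l then 1 else 0 := by
      intro j l
      simp only [fun b => (hG.posDef y hy).apply_symm l b]
      rw [← Matrix.mul_apply, (hG.posDef y hy).inv_mul, Matrix.one_apply]
    -- Raising both indices turns the connection terms in the covariant derivative of `G` into those
    -- of its inverse, with the opposite sign.
    have t1 : ∑ a, ∑ b, (G y)⁻¹ i a * (G y)⁻¹ j b * ∑ l, christoffel H y l k a * G y l b
        = ∑ l, christoffel H y j k l * (G y)⁻¹ i l := by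
      refine Finset.sum_congr rfl fun a _ => ?_
      calc _ = ∑ l, (G y)⁻¹ i a * christoffel H y l k a * ∑ b, (G y)⁻¹ j b * G y l b := by
            simp only [Finset.mul_sum]
            rw [Finset.sum_comm]
            exact Finset.sum_congr rfl fun _ _ => Finset.sum_congr rfl fun _ _ => by ring
        _ = _ := by simp only [hδ]; simp; ring
    have t2 : ∑ a, ∑ b, (G y)⁻¹ i a * (G y)⁻¹ j b * ∑ l, christoffel H y l k b * G y a l
        = ∑ l, christoffel H y i k l * (G y)⁻¹ l j := by
      rw [Finset.sum_comm]
      refine Finset.sum_congr rfl fun b _ => ?_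
      calc _ = ∑ l, (G y)⁻¹ j b * christoffel H y l k b * ∑ a, (G y)⁻¹ i a * G y l a := by
            simp only [Finset.mul_sum]
            rw [Finset.sum_comm]
            refine Finset.sum_congr rfl fun l _ => Finset.sum_congr rfl fun a _ => ?_
            rw [(hG.posDef y hy).apply_symm a l]; ring
        _ = _ := by simp only [hδ]; simp [hAs b j]; ring
    rw [hG.partialDeriv_inv hV hy, ← t1, ← t2]
    unfold raisedDeriv covDerivCoord
    simp only [mul_sub, mul_add, Finset.sum_sub_distrib, Finset.sum_add_distrib]
    ring

end difference

end calculus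

/-! ### Coordinate invariance of the Ricci tensor -/

section transformation
variable {n : ℕ}

/-- The entrywise partial derivative of a matrix valued function. -/
noncomputable def matDeriv (M : Euc n → Matrix (Fin n) (Fin n) ℝ) (k : Fin n) (y : Euc n) :
    Matrix (Fin n) (Fin n) ℝ :=
  Matrix.of fun i j => partialDeriv (fun z => M z i j) k y

lemma matDeriv_apply (M : Euc n → Matrix (Fin n) (Fin n) ℝ) (k : Fin n) (y : Euc n)
    (i j : Fin n) : matDeriv M k y i j = partialDeriv (fun z => M z i j) k y := rfl

lemma matDeriv_congr {M N : Euc n → Matrix (Fin n) (Fin n) ℝ} {V : Set (Euc n)} (hV : IsOpen V)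
    (h : ∀ z ∈ V, M z = N z) {y : Euc n} (hy : y ∈ V) (k : Fin n) :
    matDeriv M k y = matDeriv N k y := by
  ext i j
  exact partialDeriv_congr hV (fun z hz => by rw [h z hz]) hy k

section rules
variable {M N : Euc n → Matrix (Fin n) (Fin n) ℝ} {y : Euc n}

lemma matDeriv_transpose (k : Fin n) :
    matDeriv (fun z => (M z).transpose) k y = (matDeriv M k y).transpose := rfl

variable
  (hM : ∀ i j, DifferentiableAt ℝ (fun z => M z i j) y)
  (hN : ∀ i j, DifferentiableAt ℝ (fun z => N z i j) y)

include hM hN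

lemma matDeriv_add (k : Fin n) :
    matDeriv (fun z => M z + N z) k y = matDeriv M k y + matDeriv N k y := by
  ext i j
  exact partialDeriv_add (hM i j) (hN i j) k

lemma differentiableAt_mul_apply (i j : Fin n) :
    DifferentiableAt ℝ (fun z => (M z * N z) i j) y := by
  simp only [Matrix.mul_apply]
  exact DifferentiableAt.fun_sum fun l _ => (hM i l).fun_mul (hN l j)

lemma matDeriv_mul (k : Fin n) :
    matDeriv (fun z => M z * N z) k y = matDeriv M k y * N y + M y * matDeriv N k y := by
  ext i j
  simp only [matDeriv_apply, Matrix.mul_apply, Matrix.add_apply]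
  rw [partialDeriv_sum (fun l _ => (hM i l).fun_mul (hN l j)), ← Finset.sum_add_distrib]
  exact Finset.sum_congr rfl fun l _ => partialDeriv_mul (hM i l) (hN l j) k

end rules

lemma matDeriv_sum_smul {c : Fin n → Euc n → ℝ} {M : Fin n → Euc n → Matrix (Fin n) (Fin n) ℝ}
    {y : Euc n} (hc : ∀ a, DifferentiableAt ℝ (c a) y)
    (hM : ∀ a i j, DifferentiableAt ℝ (fun z => M a z i j) y) (k : Fin n) :
    matDeriv (fun z => ∑ a, c a z • M a z) k y
      = ∑ a, (partialDeriv (c a) k y • M a y + c a y • matDeriv (M a) k y) := by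
  ext i j
  simp only [matDeriv_apply, Matrix.sum_apply, Matrix.add_apply, Matrix.smul_apply, smul_eq_mul]
  rw [partialDeriv_sum (fun a _ => (hc a).fun_mul (hM a i j))]
  exact Finset.sum_congr rfl fun a _ => partialDeriv_mul (hc a) (hM a i j) k

lemma euc_eq_sum (v : Euc n) : v = ∑ a, v a • EuclideanSpace.single a (1 : ℝ) := by
  ext i
  simp [Pi.single_apply]

lemma fderiv_apply_eq_sum (f : Euc n → ℝ) (y v : Euc n) :
    fderiv ℝ f y v = ∑ a, v a * partialDeriv f a y := by
  conv_lhs => rw [euc_eq_sum v]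
  simp [partialDeriv]

lemma partialDeriv_comp_apply {τ : Euc n → Euc n} {y : Euc n} (hτ : DifferentiableAt ℝ τ y)
    (a k : Fin n) :
    partialDeriv (fun z => τ z a) k y = fderiv ℝ τ y (EuclideanSpace.single k 1) a := by
  unfold partialDeriv
  have h := ((EuclideanSpace.proj a : Euc n →L[ℝ] ℝ).hasFDerivAt (x := τ y)).comp y hτ.hasFDerivAt
  have e : (⇑(EuclideanSpace.proj a : Euc n →L[ℝ] ℝ) ∘ τ) = fun z => τ z a := rfl
  rw [e] at h
  rw [h.fderiv]
  rfl

lemma partialDeriv_comp {f : Euc n → ℝ} {τ : Euc n → Euc n} {y : Euc n}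
    (hf : DifferentiableAt ℝ f (τ y)) (hτ : DifferentiableAt ℝ τ y) (k : Fin n) :
    partialDeriv (fun z => f (τ z)) k y
      = ∑ a, partialDeriv (fun z => τ z a) k y * partialDeriv f a (τ y) := by
  have h := fderiv_comp y hf hτ
  have e : f ∘ τ = fun z => f (τ z) := rfl
  rw [e] at h
  have h2 : partialDeriv (fun z => f (τ z)) k y
      = fderiv ℝ f (τ y) (fderiv ℝ τ y (EuclideanSpace.single k 1)) := by
    unfold partialDeriv; rw [h]; rfl
  rw [h2, fderiv_apply_eq_sum]
  simp only [partialDeriv_comp_apply hτ]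

/-- The Jacobian matrix `∂ᵢ τᵃ`. -/
noncomputable def jacobian (τ : Euc n → Euc n) (y : Euc n) : Matrix (Fin n) (Fin n) ℝ :=
  Matrix.of fun a i => partialDeriv (fun z => τ z a) i y

/-- The matrix `(Γ^l_{ki})_{li}` of the Levi-Civita connection in the direction `∂ₖ`. -/
noncomputable def connMatrix (G : Euc n → Matrix (Fin n) (Fin n) ℝ) (k : Fin n) (y : Euc n) :
    Matrix (Fin n) (Fin n) ℝ :=
  Matrix.of fun l i => christoffel G y l k i

/-- The curvature matrix in the directions `∂ₖ, ∂ⱼ`. -/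
noncomputable def curvMatrix (G : Euc n → Matrix (Fin n) (Fin n) ℝ) (k j : Fin n) (y : Euc n) :
    Matrix (Fin n) (Fin n) ℝ :=
  matDeriv (connMatrix G j) k y - matDeriv (connMatrix G k) j y
    + (connMatrix G k y * connMatrix G j y - connMatrix G j y * connMatrix G k y)

variable {V V' : Set (Euc n)} {G G' : Euc n → Matrix (Fin n) (Fin n) ℝ} {τ : Euc n → Euc n}
  {y : Euc n}

/-- In matrix form the curvature transforms by conjugation with the Jacobian, so the Ricci tensor is
treated as a partial trace of it. Symmetry of the Christoffel symbols reconciles the order of the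
lower indices. -/
lemma ricciCoord_eq_curvMatrix (hV : IsOpen V) (hG : IsSmoothMetricOn V G) (hy : y ∈ V)
    (i j : Fin n) : ricciCoord G y i j = ∑ k, curvMatrix G k j y k i := by
  refine Finset.sum_congr rfl fun k _ => ?_
  have h1 : partialDeriv (fun z => christoffel G z k i j) k y
      = matDeriv (connMatrix G j) k y k i :=
    partialDeriv_congr hV (fun z hz => hG.christoffel_symm hV hz k i j) hy k
  have h2 : partialDeriv (fun z => christoffel G z k i k) j y
      = matDeriv (connMatrix G k) j y k i :=
    partialDeriv_congr hV (fun z hz => hG.christoffel_symm hV hz k i k) hy j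
  unfold curvMatrix
  simp only [Matrix.add_apply, Matrix.sub_apply, Matrix.mul_apply, ← Finset.sum_sub_distrib]
  rw [h1, h2]
  congr 1
  refine Finset.sum_congr rfl fun l _ => ?_
  rw [hG.christoffel_symm hV hy l i j, hG.christoffel_symm hV hy l i k]
  rfl

lemma IsSmoothMetricOn.matDeriv_eq (hV : IsOpen V) (hG : IsSmoothMetricOn V G) (hy : y ∈ V)
    (k : Fin n) :
    matDeriv G k y = (connMatrix G k y).transpose * G y + G y * connMatrix G k y := by
  ext i j
  rw [matDeriv_apply, ← hG.christoffel_compat hV hy k i j]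
  simp only [Matrix.add_apply, Matrix.mul_apply, Matrix.transpose_apply, connMatrix, Matrix.of_apply]
  congr 1
  exact Finset.sum_congr rfl fun _ _ => mul_comm _ _

lemma contDiffOn_jacobian (hV : IsOpen V) (hτ : ContDiffOn ℝ ∞ τ V) (a i : Fin n) :
    ContDiffOn ℝ ∞ (fun z => jacobian τ z a i) V :=
  ContDiffOn.partialDeriv hV ((EuclideanSpace.proj a : Euc n →L[ℝ] ℝ).contDiff.comp_contDiffOn hτ) i

lemma jacobian_comm (hV : IsOpen V) (hτ : ContDiffOn ℝ ∞ τ V) (hy : y ∈ V) (a i k : Fin n) :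
    matDeriv (jacobian τ) k y a i = matDeriv (jacobian τ) i y a k :=
  partialDeriv_comm hV ((EuclideanSpace.proj a : Euc n →L[ℝ] ℝ).contDiff.comp_contDiffOn hτ) hy i k

section
variable (hV : IsOpen V) (hV' : IsOpen V') (hτ : ContDiffOn ℝ ∞ τ V) (hmaps : ∀ z ∈ V, τ z ∈ V')
  (hdet : ∀ z ∈ V, IsUnit (jacobian τ z).det) (hG : IsSmoothMetricOn V G)
  (hG' : IsSmoothMetricOn V' G')
  (hGG' : ∀ z ∈ V, G z = (jacobian τ z).transpose * G' (τ z) * jacobian τ z)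
include hV hV' hτ hmaps hdet hG hG' hGG'

/-- The transformation law of the Levi-Civita connection. -/
lemma jacobian_mul_connMatrix (hy : y ∈ V) (i : Fin n) :
    jacobian τ y * connMatrix G i y
      = (∑ a, jacobian τ y a i • connMatrix G' a (τ y)) * jacobian τ y
        + matDeriv (jacobian τ) i y := by
  set A := jacobian τ y with hA
  have hAB : A * A⁻¹ = 1 := Matrix.mul_nonsing_inv _ (hdet y hy)
  -- The candidate for `A * connMatrix G i`: the pulled back connection plus the inhomogeneous term.
  -- The product rule on `G = Aᵀ G' A` gives metric compatibility of `A⁻¹ * U` (`hdG`), symmetry of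
  -- second derivatives makes it torsion-free (`hUs`), and `koszul_eq` concludes.
  set U : Fin n → Matrix (Fin n) (Fin n) ℝ := fun i =>
    (∑ a, A a i • connMatrix G' a (τ y)) * A + matDeriv (jacobian τ) i y with hU
  have hτd : DifferentiableAt ℝ τ y := (hτ.contDiffAt (hV.mem_nhds hy)).differentiableAt (by simp)
  have hAd := fun a i => (contDiffOn_jacobian hV hτ a i).differentiableAt_of_isOpen hV hy
  have hG'd := fun a b => hG'.differentiableAt hV' (hmaps y hy) a b
  have hcomp : ∀ a b, DifferentiableAt ℝ (fun z => G' (τ z) a b) y := fun a b =>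
    (hG'd a b).comp y hτd
  have hdG : ∀ k, matDeriv G k y = (U k).transpose * G' (τ y) * A + A.transpose * G' (τ y) * U k := by
    intro k
    have e1 : matDeriv (fun z => G' (τ z)) k y = ∑ a, A a k • matDeriv G' a (τ y) := by
      ext i j
      rw [matDeriv_apply, partialDeriv_comp (hG'd i j) hτd]
      simp [Matrix.sum_apply, matDeriv_apply, hA, jacobian]
    have hAt : ∀ i j, DifferentiableAt ℝ (fun z => (jacobian τ z).transpose i j) y :=
      fun i j => hAd j i
    rw [matDeriv_congr hV hGG' hy,
      matDeriv_mul (differentiableAt_mul_apply hAt hcomp) hAd,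
      matDeriv_mul hAt hcomp, e1, matDeriv_transpose]
    simp only [hG'.matDeriv_eq hV' (hmaps y hy), hU, Matrix.transpose_add, Matrix.transpose_mul,
      Matrix.transpose_sum, Matrix.transpose_smul, smul_add, Finset.sum_add_distrib]
    have e2 : ∑ a, A a k • ((connMatrix G' a (τ y)).transpose * G' (τ y))
        = (∑ a, A a k • (connMatrix G' a (τ y)).transpose) * G' (τ y) := by
      simp [Finset.sum_mul]
    have e3 : ∑ a, A a k • (G' (τ y) * connMatrix G' a (τ y))
        = G' (τ y) * ∑ a, A a k • connMatrix G' a (τ y) := by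
      simp [Finset.mul_sum]
    rw [e2, e3, ← hA]
    noncomm_ring
  have hUs : ∀ m k i, U k m i = U i m k := by
    intro m k i
    simp only [hU, Matrix.add_apply, Matrix.mul_apply, Matrix.sum_apply, Matrix.smul_apply,
      smul_eq_mul, jacobian_comm hV hτ hy m i k, Finset.sum_mul]
    congr 1
    rw [Finset.sum_comm]
    refine Finset.sum_congr rfl fun a _ => Finset.sum_congr rfl fun b _ => ?_
    have := hG'.christoffel_symm hV' (hmaps y hy) m a b
    simp only [connMatrix, Matrix.of_apply, this]; ring
  have hGy := hGG' y hy
  rw [← hA] at hGy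
  have key := koszul_eq (hG.posDef y hy).inv_mul (hG.posDef y hy).apply_symm
    (γ := fun k i j => (A⁻¹ * U i) k j)
    (D := fun k i j => partialDeriv (fun z => G z i j) k y) ?_ ?_
  · have e : connMatrix G i y = A⁻¹ * U i := by
      ext k j
      exact key k i j
    rw [e, ← Matrix.mul_assoc, hAB, Matrix.one_mul]
  · intro k i j
    simp only [Matrix.mul_apply]
    exact Finset.sum_congr rfl fun m _ => by rw [hUs]
  · intro k i j
    have e1 : ∑ l, (A⁻¹ * U k) l i * G y l j = ((A⁻¹ * U k).transpose * G y) i j := by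
      rw [Matrix.mul_apply]; rfl
    have e2 : ∑ l, (A⁻¹ * U k) l j * G y i l = (G y * (A⁻¹ * U k)) i j := by
      rw [Matrix.mul_apply]
      exact Finset.sum_congr rfl fun _ _ => mul_comm _ _
    have hBA : (A⁻¹).transpose * A.transpose = 1 := by
      rw [← Matrix.transpose_mul, hAB, Matrix.transpose_one]
    have f1 : (A⁻¹ * U k).transpose * G y = (U k).transpose * G' (τ y) * A := by
      rw [hGy, Matrix.transpose_mul]
      calc _ = (U k).transpose * ((A⁻¹).transpose * A.transpose) * G' (τ y) * A := by
            noncomm_ring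
        _ = _ := by rw [hBA, Matrix.mul_one]
    have f2 : G y * (A⁻¹ * U k) = A.transpose * G' (τ y) * U k := by
      rw [hGy]
      calc _ = A.transpose * G' (τ y) * (A * A⁻¹) * U k := by noncomm_ring
        _ = _ := by rw [hAB, Matrix.mul_one]
    rw [e1, e2, ← matDeriv_apply, hdG, f1, f2, Matrix.add_apply]

/-- Differentiate the law `A ω_i = W_i A + ∂_i A` of `jacobian_mul_connMatrix` and antisymmetrise in
the two directions: the second derivatives of `A` cancel, and what remains is the curvature of the
pulled back connection `W`. That curvature is the pullback of the curvature of `G'`, because `∂_k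
A_{aj}` is symmetric in `k` and `j`. -/
lemma jacobian_mul_curvMatrix (hy : y ∈ V) (k j : Fin n) :
    jacobian τ y * curvMatrix G k j y
      = (∑ a, ∑ b, (jacobian τ y a k * jacobian τ y b j) • curvMatrix G' a b (τ y))
        * jacobian τ y := by
  set A := jacobian τ y with hA
  set W : Fin n → Euc n → Matrix (Fin n) (Fin n) ℝ := fun i z =>
    ∑ a, jacobian τ z a i • connMatrix G' a (τ z) with hW
  have hτd : DifferentiableAt ℝ τ y := (hτ.contDiffAt (hV.mem_nhds hy)).differentiableAt (by simp)
  have hAd := fun a i => (contDiffOn_jacobian hV hτ a i).differentiableAt_of_isOpen hV hy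
  have hωd : ∀ i a b, DifferentiableAt ℝ (fun z => connMatrix G i z a b) y := fun i a b =>
    (hG.contDiffOn_christoffel hV a i b).differentiableAt_of_isOpen hV hy
  have hω'd : ∀ i a b, DifferentiableAt ℝ (fun z => connMatrix G' i z a b) (τ y) := fun i a b =>
    (hG'.contDiffOn_christoffel hV' a i b).differentiableAt_of_isOpen hV' (hmaps y hy)
  have hω'c : ∀ i a b, DifferentiableAt ℝ (fun z => connMatrix G' i (τ z) a b) y := fun i a b =>
    (hω'd i a b).comp y hτd
  have hdAd : ∀ i a b, DifferentiableAt ℝ (fun z => matDeriv (jacobian τ) i z a b) y := fun i a b =>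
    (ContDiffOn.partialDeriv hV (contDiffOn_jacobian hV hτ a b) i).differentiableAt_of_isOpen hV hy
  have hWd : ∀ i a b, DifferentiableAt ℝ (fun z => W i z a b) y := by
    intro i a b
    simp only [hW, Matrix.sum_apply, Matrix.smul_apply, smul_eq_mul]
    exact DifferentiableAt.fun_sum fun c _ => (hAd c i).fun_mul (hω'c c a b)
  have hlaw : ∀ z ∈ V, ∀ i, jacobian τ z * connMatrix G i z
      = W i z * jacobian τ z + matDeriv (jacobian τ) i z := fun z hz i =>
    jacobian_mul_connMatrix hV hV' hτ hmaps hdet hG hG' hGG' hz i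
  have hder : ∀ i k, matDeriv (jacobian τ) k y * connMatrix G i y + A * matDeriv (connMatrix G i) k y
      = matDeriv (W i) k y * A + W i y * matDeriv (jacobian τ) k y
        + matDeriv (matDeriv (jacobian τ) i) k y := by
    intro i k
    have h := matDeriv_congr hV (fun z hz => hlaw z hz i) hy k
    rw [matDeriv_mul hAd (hωd i), matDeriv_add (differentiableAt_mul_apply (hWd i) hAd) (hdAd i),
      matDeriv_mul (hWd i) hAd] at h
    exact h
  have hdd : matDeriv (matDeriv (jacobian τ) j) k y = matDeriv (matDeriv (jacobian τ) k) j y := by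
    ext a b
    exact partialDeriv_comm hV (contDiffOn_jacobian hV hτ a b) hy j k
  have hcompd : ∀ a k, matDeriv (fun z => connMatrix G' a (τ z)) k y
      = ∑ b, A b k • matDeriv (connMatrix G' a) b (τ y) := by
    intro a k
    ext i l
    rw [matDeriv_apply, partialDeriv_comp (hω'd a i l) hτd]
    simp [Matrix.sum_apply, matDeriv_apply, hA, jacobian]
  have hdW : ∀ i k, matDeriv (W i) k y
      = ∑ a, (matDeriv (jacobian τ) k y a i • connMatrix G' a (τ y)
        + A a i • ∑ b, A b k • matDeriv (connMatrix G' a) b (τ y)) := by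
    intro i k
    have := matDeriv_sum_smul (c := fun a z => jacobian τ z a i)
      (M := fun a z => connMatrix G' a (τ z)) (fun a => hAd a i) (fun a => hω'c a) k
    simp only [hcompd] at this
    exact this
  have hWcurv : matDeriv (W j) k y - matDeriv (W k) j y + (W k y * W j y - W j y * W k y)
      = ∑ a, ∑ b, (A a k * A b j) • curvMatrix G' a b (τ y) := by
    rw [hdW, hdW]
    simp only [jacobian_comm hV hτ hy _ j k, curvMatrix, hW, ← hA, Finset.sum_add_distrib,
      smul_add, smul_sub, Finset.sum_sub_distrib, Finset.sum_mul, Finset.mul_sum, Finset.smul_sum,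
      smul_smul, Matrix.smul_mul, Matrix.mul_smul]
    have e1 : ∑ a, ∑ b, (A a j * A b k) • matDeriv (connMatrix G' a) b (τ y)
        = ∑ a, ∑ b, (A a k * A b j) • matDeriv (connMatrix G' b) a (τ y) := by
      rw [Finset.sum_comm]
      exact Finset.sum_congr rfl fun _ _ => Finset.sum_congr rfl fun _ _ => by rw [mul_comm]
    have e2 : ∑ a, ∑ b, (A a j * A b k) • (connMatrix G' b (τ y) * connMatrix G' a (τ y))
        = ∑ a, ∑ b, (A a k * A b j) • (connMatrix G' a (τ y) * connMatrix G' b (τ y)) := by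
      rw [Finset.sum_comm]
      exact Finset.sum_congr rfl fun _ _ => Finset.sum_congr rfl fun _ _ => by rw [mul_comm (A _ j)]
    rw [e1, e2]
    abel
  have hk := hlaw y hy k
  have hj := hlaw y hy j
  have h1 := hder j k
  have h2 := hder k j
  rw [← hA] at hk hj
  rw [← hWcurv]
  unfold curvMatrix
  rw [hdd] at h1
  have h1' : A * matDeriv (connMatrix G j) k y = matDeriv (W j) k y * A
      + W j y * matDeriv (jacobian τ) k y + matDeriv (matDeriv (jacobian τ) k) j y
      - matDeriv (jacobian τ) k y * connMatrix G j y := by rw [← h1]; abel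
  have h2' : A * matDeriv (connMatrix G k) j y = matDeriv (W k) j y * A
      + W k y * matDeriv (jacobian τ) j y + matDeriv (matDeriv (jacobian τ) k) j y
      - matDeriv (jacobian τ) j y * connMatrix G k y := by rw [← h2]; abel
  have h3 : A * (connMatrix G k y * connMatrix G j y)
      = W k y * (W j y * A + matDeriv (jacobian τ) j y)
        + matDeriv (jacobian τ) k y * connMatrix G j y := by
    rw [← Matrix.mul_assoc, hk, Matrix.add_mul, Matrix.mul_assoc, hj]
  have h4 : A * (connMatrix G j y * connMatrix G k y)
      = W j y * (W k y * A + matDeriv (jacobian τ) k y)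
        + matDeriv (jacobian τ) j y * connMatrix G k y := by
    rw [← Matrix.mul_assoc, hj, Matrix.add_mul, Matrix.mul_assoc, hk]
  rw [Matrix.mul_add, Matrix.mul_sub, Matrix.mul_sub, h1', h2', h3, h4]
  noncomm_ring

/-- The Ricci tensor is a tensor. -/
lemma ricciCoord_transform (hy : y ∈ V) (i j : Fin n) :
    ricciCoord G y i j
      = ∑ a, ∑ b, jacobian τ y a i * jacobian τ y b j * ricciCoord G' (τ y) a b := by
  set A := jacobian τ y with hA
  have hAB : A * A⁻¹ = 1 := Matrix.mul_nonsing_inv _ (hdet y hy)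
  have hBA : A⁻¹ * A = 1 := Matrix.nonsing_inv_mul _ (hdet y hy)
  rw [ricciCoord_eq_curvMatrix hV hG hy]
  simp only [ricciCoord_eq_curvMatrix hV' hG' (hmaps y hy)]
  have h : ∀ k, curvMatrix G k j y
      = A⁻¹ * ((∑ a, ∑ b, (A a k * A b j) • curvMatrix G' a b (τ y)) * A) := by
    intro k
    rw [← jacobian_mul_curvMatrix hV hV' hτ hmaps hdet hG hG' hGG' hy, ← Matrix.mul_assoc, hBA,
      Matrix.one_mul]
  set Y : Fin n → Matrix (Fin n) (Fin n) ℝ := fun a =>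
    ∑ b, A b j • curvMatrix G' a b (τ y) with hY
  have h2 : ∀ k, curvMatrix G k j y = ∑ a, A a k • (A⁻¹ * Y a * A) := by
    intro k
    rw [h]
    simp only [hY, mul_smul, ← Finset.smul_sum, Finset.sum_mul, Finset.mul_sum, Matrix.smul_mul,
      Matrix.mul_smul, Matrix.mul_assoc]
  have h3 : ∑ k, curvMatrix G k j y k i = ∑ a, (Y a * A) a i := by
    simp only [h2, Matrix.sum_apply, Matrix.smul_apply, smul_eq_mul]
    rw [Finset.sum_comm]
    refine Finset.sum_congr rfl fun a _ => ?_
    rw [← Matrix.mul_apply, Matrix.mul_assoc, ← Matrix.mul_assoc A, hAB, Matrix.one_mul]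
  rw [h3]
  simp only [hY, Matrix.mul_apply, Matrix.sum_apply, Matrix.smul_apply, smul_eq_mul,
    Finset.mul_sum, Finset.sum_mul]
  calc _ = ∑ d, ∑ a, ∑ b, A b j * curvMatrix G' a b (τ y) a d * A d i := Finset.sum_comm
    _ = ∑ d, ∑ b, ∑ a, A b j * curvMatrix G' a b (τ y) a d * A d i :=
        Finset.sum_congr rfl fun _ _ => Finset.sum_comm
    _ = _ := Finset.sum_congr rfl fun _ _ => Finset.sum_congr rfl fun _ _ =>
        Finset.sum_congr rfl fun _ _ => by ring

omit hV hV' hτ hmaps hG hG' in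
/-- Contraction of a covariant 2-tensor with the inverse metric is coordinate invariant. -/
lemma sum_inv_mul_transform {R R' : Matrix (Fin n) (Fin n) ℝ} (hy : y ∈ V)
    (hR : R = (jacobian τ y).transpose * R' * jacobian τ y) :
    ∑ i, ∑ j, (G y)⁻¹ i j * R i j = ∑ i, ∑ j, (G' (τ y))⁻¹ i j * R' i j := by
  set A := jacobian τ y with hA
  have hAB : A * A⁻¹ = 1 := Matrix.mul_nonsing_inv _ (hdet y hy)
  have e : ∀ X Y : Matrix (Fin n) (Fin n) ℝ, ∑ i, ∑ j, X i j * Y i j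
      = (X * Y.transpose).trace := by
    intro X Y
    simp [Matrix.trace, Matrix.mul_apply]
  rw [e, e, hR, hGG' y hy, ← hA, Matrix.mul_inv_rev, Matrix.mul_inv_rev, Matrix.transpose_mul,
    Matrix.transpose_mul, Matrix.transpose_transpose]
  have h2 : (A.transpose)⁻¹ * A.transpose = 1 := by
    rw [← Matrix.transpose_nonsing_inv, ← Matrix.transpose_mul, hAB, Matrix.transpose_one]
  calc _ = (A⁻¹ * ((G' (τ y))⁻¹ * ((A.transpose)⁻¹ * A.transpose) * (R'.transpose * A))).trace := by
        simp only [Matrix.mul_assoc]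
    _ = _ := by
        rw [h2, Matrix.mul_one, Matrix.trace_mul_comm, Matrix.mul_assoc, Matrix.mul_assoc, hAB,
          Matrix.mul_one]

/-- The trace of the Ricci tensor of one metric is coordinate invariant, also when it is taken
with respect to another metric. -/
lemma contracted_ricciCoord_transform {K K' : Euc n → Matrix (Fin n) (Fin n) ℝ} (hy : y ∈ V)
    (hK : ∀ z ∈ V, K z = (jacobian τ z).transpose * K' (τ z) * jacobian τ z) :
    ∑ i, ∑ j, (K y)⁻¹ i j * ricciCoord G y i j
      = ∑ i, ∑ j, (K' (τ y))⁻¹ i j * ricciCoord G' (τ y) i j := by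
  refine sum_inv_mul_transform (R := Matrix.of (ricciCoord G y))
    (R' := Matrix.of (ricciCoord G' (τ y))) hdet hK hy ?_
  ext i j
  rw [Matrix.of_apply, ricciCoord_transform hV hV' hτ hmaps hdet hG hG' hGG' hy]
  simp only [Matrix.mul_apply, Matrix.transpose_apply, Matrix.of_apply, Finset.sum_mul]
  rw [Finset.sum_comm]
  exact Finset.sum_congr rfl fun _ _ => Finset.sum_congr rfl fun _ _ => by ring

end

end transformation

/-! ### Weak partial derivatives -/

section weak
variable {n : ℕ}

lemma contDiff_of_contDiffAt_tsupport {E F : Type*} [NormedAddCommGroup E] [NormedSpace ℝ E]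
    [NormedAddCommGroup F] [NormedSpace ℝ F] {f : E → F} {m : WithTop ℕ∞}
    (h : ∀ x ∈ tsupport f, ContDiffAt ℝ m f x) : ContDiff ℝ m f := by
  refine contDiff_iff_contDiffAt.2 fun x => ?_
  by_cases hx : x ∈ tsupport f
  · exact h x hx
  · exact (contDiffAt_const (c := (0 : F))).congr_of_eventuallyEq
      (notMem_tsupport_iff_eventuallyEq.1 hx)

lemma ContDiffOn.mul_contDiff_of_tsupport_subset {E : Type*} [NormedAddCommGroup E]
    [NormedSpace ℝ E] {f φ : E → ℝ} {m : WithTop ℕ∞} {V : Set E} (hV : IsOpen V)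
    (hf : ContDiffOn ℝ m f V) (hφ : ContDiff ℝ m φ) (hs : tsupport φ ⊆ V) :
    ContDiff ℝ m fun y => f y * φ y :=
  contDiff_of_contDiffAt_tsupport fun _ hx =>
    (hf.contDiffAt (hV.mem_nhds (hs (tsupport_mul_subset_right hx)))).mul hφ.contDiffAt

lemma partialDeriv_eq_zero_of_notMem_tsupport {f : Euc n → ℝ} {y : Euc n} (hy : y ∉ tsupport f)
    (k : Fin n) : partialDeriv f k y = 0 := by
  rw [Filter.EventuallyEq.partialDeriv_eq (notMem_tsupport_iff_eventuallyEq.1 hy) k]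
  exact partialDeriv_const 0 k y

lemma tsupport_partialDeriv_subset (f : Euc n → ℝ) (k : Fin n) :
    tsupport (partialDeriv f k) ⊆ tsupport f :=
  closure_minimal (fun y hy => by
    by_contra h
    exact hy (partialDeriv_eq_zero_of_notMem_tsupport h k)) (isClosed_tsupport f)

lemma HasCompactSupport.partialDeriv {f : Euc n → ℝ} (hf : HasCompactSupport f) (k : Fin n) :
    HasCompactSupport (partialDeriv f k) :=
  hf.of_isClosed_subset (isClosed_tsupport _) (tsupport_partialDeriv_subset f k)

lemma ContDiff.continuous_partialDeriv {f : Euc n → ℝ} (hf : ContDiff ℝ 1 f) (k : Fin n) :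
    Continuous (_root_.partialDeriv f k) :=
  (hf.continuous_fderiv (by simp)).clm_apply continuous_const

lemma integral_partialDeriv_eq_zero {f : Euc n → ℝ} (hf : ContDiff ℝ 1 f)
    (hc : HasCompactSupport f) (k : Fin n) : ∫ y, partialDeriv f k y = 0 := by
  have i1 : Integrable (partialDeriv f k) volume :=
    (hf.continuous_partialDeriv k).integrable_of_hasCompactSupport (hc.partialDeriv k)
  have i2 : Integrable f volume := hf.continuous.integrable_of_hasCompactSupport hc
  have h := integral_mul_fderiv_eq_neg_fderiv_mul_of_integrable (μ := volume) (𝕜 := ℝ)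
    (f := fun _ : Euc n => (1 : ℝ)) (g := f) (v := EuclideanSpace.single k 1)
    (by simp) (by simp only [one_mul]; exact i1) (by simp only [one_mul]; exact i2)
    (fun x _ => differentiableAt_const _) (fun x _ => hf.differentiable (by simp) x)
  simpa [partialDeriv] using h

lemma MeasureTheory.LocallyIntegrableOn.integrable_mul_test {U : Set (Euc n)} {w φ : Euc n → ℝ}
    (hw : LocallyIntegrableOn w U volume) (hφ : Continuous φ) (hc : HasCompactSupport φ)
    (hs : tsupport φ ⊆ U) : Integrable (fun y => w y * φ y) := by
  have h1 : IntegrableOn (fun y => w y * φ y) (tsupport φ) :=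
    (hw.integrableOn_compact_subset hs hc).mul_continuousOn hφ.continuousOn hc
  refine (integrableOn_iff_integrable_of_support_subset ?_).1 h1
  intro y hy
  by_contra h
  exact hy (by simp [image_eq_zero_of_notMem_tsupport h])

lemma HasWeakPartialDeriv.mono {U V : Set (Euc n)} {f w : Euc n → ℝ} {k : Fin n}
    (h : HasWeakPartialDeriv U f k w) (hVU : V ⊆ U) : HasWeakPartialDeriv V f k w :=
  ⟨h.1.mono_set hVU, h.2.1.mono_set hVU, fun φ h1 h2 h3 => h.2.2 φ h1 h2 (h3.trans hVU)⟩

lemma HasWeakPartialDeriv.ae_eq {U : Set (Euc n)} (hU : IsOpen U) {f w w' : Euc n → ℝ}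
    {k : Fin n} (h : HasWeakPartialDeriv U f k w) (h' : HasWeakPartialDeriv U f k w') :
    ∀ᵐ y, y ∈ U → w y = w' y := by
  have := hU.ae_eq_zero_of_integral_contDiff_smul_eq_zero (h.2.1.sub h'.2.1) (μ := volume) ?_
  · filter_upwards [this] with y hy hyU
    simpa [sub_eq_zero] using hy hyU
  · intro φ h1 h2 h3
    have i1 := h.2.1.integrable_mul_test h1.continuous h2 h3
    have i2 := h'.2.1.integrable_mul_test h1.continuous h2 h3
    have e1 := h.2.2 φ h1 h2 h3
    have e2 := h'.2.2 φ h1 h2 h3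
    calc ∫ y, φ y • (w - w') y = ∫ y, (w y * φ y - w' y * φ y) := by
          congr 1; ext y; simp; ring
      _ = 0 := by rw [integral_sub i1 i2]; linarith

lemma ContDiffOn.hasWeakPartialDeriv {V : Set (Euc n)} (hV : IsOpen V) {f : Euc n → ℝ}
    (hf : ContDiffOn ℝ ∞ f V) (k : Fin n) : HasWeakPartialDeriv V f k (_root_.partialDeriv f k) := by
  have hf1 : LocallyIntegrableOn f V volume :=
    hf.continuousOn.locallyIntegrableOn hV.measurableSet
  have hf2 : LocallyIntegrableOn (_root_.partialDeriv f k) V volume :=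
    (ContDiffOn.partialDeriv hV hf k).continuousOn.locallyIntegrableOn hV.measurableSet
  refine ⟨hf1, hf2, fun φ h1 h2 h3 => ?_⟩
  have hprod := ContDiffOn.mul_contDiff_of_tsupport_subset hV hf h1 h3
  have hz := integral_partialDeriv_eq_zero (hprod.of_le (by simp))
    (h2.mul_left (f := f)) k
  have hφ' := (h1.of_le (m := 1) (by simp)).continuous_partialDeriv k
  have e : ∀ y, _root_.partialDeriv (fun z => f z * φ z) k y
      = _root_.partialDeriv f k y * φ y + f y * _root_.partialDeriv φ k y := by
    intro y
    by_cases hy : y ∈ tsupport φ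
    · exact partialDeriv_mul (hf.differentiableAt_of_isOpen hV (h3 hy))
        (h1.differentiable (by simp) y) k
    · rw [partialDeriv_eq_zero_of_notMem_tsupport hy, image_eq_zero_of_notMem_tsupport hy,
        partialDeriv_eq_zero_of_notMem_tsupport (fun h => hy (tsupport_mul_subset_right h))]
      ring
  have i1 := hf2.integrable_mul_test h1.continuous h2 h3
  have i2 := hf1.integrable_mul_test hφ' (h2.partialDeriv k)
    ((tsupport_partialDeriv_subset φ k).trans h3)
  simp only [e] at hz
  rw [integral_add i1 i2] at hz
  linarith

/-- The product of `θ` with a test function is again a test function, to which the weak derivative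
of `f` applies. -/
lemma HasWeakPartialDeriv.contDiffOn_mul {U : Set (Euc n)} (hU : IsOpen U) {θ f w : Euc n → ℝ}
    {k : Fin n} (hθ : ContDiffOn ℝ ∞ θ U) (hf : HasWeakPartialDeriv U f k w) :
    HasWeakPartialDeriv U (fun y => θ y * f y) k
      (fun y => partialDeriv θ k y * f y + θ y * w y) := by
  have hθ' := ContDiffOn.partialDeriv hU hθ k
  refine ⟨hf.1.continuousOn_mul hθ.continuousOn hU.isLocallyClosed,
    (hf.1.continuousOn_mul hθ'.continuousOn hU.isLocallyClosed).add
    (hf.2.1.continuousOn_mul hθ.continuousOn hU.isLocallyClosed), fun φ h1 h2 h3 => ?_⟩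
  have hprod := ContDiffOn.mul_contDiff_of_tsupport_subset hU hθ h1 h3
  have hpc : HasCompactSupport fun y => θ y * φ y := h2.mul_left
  have hps : tsupport (fun y => θ y * φ y) ⊆ U := tsupport_mul_subset_right.trans h3
  have h := hf.2.2 _ hprod hpc hps
  have e : ∀ y, partialDeriv (fun z => θ z * φ z) k y
      = partialDeriv θ k y * φ y + θ y * partialDeriv φ k y := by
    intro y
    by_cases hy : y ∈ tsupport φ
    · exact partialDeriv_mul (hθ.differentiableAt_of_isOpen hU (h3 hy))
        (h1.differentiable (by simp) y) k
    · rw [partialDeriv_eq_zero_of_notMem_tsupport hy, image_eq_zero_of_notMem_tsupport hy,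
        partialDeriv_eq_zero_of_notMem_tsupport (fun h => hy (tsupport_mul_subset_right h))]
      ring
  have hφ' := (h1.of_le (m := 1) (by simp)).continuous_partialDeriv k
  have hs := (tsupport_partialDeriv_subset φ k).trans h3
  have i1 : Integrable (fun y => f y * partialDeriv θ k y * φ y) := by
    have := (hf.1.continuousOn_mul hθ'.continuousOn hU.isLocallyClosed).integrable_mul_test
      h1.continuous h2 h3
    exact this.congr (Filter.Eventually.of_forall fun y => by simp only [mul_comm (f y)])
  have i2 : Integrable (fun y => θ y * f y * partialDeriv φ k y) :=
    (hf.1.continuousOn_mul hθ.continuousOn hU.isLocallyClosed).integrable_mul_test hφ'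
      (h2.partialDeriv k) hs
  have i3 : Integrable (fun y => w y * (θ y * φ y)) :=
    hf.2.1.integrable_mul_test hprod.continuous hpc hps
  have e1 : ∫ y, f y * partialDeriv (fun z => θ z * φ z) k y
      = (∫ y, f y * partialDeriv θ k y * φ y) + ∫ y, θ y * f y * partialDeriv φ k y := by
    rw [← integral_add i1 i2]
    congr 1; ext y; rw [e]; ring
  have e2 : ∫ y, (partialDeriv θ k y * f y + θ y * w y) * φ y
      = (∫ y, f y * partialDeriv θ k y * φ y) + ∫ y, w y * (θ y * φ y) := by
    rw [← integral_add i1 i3]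
    congr 1; ext y; ring
  rw [e2]
  change ∫ y, θ y * f y * partialDeriv φ k y = _
  linarith

/-! ### Mollification and the chain rule -/

/-- A standard mollifying sequence, with supports of radius `R / (m + 1)`. -/
noncomputable def mollifierBump (n : ℕ) {R : ℝ} (hR : 0 < R) (m : ℕ) : ContDiffBump (0 : Euc n) where
  rIn := R / (2 * (m + 1))
  rOut := R / (m + 1)
  rIn_pos := by positivity
  rIn_lt_rOut := by
    apply div_lt_div_of_pos_left hR (by positivity)
    have : (0 : ℝ) ≤ m := by positivity
    linarith

/-- The mollifying kernel. -/
noncomputable def mollifier (n : ℕ) {R : ℝ} (hR : 0 < R) (m : ℕ) : Euc n → ℝ :=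
  (mollifierBump n hR m).normed volume

/-- The mollification of `f`. -/
noncomputable def mollify {R : ℝ} (hR : 0 < R) (m : ℕ) (f : Euc n → ℝ) (x : Euc n) : ℝ :=
  ∫ y, f y * mollifier n hR m (x - y)

section mollify
variable {R : ℝ} (hR : 0 < R)

lemma mollifierBump_rOut (m : ℕ) : (mollifierBump n hR m).rOut = R / (m + 1) := rfl

lemma mollifierBump_rOut_le (m : ℕ) : (mollifierBump n hR m).rOut ≤ R := by
  rw [mollifierBump_rOut]
  apply div_le_self hR.le
  have : (0 : ℝ) ≤ m := by positivity
  linarith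

lemma tendsto_mollifierBump_rOut :
    Filter.Tendsto (fun m => (mollifierBump n hR m).rOut) Filter.atTop (nhds 0) := by
  simp only [mollifierBump_rOut]
  have := (tendsto_one_div_add_atTop_nhds_zero_nat (𝕜 := ℝ)).const_mul R
  simpa [div_eq_mul_inv] using this

lemma mollifier_neg (m : ℕ) (x : Euc n) : mollifier n hR m (-x) = mollifier n hR m x :=
  ContDiffBump.normed_neg _ _

lemma mollifier_sub_comm (m : ℕ) (x y : Euc n) :
    mollifier n hR m (x - y) = mollifier n hR m (y - x) := by
  rw [← mollifier_neg, neg_sub]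

lemma contDiff_mollifier (m : ℕ) {r : ℕ∞} : ContDiff ℝ r (mollifier n hR m) :=
  ContDiffBump.contDiff_normed _

lemma hasCompactSupport_mollifier (m : ℕ) : HasCompactSupport (mollifier n hR m) :=
  ContDiffBump.hasCompactSupport_normed _

lemma mollifier_nonneg (m : ℕ) (x : Euc n) : 0 ≤ mollifier n hR m x :=
  ContDiffBump.nonneg_normed _ _

lemma tsupport_mollifier_sub_subset (m : ℕ) (x : Euc n) :
    tsupport (fun y => mollifier n hR m (x - y)) ⊆ Metric.closedBall x R := by
  refine closure_minimal ?_ Metric.isClosed_closedBall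
  intro y hy
  have h : x - y ∈ Function.support (mollifier n hR m) := hy
  rw [mollifier, ContDiffBump.support_normed_eq] at h
  rw [Metric.mem_closedBall, dist_comm, dist_eq_norm]
  rw [mem_ball_zero_iff] at h
  exact h.le.trans (mollifierBump_rOut_le hR m)

lemma mollify_eq_convolution (m : ℕ) (f : Euc n → ℝ) (x : Euc n) :
    mollify hR m f x = convolution (mollifier n hR m) f (ContinuousLinearMap.lsmul ℝ ℝ) volume x := by
  rw [mollify, convolution_def, ← integral_sub_left_eq_self _ _ x]
  congr 1; ext y
  simp [mul_comm]

lemma mollify_eq_convolution_right (m : ℕ) (f : Euc n → ℝ) :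
    mollify hR m f = convolution f (mollifier n hR m) (ContinuousLinearMap.mul ℝ ℝ) volume := rfl

lemma contDiff_mollify (m : ℕ) {f : Euc n → ℝ} (hf : LocallyIntegrable f) {r : ℕ∞} :
    ContDiff ℝ r (mollify hR m f) := by
  rw [mollify_eq_convolution_right]
  exact (hasCompactSupport_mollifier hR m).contDiff_convolution_right _ hf
    (contDiff_mollifier hR m)

lemma partialDeriv_mollify (m : ℕ) {f : Euc n → ℝ} (hf : LocallyIntegrable f) (k : Fin n)
    (x : Euc n) :
    partialDeriv (mollify hR m f) k x = ∫ y, f y * partialDeriv (mollifier n hR m) k (x - y) := by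
  have h := (hasCompactSupport_mollifier (n := n) hR m).hasFDerivAt_convolution_right
    (ContinuousLinearMap.mul ℝ ℝ) hf (contDiff_mollifier hR m) x
  rw [← mollify_eq_convolution_right] at h
  unfold partialDeriv
  rw [h.fderiv, convolution_precompR_apply _ hf ((hasCompactSupport_mollifier hR m).fderiv ℝ)
    ((contDiff_mollifier hR m (r := 1)).continuous_fderiv (by simp))]
  rfl

/-- Mollification commutes with weak differentiation. -/
lemma HasWeakPartialDeriv.partialDeriv_mollify {U K : Set (Euc n)} {f w : Euc n → ℝ} {k : Fin n}
    (h : HasWeakPartialDeriv U f k w) (hK : IsCompact K) (hKU : K ⊆ U) (m : ℕ) {x : Euc n}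
    (hx : Metric.closedBall x R ⊆ K) :
    partialDeriv (mollify hR m (K.indicator f)) k x = mollify hR m (K.indicator w) x := by
  have hfi : Integrable (K.indicator f) :=
    (h.1.integrableOn_compact_subset hKU hK).integrable_indicator hK.measurableSet
  rw [_root_.partialDeriv_mollify hR m hfi.locallyIntegrable]
  -- As a function of `y` the reflected kernel is a test function supported in `K`, so the
  -- derivative falling on it can be moved to `f`; the reflection accounts for the sign in `hd`.
  set ψ : Euc n → ℝ := fun y => mollifier n hR m (x - y) with hψ
  have hψc : ContDiff ℝ ∞ ψ := (contDiff_mollifier hR m).comp (contDiff_const.sub contDiff_id)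
  have hψs : tsupport ψ ⊆ K := (tsupport_mollifier_sub_subset hR m x).trans hx
  have hψcs : HasCompactSupport ψ := hK.of_isClosed_subset (isClosed_tsupport _) hψs
  have hd : ∀ y, partialDeriv ψ k y = - partialDeriv (mollifier n hR m) k (x - y) := by
    intro y
    have h1 : HasFDerivAt (fun z : Euc n => x - z) (-ContinuousLinearMap.id ℝ (Euc n)) y :=
      (hasFDerivAt_id y).const_sub x
    have h2 := (((contDiff_mollifier hR m (r := 1)).differentiable (by simp)
      (x - y)).hasFDerivAt).comp y h1
    have e : mollifier n hR m ∘ (fun z => x - z) = ψ := rfl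
    rw [e] at h2
    unfold partialDeriv
    rw [h2.fderiv]
    simp
  have hh := h.2.2 ψ hψc hψcs (hψs.trans hKU)
  simp only [hd] at hh
  have e1 : ∀ y, K.indicator f y * partialDeriv (mollifier n hR m) k (x - y)
      = - (f y * - partialDeriv (mollifier n hR m) k (x - y)) := by
    intro y
    by_cases hy : y ∈ K
    · simp [hy]
    · have : partialDeriv (mollifier n hR m) k (x - y) = 0 := by
        rw [← neg_eq_zero, ← hd]
        exact partialDeriv_eq_zero_of_notMem_tsupport (fun h => hy (hψs h)) k
      simp [this]
  simp only [e1, integral_neg, hh, neg_neg, mollify]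
  congr 1; ext y
  by_cases hy : y ∈ K
  · simp [hy, hψ]
  · have : ψ y = 0 := image_eq_zero_of_notMem_tsupport (fun h => hy (hψs h))
    simp [hy, this]

/-- Joint convergence of mollifications. -/
lemma tendsto_mollify {c : ℕ → Euc n → ℝ} {y : Euc n} {L : ℝ}
    (hc : ∀ᶠ m in Filter.atTop, AEStronglyMeasurable (c m) volume)
    (h : Filter.Tendsto (Function.uncurry c) (Filter.atTop ×ˢ nhds y) (nhds L)) :
    Filter.Tendsto (Function.uncurry fun m x => mollify hR m (c m) x) (Filter.atTop ×ˢ nhds y)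
      (nhds L) := by
  have := ContDiffBump.convolution_tendsto_right (μ := (volume : Measure (Euc n)))
    (φ := fun p : ℕ × Euc n => mollifierBump n hR p.1) (g := fun p => c p.1)
    (k := fun p : ℕ × Euc n => p.2) (x₀ := y) (z₀ := L) (l := Filter.atTop ×ˢ nhds y)
    ((tendsto_mollifierBump_rOut hR).comp Filter.tendsto_fst)
    (Filter.tendsto_fst.eventually hc) ?_ Filter.tendsto_snd
  · refine this.congr fun p => ?_
    simp only [Function.uncurry, mollify_eq_convolution]
    rfl
  · exact h.comp ((Filter.tendsto_fst.comp Filter.tendsto_fst).prodMk Filter.tendsto_snd)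

end mollify

end weak

/-! ### The chain rule for weak derivatives -/

section chain
variable {n : ℕ}

open Filter Topology

/-- The kernel is even, so mollification is symmetric by Fubini. -/
lemma integral_mul_mollify {R : ℝ} (hR : 0 < R) (m : ℕ) {c v : Euc n → ℝ}
    (hc : Continuous c) (hcc : HasCompactSupport c) (hv : Integrable v) :
    ∫ x, c x * mollify hR m v x = ∫ y, v y * mollify hR m c y := by
  have hci : Integrable c := hc.integrable_of_hasCompactSupport hcc
  obtain ⟨C, hC⟩ := (hasCompactSupport_mollifier (n := n) hR m).exists_bound_of_continuous
    (contDiff_mollifier hR m (r := 0)).continuous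
  have hint : Integrable (Function.uncurry fun x y => c x * (v y * mollifier n hR m (x - y)))
      (volume.prod volume) := by
    have h1 := (hci.mul_prod hv).mul_bdd (c := C)
      (g := fun z : Euc n × Euc n => mollifier n hR m (z.1 - z.2))
      (((contDiff_mollifier hR m (r := 0)).continuous.comp
        (continuous_fst.sub continuous_snd)).aestronglyMeasurable)
      (Eventually.of_forall fun z => hC _)
    refine h1.congr (Eventually.of_forall fun z => ?_)
    simp only [Function.uncurry]; ring
  unfold mollify
  simp only [← integral_const_mul]
  rw [integral_integral_swap hint]
  congr 1; ext y
  congr 1; ext x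
  rw [mollifier_sub_comm]; ring

/-- Pairing the mollifications of an integrable function with a convergent sequence of test
functions. -/
lemma tendsto_integral_mul_mollify {R : ℝ} (hR : 0 < R) {v c : Euc n → ℝ} {C : ℕ → Euc n → ℝ}
    (hv : Integrable v) (hcont : ∀ᶠ m in atTop, Continuous (C m))
    (hsupp : ∀ᶠ m in atTop, HasCompactSupport (C m)) {B : ℝ}
    (hB : ∀ᶠ m in atTop, ∀ x, |C m x| ≤ B)
    (hlim : ∀ y, Tendsto (Function.uncurry C) (atTop ×ˢ 𝓝 y) (𝓝 (c y))) :
    Tendsto (fun m => ∫ x, C m x * mollify hR m v x) atTop (𝓝 (∫ y, v y * c y)) := by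
  -- Moving the mollification onto the continuous factor leaves the fixed integrable `v` outside, so
  -- bounded pointwise convergence suffices and no `L¹` convergence of the mollifications of `v` is
  -- needed.
  have h1 : (fun m => ∫ y, v y * mollify hR m (C m) y)
      =ᶠ[atTop] fun m => ∫ x, C m x * mollify hR m v x := by
    filter_upwards [hcont, hsupp] with m h1 h2
    exact (integral_mul_mollify hR m h1 h2 hv).symm
  refine Tendsto.congr' h1 ?_
  refine tendsto_integral_filter_of_dominated_convergence (fun y => |v y| * B) ?_ ?_ ?_ ?_
  · filter_upwards [hcont] with m h1
    exact hv.aestronglyMeasurable.mul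
      (contDiff_mollify hR m h1.locallyIntegrable (r := 0)).continuous.aestronglyMeasurable
  · filter_upwards [hcont, hB] with m h1 h2
    refine Eventually.of_forall fun y => ?_
    rw [norm_mul, Real.norm_eq_abs, Real.norm_eq_abs]
    refine mul_le_mul_of_nonneg_left ?_ (abs_nonneg _)
    rw [mollify_eq_convolution]
    have h3 := ContDiffBump.integral_normed (mollifierBump n hR m) (μ := volume)
    have h4 := ContDiffBump.integrable_normed (mollifierBump n hR m) (μ := volume)
    rw [convolution_def]
    calc |∫ t, (ContinuousLinearMap.lsmul ℝ ℝ) (mollifier n hR m t) (C m (y - t))|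
        ≤ ∫ t, mollifier n hR m t * B := by
          rw [← Real.norm_eq_abs]
          refine norm_integral_le_of_norm_le (g := fun t => mollifier n hR m t * B)
            (h4.mul_const B) (Eventually.of_forall fun t => ?_)
          simp only [ContinuousLinearMap.lsmul_apply, smul_eq_mul, norm_mul, Real.norm_eq_abs]
          rw [abs_of_nonneg (mollifier_nonneg hR m t)]
          exact mul_le_mul_of_nonneg_left (h2 _) (mollifier_nonneg hR m t)
      _ = B := by rw [integral_mul_const, mollifier, h3, one_mul]
  · exact hv.abs.mul_const B
  · refine Eventually.of_forall fun y => ?_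
    have h2 := tendsto_mollify hR (c := C) (hcont.mono fun m h => h.aestronglyMeasurable) (hlim y)
    have h1 : Tendsto (fun m : ℕ => (m, y)) atTop (atTop ×ˢ 𝓝 y) :=
      tendsto_id.prodMk tendsto_const_nhds
    have h3 : Tendsto (fun m => mollify hR m (C m) y) atTop (𝓝 (c y)) := h2.comp h1
    exact h3.const_mul _

lemma MeasureTheory.LocallyIntegrableOn.finset_sum {ι : Type*} (s : Finset ι) {U : Set (Euc n)}
    {f : ι → Euc n → ℝ} (h : ∀ i ∈ s, LocallyIntegrableOn (f i) U volume) :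
    LocallyIntegrableOn (fun y => ∑ i ∈ s, f i y) U volume := by
  classical
  induction s using Finset.induction_on with
  | empty => simpa using (locallyIntegrable_zero (μ := volume)).locallyIntegrableOn U
  | insert a s ha ih =>
    simp only [Finset.sum_insert ha]
    exact (h a (Finset.mem_insert_self a s)).add
      (ih fun i hi => h i (Finset.mem_insert_of_mem hi))

set_option maxHeartbeats 1000000 in
/-- The chain rule for continuous functions with weak derivatives. -/
theorem HasWeakPartialDeriv.comp_contDiffOn {ι : Type*} [Fintype ι] [DecidableEq ι]
    {U : Set (Euc n)} (hU : IsOpen U) {f w : ι → Euc n → ℝ} {k : Fin n}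
    (hf : ∀ i, ContinuousOn (f i) U) (hw : ∀ i, HasWeakPartialDeriv U (f i) k (w i))
    {O : Set (ι → ℝ)} (hO : IsOpen O) {Φ : (ι → ℝ) → ℝ} (hΦ : ContDiffOn ℝ 1 Φ O)
    (hmaps : ∀ y ∈ U, (fun i => f i y) ∈ O) :
    HasWeakPartialDeriv U (fun y => Φ fun i => f i y) k
      (fun y => ∑ i, fderiv ℝ Φ (fun i => f i y) (Pi.single i 1) * w i y) := by
  have hfpi : ContinuousOn (fun y => (fun i => f i y : ι → ℝ)) U := continuousOn_pi.2 hf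
  have hΦf : ContinuousOn (fun y => Φ fun i => f i y) U := hΦ.continuousOn.comp hfpi hmaps
  have hdΦ : ∀ i, ContinuousOn (fun z => fderiv ℝ Φ z (Pi.single i 1)) O := fun i =>
    (hΦ.continuousOn_fderiv_of_isOpen hO (by simp)).clm_apply continuousOn_const
  have hdΦf : ∀ i, ContinuousOn (fun y => fderiv ℝ Φ (fun i => f i y) (Pi.single i 1)) U :=
    fun i => (hdΦ i).comp hfpi hmaps
  have hsum : LocallyIntegrableOn
      (fun y => ∑ i, fderiv ℝ Φ (fun i => f i y) (Pi.single i 1) * w i y) U volume :=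
    LocallyIntegrableOn.finset_sum _ fun i _ =>
      (hw i).2.1.continuousOn_mul (hdΦf i) hU.isLocallyClosed
  refine ⟨hΦf.locallyIntegrableOn hU.measurableSet, hsum, fun ψ hψ hψc hψs => ?_⟩
  have hKc : IsCompact (tsupport ψ) := hψc
  obtain ⟨R, hR, hRU⟩ := hKc.exists_cthickening_subset_open hU hψs
  set K := Metric.cthickening R (tsupport ψ) with hK
  have hKcomp : IsCompact K := hKc.cthickening
  have hball : ∀ x ∈ tsupport ψ, Metric.closedBall x R ⊆ K := fun x hx =>
    Metric.closedBall_subset_cthickening hx R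
  have hKint : ∀ x ∈ tsupport ψ, K ∈ 𝓝 x := fun x hx =>
    Filter.mem_of_superset (Metric.closedBall_mem_nhds x hR) (hball x hx)
  have hfi : ∀ i, Integrable (K.indicator (f i)) := fun i =>
    ((hw i).1.integrableOn_compact_subset hRU hKcomp).integrable_indicator hKcomp.measurableSet
  have hwi : ∀ i, Integrable (K.indicator (w i)) := fun i =>
    ((hw i).2.1.integrableOn_compact_subset hRU hKcomp).integrable_indicator hKcomp.measurableSet
  set F : ℕ → Euc n → ι → ℝ := fun m x i => mollify hR m (K.indicator (f i)) x with hF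
  -- joint convergence of the mollified functions
  have hFlim : ∀ y ∈ tsupport ψ,
      Tendsto (Function.uncurry F) (atTop ×ˢ 𝓝 y) (𝓝 fun i => f i y) := by
    intro y hy
    rw [tendsto_pi_nhds]
    intro i
    refine tendsto_mollify hR (c := fun _ => K.indicator (f i))
      (Eventually.of_forall fun _ => (hfi i).aestronglyMeasurable) ?_
    have h1 : Tendsto (K.indicator (f i)) (𝓝 y) (𝓝 (f i y)) := by
      have h2 : ContinuousAt (f i) y := (hf i).continuousAt (hU.mem_nhds (hψs hy))
      refine Tendsto.congr' ?_ h2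
      filter_upwards [hKint y hy] with z hz
      rw [Set.indicator_of_mem hz]
    exact h1.comp tendsto_snd
  have hsmooth : ∀ m i, ContDiff ℝ 1 fun x => F m x i := fun m i =>
    contDiff_mollify hR m (hfi i).locallyIntegrable
  -- Convergence is joint in the index and the point, so compactness of `tsupport ψ` turns a
  -- condition holding near each limit value into one that holds on the whole support from some
  -- index on. This puts the mollified values in `O` and bounds continuous functions of them.
  have hunif : ∀ P : (ι → ℝ) → Prop, (∀ y ∈ tsupport ψ, ∀ᶠ z in 𝓝 fun i => f i y, P z) →
      ∀ᶠ m in atTop, ∀ x ∈ tsupport ψ, P (F m x) := by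
    intro P hP
    have h1 : ∀ᶠ p : ℕ × Euc n in atTop ×ˢ 𝓝ˢ (tsupport ψ), P (F p.1 p.2) :=
      hKc.mem_prod_nhdsSet_of_forall fun y hy => (hFlim y hy).eventually (hP y hy)
    exact h1.curry.mono fun m h x hx => h.self_of_nhdsSet x hx
  have hFO : ∀ᶠ m in atTop, ∀ x ∈ tsupport ψ, F m x ∈ O :=
    hunif (fun z => z ∈ O) fun y hy => hO.mem_nhds (hmaps y (hψs hy))
  -- bounds
  obtain ⟨B₀, hB₀⟩ := hψc.exists_bound_of_continuous hψ.continuous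
  have hbd : ∀ g : (ι → ℝ) → ℝ, ContinuousOn g O →
      ∃ B, ∀ᶠ m in atTop, ∀ x ∈ tsupport ψ, |g (F m x)| ≤ B := by
    intro g hg
    obtain ⟨B, hB⟩ : ∃ B, ∀ y ∈ tsupport ψ, ‖g fun i => f i y‖ ≤ B :=
      hKc.exists_bound_of_continuousOn ((hg.comp hfpi hmaps).mono hψs)
    refine ⟨B + 1, hunif (fun z => |g z| ≤ B + 1) fun y hy => ?_⟩
    have h2 : ContinuousAt g fun i => f i y := hg.continuousAt (hO.mem_nhds (hmaps y (hψs hy)))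
    have h3 : |g fun i => f i y| < B + 1 := lt_of_le_of_lt (hB y hy) (lt_add_one B)
    exact (h2.abs.eventually_lt_const h3).mono fun z hz => hz.le
  -- the limit of a product with a test function
  have hlimprod : ∀ (g : (ι → ℝ) → ℝ) (χ : Euc n → ℝ), ContinuousOn g O → Continuous χ →
      tsupport χ ⊆ tsupport ψ → ∀ y, Tendsto (Function.uncurry fun m x => g (F m x) * χ x)
        (atTop ×ˢ 𝓝 y) (𝓝 ((g fun i => f i y) * χ y)) := by
    intro g χ hg hχ hχs y
    by_cases hy : y ∈ tsupport ψ
    · have h2 : ContinuousAt g fun i => f i y := hg.continuousAt (hO.mem_nhds (hmaps y (hψs hy)))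
      exact (h2.tendsto.comp (hFlim y hy)).mul (hχ.continuousAt.tendsto.comp tendsto_snd)
    · have h0 : χ y = 0 := image_eq_zero_of_notMem_tsupport fun h => hy (hχs h)
      rw [h0, mul_zero]
      refine tendsto_const_nhds.congr' ?_
      have h1 : ∀ᶠ x in 𝓝 y, x ∉ tsupport ψ := (isClosed_tsupport ψ).isOpen_compl.mem_nhds hy
      filter_upwards [tendsto_snd.eventually h1] with p hp
      simp only [Function.uncurry]
      rw [image_eq_zero_of_notMem_tsupport fun h => hp (hχs h), mul_zero]
  have hlimseq : ∀ (g : (ι → ℝ) → ℝ) (χ : Euc n → ℝ), ContinuousOn g O → Continuous χ →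
      tsupport χ ⊆ tsupport ψ → ∀ y, Tendsto (fun m => g (F m y) * χ y) atTop
        (𝓝 ((g fun i => f i y) * χ y)) := by
    intro g χ hg hχ hχs y
    have h1 : Tendsto (fun m : ℕ => (m, y)) atTop (atTop ×ˢ 𝓝 y) :=
      tendsto_id.prodMk tendsto_const_nhds
    have h2 := hlimprod g χ hg hχ hχs y
    have h3 := h2.comp h1
    simpa only [Function.comp_def, Function.uncurry_apply_pair] using h3
  have hcontprod : ∀ (g : (ι → ℝ) → ℝ) (χ : Euc n → ℝ), ContinuousOn g O → Continuous χ →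
      tsupport χ ⊆ tsupport ψ → ∀ᶠ m in atTop, Continuous fun x => g (F m x) * χ x := by
    intro g χ hg hχ hχs
    filter_upwards [hFO] with m hm
    refine continuous_iff_continuousAt.2 fun x => ?_
    by_cases hx : x ∈ tsupport ψ
    · have h2 : ContinuousAt g (F m x) := hg.continuousAt (hO.mem_nhds (hm x hx))
      have h3 : ContinuousAt (F m) x := (continuous_pi fun i => (hsmooth m i).continuous).continuousAt
      exact (ContinuousAt.comp h2 h3).mul hχ.continuousAt
    · have h1 : ∀ᶠ z in 𝓝 x, z ∉ tsupport ψ := (isClosed_tsupport ψ).isOpen_compl.mem_nhds hx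
      refine (continuousAt_const (y := (0 : ℝ))).congr ?_
      filter_upwards [h1] with z hz
      rw [image_eq_zero_of_notMem_tsupport fun h => hz (hχs h), mul_zero]
  -- the identity for the mollified functions
  have hid : ∀ᶠ m in atTop, ∫ x, Φ (F m x) * partialDeriv ψ k x
      = - ∑ i, ∫ x, (fderiv ℝ Φ (F m x) (Pi.single i 1) * ψ x) * mollify hR m (K.indicator (w i)) x := by
    filter_upwards [hFO, eventually_all.2 fun i => hcontprod _ ψ (hdΦ i) hψ.continuous subset_rfl,
      hcontprod Φ (partialDeriv ψ k) hΦ.continuousOn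
        ((hψ.of_le (m := 1) (by simp)).continuous_partialDeriv k) (tsupport_partialDeriv_subset ψ k)]
      with m hm hci hcΦ
    have hFpi : ContDiff ℝ 1 (F m) := contDiff_pi.2 (hsmooth m)
    have hprod : ContDiff ℝ 1 fun x => Φ (F m x) * ψ x :=
      contDiff_of_contDiffAt_tsupport fun x hx =>
        ((hΦ.contDiffAt (hO.mem_nhds (hm x (tsupport_mul_subset_right hx)))).comp x
          hFpi.contDiffAt).mul (hψ.of_le (by simp)).contDiffAt
    have hz := integral_partialDeriv_eq_zero hprod hψc.mul_left k
    have e : ∀ x, partialDeriv (fun x => Φ (F m x) * ψ x) k x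
        = (∑ i, (fderiv ℝ Φ (F m x) (Pi.single i 1) * ψ x) * mollify hR m (K.indicator (w i)) x)
          + Φ (F m x) * partialDeriv ψ k x := by
      intro x
      by_cases hx : x ∈ tsupport ψ
      · have hΦd : DifferentiableAt ℝ Φ (F m x) :=
          (hΦ.contDiffAt (hO.mem_nhds (hm x hx))).differentiableAt (by simp)
        have hFd : DifferentiableAt ℝ (F m) x := hFpi.differentiable (by simp) x
        have hcd : DifferentiableAt ℝ (fun x => Φ (F m x)) x := hΦd.comp x hFd
        rw [partialDeriv_mul hcd (hψ.differentiable (by simp) x)]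
        congr 1
        have e1 : partialDeriv (fun x => Φ (F m x)) k x
            = ∑ i, fderiv ℝ Φ (F m x) (Pi.single i 1) * mollify hR m (K.indicator (w i)) x := by
          have h1 : partialDeriv (fun x => Φ (F m x)) k x
              = fderiv ℝ Φ (F m x) (fderiv ℝ (F m) x (EuclideanSpace.single k 1)) := by
            unfold partialDeriv
            have := fderiv_comp x hΦd hFd
            have e : Φ ∘ F m = fun x => Φ (F m x) := rfl
            rw [e] at this; rw [this]; rfl
          have h2 : fderiv ℝ (F m) x (EuclideanSpace.single k 1)
              = fun i => mollify hR m (K.indicator (w i)) x := by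
            ext i
            rw [← (hw i).partialDeriv_mollify hR hKcomp hRU m (hball x hx), fderiv_pi
              (fun i => (hsmooth m i).differentiable (by simp) x)]
            rfl
          rw [h1, h2]
          conv_lhs => rw [pi_eq_sum_univ' fun i => mollify hR m (K.indicator (w i)) x]
          rw [map_sum]
          refine Finset.sum_congr rfl fun i _ => ?_
          rw [map_smul, smul_eq_mul, mul_comm]
        rw [e1, Finset.sum_mul]
        exact Finset.sum_congr rfl fun i _ => by ring
      · rw [partialDeriv_eq_zero_of_notMem_tsupport hx, image_eq_zero_of_notMem_tsupport hx,
          partialDeriv_eq_zero_of_notMem_tsupport (fun h => hx (tsupport_mul_subset_right h))]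
        simp
    simp only [e] at hz
    have hi1 : ∀ i ∈ Finset.univ, Integrable fun x => (fderiv ℝ Φ (F m x) (Pi.single i 1) * ψ x)
        * mollify hR m (K.indicator (w i)) x := fun i _ =>
      ((hci i).mul (contDiff_mollify hR m (hwi i).locallyIntegrable
        (r := 0)).continuous).integrable_of_hasCompactSupport (hψc.mul_left.mul_right)
    have hi2 : Integrable fun x => Φ (F m x) * partialDeriv ψ k x :=
      hcΦ.integrable_of_hasCompactSupport (hψc.partialDeriv k).mul_left
    rw [integral_add (integrable_finsetSum _ hi1) hi2, integral_finsetSum _ hi1] at hz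
    linarith
  -- passage to the limit
  choose B₁ hB₁ using fun i => hbd (fun z => fderiv ℝ Φ z (Pi.single i 1)) (hdΦ i)
  obtain ⟨B₂, hB₂⟩ := hbd Φ hΦ.continuousOn
  have hψ' := (hψ.of_le (m := 1) (by simp)).continuous_partialDeriv k
  have hL : Tendsto (fun m => ∫ x, Φ (F m x) * partialDeriv ψ k x) atTop
      (𝓝 (∫ x, (Φ fun i => f i x) * partialDeriv ψ k x)) := by
    refine tendsto_integral_filter_of_dominated_convergence (fun x => B₂ * |partialDeriv ψ k x|)
      ?_ ?_ ?_ ?_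
    · filter_upwards [hcontprod Φ (partialDeriv ψ k) hΦ.continuousOn hψ'
        (tsupport_partialDeriv_subset ψ k)] with m hm
      exact hm.aestronglyMeasurable
    · filter_upwards [hB₂] with m hm
      refine Eventually.of_forall fun x => ?_
      by_cases hx : x ∈ tsupport ψ
      · rw [norm_mul, Real.norm_eq_abs, Real.norm_eq_abs]
        exact mul_le_mul_of_nonneg_right (hm x hx) (abs_nonneg _)
      · simp [partialDeriv_eq_zero_of_notMem_tsupport hx]
    · exact ((hψ'.integrable_of_hasCompactSupport (hψc.partialDeriv k)).abs).const_mul _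
    · refine Eventually.of_forall fun x => ?_
      exact hlimseq Φ (partialDeriv ψ k) hΦ.continuousOn hψ'
        (tsupport_partialDeriv_subset ψ k) x
  have hRR : Tendsto (fun m => - ∑ i, ∫ x, (fderiv ℝ Φ (F m x) (Pi.single i 1) * ψ x)
      * mollify hR m (K.indicator (w i)) x) atTop
      (𝓝 (- ∑ i, ∫ x, K.indicator (w i) x * (fderiv ℝ Φ (fun i => f i x) (Pi.single i 1) * ψ x))) := by
    refine (tendsto_finsetSum _ fun i _ => ?_).neg
    -- The absolute value keeps the bound nonnegative even if `tsupport ψ` is empty, when nothing is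
    -- known about `B₁ i`.
    refine tendsto_integral_mul_mollify hR (hwi i) (B := |B₁ i| * B₀)
      (hcontprod _ ψ (hdΦ i) hψ.continuous subset_rfl)
      (Eventually.of_forall fun m => hψc.mul_left) ?_
      (hlimprod _ ψ (hdΦ i) hψ.continuous subset_rfl)
    filter_upwards [hB₁ i] with m hm x
    rw [abs_mul]
    by_cases hx : x ∈ tsupport ψ
    · exact mul_le_mul ((hm x hx).trans (le_abs_self _)) (hB₀ x) (abs_nonneg _) (abs_nonneg _)
    · rw [image_eq_zero_of_notMem_tsupport hx, abs_zero, mul_zero]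
      exact mul_nonneg (abs_nonneg _) ((norm_nonneg _).trans (hB₀ x))
  have hfin := tendsto_nhds_unique (hL.congr' hid) hRR
  rw [hfin]
  have hi : ∀ i ∈ Finset.univ, Integrable fun x =>
      (fderiv ℝ Φ (fun i => f i x) (Pi.single i 1) * w i x) * ψ x := fun i _ =>
    ((hw i).2.1.continuousOn_mul (hdΦf i) hU.isLocallyClosed).integrable_mul_test
      hψ.continuous hψc hψs
  simp only [Finset.sum_mul]
  rw [integral_finsetSum _ hi]
  congr 1
  refine Finset.sum_congr rfl fun i _ => ?_
  congr 1; ext x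
  by_cases hx : x ∈ K
  · rw [Set.indicator_of_mem hx]; ring
  · have : ψ x = 0 := image_eq_zero_of_notMem_tsupport fun h =>
      hx (Metric.self_subset_cthickening _ h)
    simp [this]

end chain

/-! ### Cutoff functions near sets of finite Hausdorff measure -/

section cutoff

open Filter Topology

/-- Finite measure in a dimension below `n` forces `n`-dimensional Hausdorff measure zero, and
Lebesgue measure is a multiple of the latter by uniqueness of Haar measure. -/
lemma volume_eq_zero_of_hausdorffMeasure_lt_top {n : ℕ} {s : ℝ} (hs : s < n) {Z : Set (Euc n)}
    (h : Measure.hausdorffMeasure s Z < ⊤) : volume Z = 0 := by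
  have h1 : Measure.hausdorffMeasure (n : ℝ) Z = 0 :=
    (Measure.hausdorffMeasure_zero_or_top hs Z).resolve_right h.ne
  have hfr : Module.finrank ℝ (Euc n) = n := by simp
  have inst : Measure.IsAddHaarMeasure (Measure.hausdorffMeasure (n : ℝ) : Measure (Euc n)) := by
    have := isAddHaarMeasure_hausdorffMeasure (E := Euc n)
    rwa [hfr] at this
  have h2 := Measure.isAddLeftInvariant_eq_smul (volume : Measure (Euc n))
    (Measure.hausdorffMeasure (n : ℝ))
  rw [h2]
  simp [h1]

/-- Take a countable cover by sets of small diameter from the definition of Hausdorff measure and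
replace each set meeting `Z` by a ball about one of its points in `Z`, of radius slightly larger
than the diameter. The excess is paid from the gap below `C`, and compactness makes the cover
finite. -/
lemma exists_finite_ball_cover {X : Type*} [MetricSpace X] [Nonempty X] [MeasurableSpace X] [BorelSpace X]
    {Z : Set X} (hZ : IsCompact Z) {s : ℝ} (hs : 0 ≤ s) {C : ℝ≥0∞}
    (hC : Measure.hausdorffMeasure s Z < C) {δ : ℝ} (hδ : 0 < δ) :
    ∃ (I : Finset ℕ) (y : ℕ → X) (r : ℕ → ℝ), (∀ i ∈ I, 0 < r i ∧ r i ≤ δ ∧ y i ∈ Z) ∧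
      Z ⊆ ⋃ i ∈ I, Metric.ball (y i) (r i) ∧ ∑ i ∈ I, ENNReal.ofReal (r i) ^ s ≤ C := by
  rcases Z.eq_empty_or_nonempty with rfl | ⟨z₀, hz₀⟩
  · exact ⟨∅, fun _ => Classical.arbitrary X, fun _ => 0, by simp, by simp, by simp⟩
  rw [Measure.hausdorffMeasure_apply] at hC
  -- Diameters at most `δ / 2` and radii less than diameter plus `δ / 2` keep the radii at most `δ`.
  have hC' := (le_iSup₂ (f := fun (r : ℝ≥0∞) (_ : 0 < r) =>
    ⨅ (t : ℕ → Set X) (_ : Z ⊆ ⋃ n, t n) (_ : ∀ n, Metric.ediam (t n) ≤ r),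
      ∑' n, ⨆ _ : (t n).Nonempty, Metric.ediam (t n) ^ s) (ENNReal.ofReal (δ / 2))
        (by simpa using hδ)).trans_lt hC
  simp only [iInf_lt_iff] at hC'
  obtain ⟨t, htZ, htd, hsum⟩ := hC'
  obtain ⟨ε, hε, hεsum⟩ : ∃ ε : ℕ → NNReal, (∀ i, 0 < ε i) ∧
      (∑' n, ⨆ _ : (t n).Nonempty, Metric.ediam (t n) ^ s) + ∑' i, (ε i : ℝ≥0∞) ≤ C := by
    obtain ⟨ε, h1, h2⟩ := ENNReal.exists_pos_sum_of_countable (tsub_pos_of_lt hsum).ne' ℕ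
    exact ⟨ε, h1, by
      calc _ ≤ _ + (C - _) := add_le_add_right h2.le _
        _ = C := add_tsub_cancel_of_le hsum.le⟩
  have hdiam : ∀ i, Metric.ediam (t i) ≠ ⊤ := fun i =>
    ((htd i).trans_lt ENNReal.ofReal_lt_top).ne
  have hr : ∀ i, ∃ r : ℝ, (Metric.ediam (t i)).toReal < r ∧ r < (Metric.ediam (t i)).toReal + δ / 2 ∧
      ENNReal.ofReal r ^ s ≤ Metric.ediam (t i) ^ s + ε i := by
    intro i
    set d := (Metric.ediam (t i)).toReal with hd
    have hde : Metric.ediam (t i) = ENNReal.ofReal d := (ENNReal.ofReal_toReal (hdiam i)).symm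
    have hcont : Tendsto (fun x : ℝ => ENNReal.ofReal x ^ s) (𝓝[>] d) (𝓝 (ENNReal.ofReal d ^ s)) :=
      ((ENNReal.continuous_rpow_const.comp ENNReal.continuous_ofReal).tendsto d).mono_left
        nhdsWithin_le_nhds
    have h1 : ENNReal.ofReal d ^ s < ENNReal.ofReal d ^ s + ε i :=
      ENNReal.lt_add_right (ENNReal.rpow_lt_top_of_nonneg hs ENNReal.ofReal_ne_top).ne
        (by simpa using (hε i).ne')
    have h2 : ∀ᶠ x in 𝓝[>] d, x < d + δ / 2 :=
      nhdsWithin_le_nhds (eventually_lt_nhds (by linarith))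
    obtain ⟨r, ⟨hr1, hr2⟩, hr3⟩ :=
      ((hcont.eventually_lt_const h1).and h2 |>.and self_mem_nhdsWithin).exists
    exact ⟨r, hr3, hr2, by rw [hde]; exact hr1.le⟩
  choose r hr1 hr2 hr3 using hr
  -- Sets that miss `Z` get a dummy centre; they are left out of the cover.
  have hy : ∀ i, ∃ y, y ∈ Z ∧ ((t i ∩ Z).Nonempty → y ∈ t i) := by
    intro i
    by_cases h : (t i ∩ Z).Nonempty
    · obtain ⟨y, h1, h2⟩ := h
      exact ⟨y, h2, fun _ => h1⟩
    · exact ⟨z₀, hz₀, fun h' => absurd h' h⟩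
  choose y hyZ hyt using hy
  have hrpos : ∀ i, 0 < r i := fun i => ENNReal.toReal_nonneg.trans_lt (hr1 i)
  have hcover : Z ⊆ ⋃ i : {i // (t i ∩ Z).Nonempty}, Metric.ball (y i) (r i) := by
    intro z hz
    obtain ⟨i, hi⟩ := Set.mem_iUnion.1 (htZ hz)
    have hne : (t i ∩ Z).Nonempty := ⟨z, hi, hz⟩
    refine Set.mem_iUnion.2 ⟨⟨i, hne⟩, ?_⟩
    rw [Metric.mem_ball]
    refine lt_of_le_of_lt ?_ (hr1 i)
    rw [dist_edist]
    exact ENNReal.toReal_mono (hdiam i) (Metric.edist_le_ediam_of_mem hi (hyt i hne))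
  obtain ⟨I, hI⟩ := hZ.elim_finite_subcover _ (fun i => Metric.isOpen_ball) hcover
  refine ⟨I.map (Function.Embedding.subtype _), y, r, fun i _ => ⟨hrpos i, ?_, hyZ i⟩, ?_, ?_⟩
  · have h1 : (Metric.ediam (t i)).toReal ≤ δ / 2 := by
      have := ENNReal.toReal_mono ENNReal.ofReal_ne_top (htd i)
      rwa [ENNReal.toReal_ofReal (by linarith)] at this
    have := hr2 i
    linarith
  · refine hI.trans (Set.iUnion₂_subset fun i hi => ?_)
    exact Set.subset_biUnion_of_mem (u := fun i => Metric.ball (y i) (r i))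
      (Finset.mem_map_of_mem (Function.Embedding.subtype _) hi)
  · rw [Finset.sum_map]
    calc ∑ i ∈ I, ENNReal.ofReal (r i) ^ s
        ≤ ∑ i ∈ I, ((⨆ _ : (t i).Nonempty, Metric.ediam (t i) ^ s) + ε i) := by
          refine Finset.sum_le_sum fun i _ => ?_
          have hne : (t i).Nonempty := i.2.mono Set.inter_subset_left
          simpa [hne] using hr3 i
      _ = ∑ i ∈ I.map (Function.Embedding.subtype _),
            ((⨆ _ : (t i).Nonempty, Metric.ediam (t i) ^ s) + ε i) := by
          rw [Finset.sum_map]; rfl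
      _ ≤ ∑' i, ((⨆ _ : (t i).Nonempty, Metric.ediam (t i) ^ s) + (ε i : ℝ≥0∞)) :=
          ENNReal.sum_le_tsum _
      _ ≤ C := by rw [ENNReal.tsum_add]; exact hεsum

lemma ENNReal.rpow_finset_sum_le {ι : Type*} (s : Finset ι) (f : ι → ℝ≥0∞) {θ : ℝ} (h0 : 0 < θ)
    (h1 : θ ≤ 1) : (∑ i ∈ s, f i) ^ θ ≤ ∑ i ∈ s, f i ^ θ := by
  classical
  induction s using Finset.induction_on with
  | empty => simp [h0]
  | insert a s ha ih =>
    rw [Finset.sum_insert ha, Finset.sum_insert ha]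
    exact (ENNReal.rpow_add_le_add_rpow _ _ h0.le h1).trans (add_le_add_right ih _)

/-- Constancy beyond `1` matters: in `exists_cutoff` the gradient estimate is then needed only where
the sum of squares is at most `1`. -/
lemma exists_smoothTransition_deriv_bound :
    ∃ L : ℝ, 0 ≤ L ∧ (∀ x, |deriv Real.smoothTransition x| ≤ L) ∧
      ∀ x, 1 < x → deriv Real.smoothTransition x = 0 := by
  have hzero : ∀ x, 1 < x → deriv Real.smoothTransition x = 0 := by
    intro x hx
    have : Real.smoothTransition =ᶠ[𝓝 x] fun _ => 1 := by
      filter_upwards [lt_mem_nhds hx] with z hz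
      exact Real.smoothTransition.one_of_one_le hz.le
    rw [this.deriv_eq]; simp
  have hneg : ∀ x, x < 0 → deriv Real.smoothTransition x = 0 := by
    intro x hx
    have : Real.smoothTransition =ᶠ[𝓝 x] fun _ => 0 := by
      filter_upwards [gt_mem_nhds hx] with z hz
      exact Real.smoothTransition.zero_of_nonpos hz.le
    rw [this.deriv_eq]; simp
  obtain ⟨L, hL⟩ := (isCompact_Icc (a := (0 : ℝ)) (b := 1)).exists_bound_of_continuousOn
    ((Real.smoothTransition.contDiff (n := 1)).continuous_deriv (by simp)).continuousOn
  have hL0 : 0 ≤ L := (norm_nonneg _).trans (hL 0 (by simp))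
  refine ⟨L, hL0, fun x => ?_, hzero⟩
  rcases lt_or_ge x 0 with h | h
  · rw [hneg x h]; simpa
  · rcases le_or_gt x 1 with h' | h'
    · exact hL x ⟨h, h'⟩
    · rw [hzero x h']; simpa

lemma exists_standard_bump (n : ℕ) : ∃ (ζ : Euc n → ℝ) (L : ℝ), 0 ≤ L ∧ ContDiff ℝ ∞ ζ ∧
    (∀ x, 0 ≤ ζ x) ∧ (∀ x ∈ Metric.closedBall 0 1, ζ x = 1) ∧
    tsupport ζ ⊆ Metric.closedBall 0 2 ∧ ∀ x, ‖fderiv ℝ ζ x‖ ≤ L := by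
  let f : ContDiffBump (0 : Euc n) := ⟨1, 2, by norm_num, by norm_num⟩
  have hc : ContDiff ℝ ∞ f := f.contDiff
  obtain ⟨L, hL⟩ := (f.hasCompactSupport.fderiv ℝ).exists_bound_of_continuous
    (hc.continuous_fderiv (by simp))
  exact ⟨f, L, (norm_nonneg _).trans (hL 0), hc, fun x => f.nonneg,
    fun x hx => f.one_of_mem_closedBall hx, by rw [f.tsupport_eq], hL⟩

lemma norm_fderiv_comp_smul_sub {n : ℕ} {ζ : Euc n → ℝ} (hζ : ContDiff ℝ ∞ ζ) {L : ℝ}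
    (hL : ∀ x, ‖fderiv ℝ ζ x‖ ≤ L) {r : ℝ} (hr : 0 < r) (c y : Euc n) :
    ‖fderiv ℝ (fun z => ζ (r⁻¹ • (z - c))) y‖ ≤ L / r := by
  have h1 : HasFDerivAt (fun z : Euc n => r⁻¹ • (z - c)) (r⁻¹ • ContinuousLinearMap.id ℝ (Euc n)) y :=
    ((hasFDerivAt_id y).sub_const c).const_smul r⁻¹
  have h2 := ((hζ.differentiable (by simp) (r⁻¹ • (y - c))).hasFDerivAt).comp y h1
  have e : ζ ∘ (fun z => r⁻¹ • (z - c)) = fun z => ζ (r⁻¹ • (z - c)) := rfl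
  rw [e] at h2
  rw [h2.fderiv, ContinuousLinearMap.comp_smul, ContinuousLinearMap.comp_id, norm_smul,
    Real.norm_eq_abs, abs_of_pos (inv_pos.2 hr), div_eq_inv_mul]
  exact mul_le_mul_of_nonneg_left (hL _) (inv_pos.2 hr).le

/-- Scaling: the gradient is at most `L / r` and lives on a ball of radius `2 r`, whose volume is of
order `r ^ n`. -/
lemma lintegral_fderiv_bump_rpow_le {n : ℕ} {ζ : Euc n → ℝ} {L q r : ℝ} (hq : 0 < q)
    (hζ : ContDiff ℝ ∞ ζ) (hL0 : 0 ≤ L) (hL : ∀ x, ‖fderiv ℝ ζ x‖ ≤ L)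
    (hs : tsupport ζ ⊆ Metric.closedBall 0 2) (hr : 0 < r) (c : Euc n) :
    ∫⁻ y, ‖fderiv ℝ (fun z => ζ (r⁻¹ • (z - c))) y‖ₑ ^ q
      ≤ ENNReal.ofReal (L ^ q * 2 ^ n) * volume (Metric.ball (0 : Euc n) 1)
        * ENNReal.ofReal r ^ ((n : ℝ) - q) := by
  have hzero : ∀ y, y ∉ Metric.closedBall c (r * 2) →
      fderiv ℝ (fun z => ζ (r⁻¹ • (z - c))) y = 0 := by
    intro y hy
    have hopen : ∀ᶠ z in 𝓝 y, z ∉ Metric.closedBall c (r * 2) :=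
      Metric.isClosed_closedBall.isOpen_compl.mem_nhds hy
    have : (fun z => ζ (r⁻¹ • (z - c))) =ᶠ[𝓝 y] fun _ => 0 := by
      filter_upwards [hopen] with z hz
      refine image_eq_zero_of_notMem_tsupport fun h => hz ?_
      have h1 := hs h
      rw [mem_closedBall_zero_iff, norm_smul, Real.norm_eq_abs, abs_of_pos (inv_pos.2 hr),
        inv_mul_le_iff₀ hr] at h1
      rwa [Metric.mem_closedBall, dist_eq_norm]
    rw [this.fderiv_eq]; simp
  calc ∫⁻ y, ‖fderiv ℝ (fun z => ζ (r⁻¹ • (z - c))) y‖ₑ ^ q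
      ≤ ∫⁻ y, (Metric.closedBall c (r * 2)).indicator (fun _ => ENNReal.ofReal (L / r) ^ q) y := by
        refine lintegral_mono fun y => ?_
        by_cases hy : y ∈ Metric.closedBall c (r * 2)
        · rw [Set.indicator_of_mem hy]
          refine ENNReal.rpow_le_rpow ?_ hq.le
          rw [← ofReal_norm]
          exact ENNReal.ofReal_le_ofReal (norm_fderiv_comp_smul_sub hζ hL hr c y)
        · have e : ‖fderiv ℝ (fun z => ζ (r⁻¹ • (z - c))) y‖ₑ = 0 := by
            rw [← ofReal_norm, hzero y hy, norm_zero, ENNReal.ofReal_zero]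
          rw [e, ENNReal.zero_rpow_of_pos hq]
          exact zero_le
    _ = ENNReal.ofReal (L / r) ^ q * (ENNReal.ofReal ((r * 2) ^ n)
          * volume (Metric.ball (0 : Euc n) 1)) := by
        rw [lintegral_indicator_const Metric.isClosed_closedBall.measurableSet,
          Measure.addHaar_closedBall _ _ (by positivity), finrank_euclideanSpace_fin]
    _ = _ := by
        rw [ENNReal.ofReal_rpow_of_nonneg (div_nonneg hL0 hr.le) hq.le,
          ENNReal.ofReal_rpow_of_pos hr, mul_right_comm, ← mul_assoc,
          ← ENNReal.ofReal_mul (by positivity), ← ENNReal.ofReal_mul (by positivity)]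
        congr 2
        rw [Real.div_rpow hL0 hr.le, Real.rpow_sub hr, Real.rpow_natCast, mul_pow]
        ring

/-- Cutoff functions near a compact set of finite `(n - q)`-dimensional Hausdorff measure, with
controlled `q`-energy. -/
theorem exists_cutoff (n : ℕ) {q : ℝ} (hq1 : 1 ≤ q) (hq2 : q ≤ 2) (hqn : q ≤ n) :
    ∃ A : ℝ≥0∞, A ≠ ⊤ ∧ ∀ {Z : Set (Euc n)}, IsCompact Z → ∀ {C : ℝ≥0∞},
      Measure.hausdorffMeasure ((n : ℝ) - q) Z < C → ∀ {δ : ℝ}, 0 < δ →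
      ∃ η : Euc n → ℝ, ContDiff ℝ ∞ η ∧ (∀ y, 0 ≤ η y ∧ η y ≤ 1) ∧ (∀ᶠ y in 𝓝ˢ Z, η y = 1) ∧
        tsupport η ⊆ Metric.cthickening δ Z ∧ ∫⁻ y, ‖fderiv ℝ η y‖ₑ ^ q ≤ A * C := by
  obtain ⟨ζ, L, hL0, hζ, hζ0, hζ1, hζs, hL⟩ := exists_standard_bump n
  obtain ⟨L', hL'0, hL', hL'z⟩ := exists_smoothTransition_deriv_bound
  set A₀ : ℝ≥0∞ := ENNReal.ofReal (L ^ q * 2 ^ n) * volume (Metric.ball (0 : Euc n) 1) with hA₀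
  -- The first factor is the constant of the pointwise gradient bound `hpt` raised to `q / 2`, the
  -- second the energy constant of one rescaled bump.
  refine ⟨ENNReal.ofReal ((2 * L') ^ 2) ^ (q / 2) * A₀, ?_, ?_⟩
  · exact ENNReal.mul_ne_top (ENNReal.rpow_ne_top_of_nonneg (by linarith) ENNReal.ofReal_ne_top)
      (ENNReal.mul_ne_top ENNReal.ofReal_ne_top Metric.isBounded_ball.measure_lt_top.ne)
  intro Z hZ C hC δ hδ
  -- The bump attached to a ball of radius `r` is supported in the ball of radius `2 r`, hence `δ /
  -- 2`.
  obtain ⟨I, c, r, hI, hcov, hsum⟩ := exists_finite_ball_cover hZ (by linarith) hC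
    (δ := δ / 2) (by linarith)
  set z : ℕ → Euc n → ℝ := fun i y => ζ ((r i)⁻¹ • (y - c i)) with hz
  have hzc : ∀ i, ContDiff ℝ ∞ (z i) := fun i =>
    hζ.comp ((contDiff_id.sub contDiff_const).const_smul _)
  have hz0 : ∀ i y, 0 ≤ z i y := fun i y => hζ0 _
  set S : Euc n → ℝ := fun y => ∑ i ∈ I, z i y ^ 2 with hS
  have hSc : ContDiff ℝ ∞ S := ContDiff.sum fun i _ => (hzc i).pow 2
  have hηc : ContDiff ℝ ∞ fun y => Real.smoothTransition (S y) :=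
    Real.smoothTransition.contDiff.comp hSc
  have hsub : ∀ i ∈ I, Metric.closedBall (c i) (2 * r i) ⊆ Metric.cthickening δ Z := by
    intro i hi
    refine (Metric.closedBall_subset_closedBall ?_).trans
      (Metric.closedBall_subset_cthickening (hI i hi).2.2 δ)
    linarith [(hI i hi).2.1]
  refine ⟨fun y => Real.smoothTransition (S y), hηc,
    fun y => ⟨Real.smoothTransition.nonneg _, Real.smoothTransition.le_one _⟩, ?_, ?_, ?_⟩
  · have hopen : IsOpen (⋃ i ∈ I, Metric.ball (c i) (r i)) :=
      isOpen_biUnion fun i _ => Metric.isOpen_ball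
    filter_upwards [hopen.mem_nhdsSet.2 hcov] with y hy
    obtain ⟨i, hi, hyi⟩ := Set.mem_iUnion₂.1 hy
    apply Real.smoothTransition.one_of_one_le
    have h1 : z i y = 1 := by
      apply hζ1
      rw [mem_closedBall_zero_iff, norm_smul, Real.norm_eq_abs, abs_of_pos (inv_pos.2 (hI i hi).1),
        inv_mul_le_iff₀ (hI i hi).1, mul_one, ← dist_eq_norm]
      exact (Metric.mem_ball.1 hyi).le
    calc (1 : ℝ) = z i y ^ 2 := by rw [h1]; norm_num
      _ ≤ S y := Finset.single_le_sum (f := fun i => z i y ^ 2) (fun j _ => sq_nonneg _) hi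
  · refine closure_minimal ?_ Metric.isClosed_cthickening
    intro y hy
    by_contra hy2
    apply hy
    apply Real.smoothTransition.zero_of_nonpos
    refine (Finset.sum_eq_zero fun i hi => ?_).le
    have : z i y = 0 := by
      refine image_eq_zero_of_notMem_tsupport (f := ζ) fun h => hy2 (hsub i hi ?_)
      have h1 := hζs h
      rw [mem_closedBall_zero_iff, norm_smul, Real.norm_eq_abs, abs_of_pos (inv_pos.2 (hI i hi).1),
        inv_mul_le_iff₀ (hI i hi).1] at h1
      rw [Metric.mem_closedBall, dist_eq_norm]; linarith
    rw [this]; norm_num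
  · have hpt : ∀ y, ‖fderiv ℝ (fun y => Real.smoothTransition (S y)) y‖ ^ 2
        ≤ (2 * L') ^ 2 * ∑ i ∈ I, ‖fderiv ℝ (z i) y‖ ^ 2 := by
      intro y
      have hSd : HasFDerivAt S (∑ i ∈ I, (2 * z i y) • fderiv ℝ (z i) y) y := by
        have := HasFDerivAt.fun_sum (u := I) (A := fun i y => z i y ^ 2) (x := y)
          (A' := fun i => (2 * z i y) • fderiv ℝ (z i) y) fun i _ => by
            have := ((hzc i).differentiable (by simp) y).hasFDerivAt.pow 2
            simpa using this
        exact this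
      have hΨ : HasDerivAt Real.smoothTransition (deriv Real.smoothTransition (S y)) (S y) :=
        ((Real.smoothTransition.contDiff (n := 1)).differentiable (by simp) (S y)).hasDerivAt
      have hd := hΨ.comp_hasFDerivAt y hSd
      have e : Real.smoothTransition ∘ S = fun y => Real.smoothTransition (S y) := rfl
      rw [e] at hd
      rw [hd.fderiv, norm_smul, mul_pow]
      -- Where `S > 1` the derivative of the transition vanishes. Elsewhere Cauchy-Schwarz bounds
      -- `(∑ z |dz|)²` by `S ∑ |dz|²`, and the factor `S` is at most `1`.
      rcases lt_or_ge 1 (S y) with h | h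
      · rw [hL'z _ h]
        simp only [norm_zero]
        have : 0 ≤ (2 * L') ^ 2 * ∑ i ∈ I, ‖fderiv ℝ (z i) y‖ ^ 2 :=
          mul_nonneg (sq_nonneg _) (Finset.sum_nonneg fun i _ => sq_nonneg _)
        simpa using this
      · have h1 : ‖deriv Real.smoothTransition (S y)‖ ^ 2 ≤ L' ^ 2 :=
          pow_le_pow_left₀ (norm_nonneg _) (hL' _) 2
        have h2 : ‖∑ i ∈ I, (2 * z i y) • fderiv ℝ (z i) y‖
            ≤ 2 * ∑ i ∈ I, z i y * ‖fderiv ℝ (z i) y‖ := by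
          refine (norm_sum_le _ _).trans ?_
          rw [Finset.mul_sum]
          refine Finset.sum_le_sum fun i _ => ?_
          rw [norm_smul, Real.norm_eq_abs, abs_of_nonneg (mul_nonneg (by norm_num) (hz0 i y)),
            mul_assoc]
        have h3 : (∑ i ∈ I, z i y * ‖fderiv ℝ (z i) y‖) ^ 2
            ≤ ∑ i ∈ I, ‖fderiv ℝ (z i) y‖ ^ 2 := by
          refine (Finset.sum_mul_sq_le_sq_mul_sq _ _ _).trans ?_
          exact mul_le_of_le_one_left (Finset.sum_nonneg fun i _ => sq_nonneg _) h
        have h4 : ‖∑ i ∈ I, (2 * z i y) • fderiv ℝ (z i) y‖ ^ 2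
            ≤ 4 * ∑ i ∈ I, ‖fderiv ℝ (z i) y‖ ^ 2 := by
          calc _ ≤ (2 * ∑ i ∈ I, z i y * ‖fderiv ℝ (z i) y‖) ^ 2 :=
                pow_le_pow_left₀ (norm_nonneg _) h2 2
            _ = 4 * (∑ i ∈ I, z i y * ‖fderiv ℝ (z i) y‖) ^ 2 := by ring
            _ ≤ _ := by linarith
        calc _ ≤ L' ^ 2 * (4 * ∑ i ∈ I, ‖fderiv ℝ (z i) y‖ ^ 2) :=
              mul_le_mul h1 h4 (sq_nonneg _) (sq_nonneg _)
          _ = _ := by ring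
    have hsq : ∀ {x : ℝ}, 0 ≤ x → ENNReal.ofReal (x ^ 2) ^ (q / 2) = ENNReal.ofReal x ^ q := by
      intro x hx
      rw [ENNReal.ofReal_pow hx, ← ENNReal.rpow_natCast, ← ENNReal.rpow_mul]
      congr 1
      push_cast; ring
    -- Raise to the power `q / 2`, which is subadditive because `q ≤ 2`. Overlaps of the balls
    -- therefore cost nothing.
    have hpt2 : ∀ y, ‖fderiv ℝ (fun y => Real.smoothTransition (S y)) y‖ₑ ^ q
        ≤ ENNReal.ofReal ((2 * L') ^ 2) ^ (q / 2) * ∑ i ∈ I, ‖fderiv ℝ (z i) y‖ₑ ^ q := by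
      intro y
      have h1 := ENNReal.ofReal_le_ofReal (hpt y)
      rw [ENNReal.ofReal_mul (sq_nonneg _), ENNReal.ofReal_sum_of_nonneg
        (fun i _ => sq_nonneg _)] at h1
      have h2 := ENNReal.rpow_le_rpow h1 (z := q / 2) (by linarith)
      rw [hsq (norm_nonneg _), ENNReal.mul_rpow_of_nonneg _ _ (by linarith), ofReal_norm] at h2
      refine h2.trans (mul_le_mul_right ?_ _)
      refine (ENNReal.rpow_finset_sum_le I _ (by linarith) (by linarith)).trans_eq ?_
      exact Finset.sum_congr rfl fun i _ => by rw [hsq (norm_nonneg _), ofReal_norm]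
    have hmeas : ∀ i, Measurable fun y => ‖fderiv ℝ (z i) y‖ₑ ^ q := fun i =>
      (((hzc i).continuous_fderiv (by simp)).enorm.measurable).pow_const q
    calc ∫⁻ y, ‖fderiv ℝ (fun y => Real.smoothTransition (S y)) y‖ₑ ^ q
        ≤ ∫⁻ y, ENNReal.ofReal ((2 * L') ^ 2) ^ (q / 2) * ∑ i ∈ I, ‖fderiv ℝ (z i) y‖ₑ ^ q :=
          lintegral_mono hpt2
      _ = ENNReal.ofReal ((2 * L') ^ 2) ^ (q / 2) * ∑ i ∈ I, ∫⁻ y, ‖fderiv ℝ (z i) y‖ₑ ^ q := by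
          rw [lintegral_const_mul _ (Finset.measurable_fun_sum _ fun i _ => hmeas i),
            lintegral_finsetSum _ fun i _ => hmeas i]
      _ ≤ ENNReal.ofReal ((2 * L') ^ 2) ^ (q / 2)
            * ∑ i ∈ I, A₀ * ENNReal.ofReal (r i) ^ ((n : ℝ) - q) := by
          refine mul_le_mul_right (Finset.sum_le_sum fun i hi => ?_) _
          exact lintegral_fderiv_bump_rpow_le (by linarith) hζ hL0 hL hζs (hI i hi).1 (c i)
      _ ≤ _ := by
          rw [← Finset.mul_sum, ← mul_assoc]
          exact mul_le_mul_right hsum _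

end cutoff

/-! ### Removable sets for distributional inequalities -/

section removable
open Filter Topology
variable {n : ℕ}

/-- A sequence of cutoff functions shrinking to a small compact set, whose gradients are
asymptotically negligible against `L^p` functions. -/
theorem exists_cutoff_seq (hn : 2 ≤ n) {p : ℝ≥0∞} (hp : (n : ℝ≥0∞) ≤ p) {Z : Set (Euc n)}
    (hZ : IsCompact Z)
    (hfin : p ≠ ⊤ → Measure.hausdorffMeasure ((n : ℝ) - p.toReal / (p.toReal - 1)) Z < ⊤)
    (hinf : p = ⊤ → Measure.hausdorffMeasure ((n : ℝ) - 1) Z = 0) :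
    volume Z = 0 ∧ ∃ η : ℕ → Euc n → ℝ, (∀ j, ContDiff ℝ ∞ (η j)) ∧
      (∀ j y, 0 ≤ η j y ∧ η j y ≤ 1) ∧ (∀ j, ∀ᶠ y in 𝓝ˢ Z, η j y = 1) ∧
      (∀ j, tsupport (η j) ⊆ Metric.cthickening (1 / ((j : ℝ) + 1)) Z) ∧
      ∀ f : Euc n → ℝ, MemLp f p volume →
        Tendsto (fun j => ∫⁻ y, ‖f y‖ₑ * ‖fderiv ℝ (η j) y‖ₑ) atTop (𝓝 0) := by
  have hn' : (2 : ℝ) ≤ n := by exact_mod_cast hn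
  have hδ : ∀ j : ℕ, (0 : ℝ) < 1 / ((j : ℝ) + 1) := fun j => by positivity
  rcases eq_or_ne p ⊤ with hpt | hpt
  · have hZ0 := hinf hpt
    refine ⟨volume_eq_zero_of_hausdorffMeasure_lt_top (s := (n : ℝ) - 1) (by linarith)
      (by rw [hZ0]; exact ENNReal.zero_lt_top), ?_⟩
    obtain ⟨A, hA, hcut⟩ := exists_cutoff n (q := 1) le_rfl (by norm_num) (by linarith)
    -- The set has measure zero, so the `j`-th cutoff can be taken with energy at most `A / (j +
    -- 1)`; it then suffices to pull out the essential supremum of `f`.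
    have hC : ∀ j : ℕ, Measure.hausdorffMeasure ((n : ℝ) - 1) Z < ((j : ℝ≥0∞) + 1)⁻¹ := by
      intro j
      rw [hZ0, ENNReal.inv_pos]
      exact ENNReal.add_ne_top.2 ⟨ENNReal.natCast_ne_top j, ENNReal.one_ne_top⟩
    choose η h1 h2 h3 h4 h5 using fun j => hcut hZ (hC j) (hδ j)
    refine ⟨η, h1, h2, h3, h4, fun f hf => ?_⟩
    have hM : eLpNormEssSup f volume ≠ ⊤ := by
      have := hf.2
      rw [hpt, eLpNorm_exponent_top] at this
      exact this.ne
    have hlim : Tendsto (fun j : ℕ => eLpNormEssSup f volume * (A * ((j : ℝ≥0∞) + 1)⁻¹)) atTop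
        (𝓝 0) := by
      have h := (tendsto_add_atTop_iff_nat 1).2 ENNReal.tendsto_inv_nat_nhds_zero
      have h' := ENNReal.Tendsto.const_mul (a := A) h (Or.inr hA)
      have h'' := ENNReal.Tendsto.const_mul (a := eLpNormEssSup f volume) h' (Or.inr hM)
      simpa using h''
    refine tendsto_of_tendsto_of_tendsto_of_le_of_le tendsto_const_nhds hlim (fun _ => zero_le)
      fun j => ?_
    calc ∫⁻ y, ‖f y‖ₑ * ‖fderiv ℝ (η j) y‖ₑ
        ≤ ∫⁻ y, eLpNormEssSup f volume * ‖fderiv ℝ (η j) y‖ₑ := by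
          refine lintegral_mono_ae ?_
          filter_upwards [enorm_ae_le_eLpNormEssSup f volume] with y hy
          exact mul_le_mul_left hy _
      _ = eLpNormEssSup f volume * ∫⁻ y, ‖fderiv ℝ (η j) y‖ₑ :=
          lintegral_const_mul _ ((h1 j).continuous_fderiv (by simp)).enorm.measurable
      _ ≤ _ := by
          have := h5 j
          simp only [ENNReal.rpow_one] at this
          exact mul_le_mul_right this _
  · have hpn : (n : ℝ) ≤ p.toReal := by
      have := ENNReal.toReal_mono hpt hp
      simpa using this
    have hp1 : 1 < p.toReal := by linarith
    set q : ℝ := p.toReal / (p.toReal - 1) with hq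
    have hpq : p.toReal.HolderConjugate q := (Real.holderConjugate_iff_eq_conjExponent hp1).2 hq
    have hq1 : 1 < q := hpq.symm.lt
    have hq2 : q ≤ 2 := by
      rw [hq, div_le_iff₀ (by linarith)]; linarith
    refine ⟨volume_eq_zero_of_hausdorffMeasure_lt_top (s := (n : ℝ) - q) (by linarith)
      (hfin hpt), ?_⟩
    have hv := volume_eq_zero_of_hausdorffMeasure_lt_top (s := (n : ℝ) - q) (by linarith)
      (hfin hpt)
    obtain ⟨A, hA, hcut⟩ := exists_cutoff n (q := q) hq1.le hq2 (by linarith)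
    -- Any finite number above the measure will do: the energies are only bounded, and the decay
    -- comes from the integral of `|f| ^ p` over the shrinking neighbourhoods of the null set `Z`
    -- (`hset`).
    set C := Measure.hausdorffMeasure ((n : ℝ) - q) Z + 1 with hCdef
    have hCt : C ≠ ⊤ := ENNReal.add_ne_top.2 ⟨(hfin hpt).ne, ENNReal.one_ne_top⟩
    have hC : Measure.hausdorffMeasure ((n : ℝ) - q) Z < C :=
      ENNReal.lt_add_right (hfin hpt).ne one_ne_zero
    choose η h1 h2 h3 h4 h5 using fun j : ℕ => hcut hZ hC (hδ j)
    refine ⟨η, h1, h2, h3, h4, fun f hf => ?_⟩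
    have hp0 : p ≠ 0 := by
      rintro rfl; simp at hp1; linarith
    have hfint : ∫⁻ y, ‖f y‖ₑ ^ p.toReal ≠ ⊤ :=
      (lintegral_rpow_enorm_lt_top_of_eLpNorm_lt_top hp0 hpt hf.2).ne
    have hT : Tendsto (fun j : ℕ => volume (Metric.cthickening (1 / ((j : ℝ) + 1)) Z)) atTop
        (𝓝 0) := by
      have := (tendsto_measure_cthickening_of_isCompact (μ := (volume : Measure (Euc n))) hZ).comp
        (tendsto_one_div_add_atTop_nhds_zero_nat (𝕜 := ℝ))
      rwa [hv] at this
    have hset := tendsto_setLIntegral_zero hfint hT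
    have hlim : Tendsto (fun j : ℕ => (∫⁻ y in Metric.cthickening (1 / ((j : ℝ) + 1)) Z,
        ‖f y‖ₑ ^ p.toReal) ^ (1 / p.toReal) * (A * C) ^ (1 / q)) atTop (𝓝 0) := by
      have h := (ENNReal.continuous_rpow_const (y := 1 / p.toReal)).tendsto 0 |>.comp hset
      have h' := ENNReal.Tendsto.mul_const (b := (A * C) ^ (1 / q)) h (Or.inr
        (ENNReal.rpow_ne_top_of_nonneg (by positivity) (ENNReal.mul_ne_top hA hCt)))
      rw [ENNReal.zero_rpow_of_pos (by positivity), zero_mul] at h'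
      exact h'
    refine tendsto_of_tendsto_of_tendsto_of_le_of_le tendsto_const_nhds hlim (fun _ => zero_le)
      fun j => ?_
    set T := Metric.cthickening (1 / ((j : ℝ) + 1)) Z with hTdef
    have hTm : MeasurableSet T := Metric.isClosed_cthickening.measurableSet
    calc ∫⁻ y, ‖f y‖ₑ * ‖fderiv ℝ (η j) y‖ₑ
        = ∫⁻ y, ((T.indicator fun y => ‖f y‖ₑ) * fun y => ‖fderiv ℝ (η j) y‖ₑ) y := by
          refine lintegral_congr fun y => ?_
          by_cases hy : y ∈ T
          · simp [Set.indicator_of_mem hy]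
          · have h0 : fderiv ℝ (η j) y = 0 := by
              by_contra hne
              exact hy (h4 j (support_fderiv_subset ℝ hne))
            have : ‖fderiv ℝ (η j) y‖ₑ = 0 := by
              rw [← ofReal_norm, h0, norm_zero, ENNReal.ofReal_zero]
            simp only [Pi.mul_apply, this, mul_zero]
      _ ≤ (∫⁻ y, (T.indicator fun y => ‖f y‖ₑ) y ^ p.toReal) ^ (1 / p.toReal)
            * (∫⁻ y, ‖fderiv ℝ (η j) y‖ₑ ^ q) ^ (1 / q) :=
          ENNReal.lintegral_mul_le_Lp_mul_Lq volume hpq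
            (hf.1.enorm.indicator hTm)
            ((h1 j).continuous_fderiv (by simp)).enorm.measurable.aemeasurable
      _ = (∫⁻ y in T, ‖f y‖ₑ ^ p.toReal) ^ (1 / p.toReal)
            * (∫⁻ y, ‖fderiv ℝ (η j) y‖ₑ ^ q) ^ (1 / q) := by
          congr 2
          rw [← lintegral_indicator hTm]
          refine lintegral_congr fun y => ?_
          by_cases hy : y ∈ T
          · simp [Set.indicator_of_mem hy]
          · simp only [Set.indicator_of_notMem hy]
            exact ENNReal.zero_rpow_of_pos (by linarith)
      _ ≤ _ := mul_le_mul_right (ENNReal.rpow_le_rpow (h5 j) (by positivity)) _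

lemma MemLpLocOn.locallyIntegrableOn {U : Set (Euc n)} (hU : IsOpen U) {p : ℝ≥0∞} (hp : 1 ≤ p)
    {f : Euc n → ℝ} (hf : MemLpLocOn p U f) : LocallyIntegrableOn f U volume := by
  refine (locallyIntegrableOn_iff hU.isLocallyClosed).2 fun K hKU hK => ?_
  have : IsFiniteMeasure (volume.restrict K) := isFiniteMeasure_restrict.2 hK.measure_lt_top.ne
  exact memLp_one_iff_integrable.1 ((hf K hKU hK).mono_exponent hp)

/-- A first order distributional inequality that holds off a small set holds across it. -/
theorem integral_nonneg_of_removable (hn : 2 ≤ n) {p : ℝ≥0∞} (hp : (n : ℝ≥0∞) ≤ p)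
    {U Z : Set (Euc n)} (hU : IsOpen U) (hUZ : IsOpen (U \ Z))
    (hfin : p ≠ ⊤ → ∀ K ⊆ U, IsCompact K →
      Measure.hausdorffMeasure ((n : ℝ) - p.toReal / (p.toReal - 1)) (K ∩ Z) < ⊤)
    (hinf : p = ⊤ → ∀ K ⊆ U, IsCompact K → Measure.hausdorffMeasure ((n : ℝ) - 1) (K ∩ Z) = 0)
    {B : Fin n → Euc n → ℝ} (hB : ∀ k, MemLpLocOn p U (B k)) {E : Euc n → ℝ}
    (hE : LocallyIntegrableOn E U volume)
    (hpos : ∀ ψ : Euc n → ℝ, ContDiff ℝ ∞ ψ → HasCompactSupport ψ → tsupport ψ ⊆ U \ Z →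
      (∀ y, 0 ≤ ψ y) → 0 ≤ ∫ y, (∑ k, B k y * partialDeriv ψ k y + E y * ψ y))
    {φ : Euc n → ℝ} (hφ : ContDiff ℝ ∞ φ) (hc : HasCompactSupport φ) (hs : tsupport φ ⊆ U)
    (hφ0 : ∀ y, 0 ≤ φ y) :
    Integrable (fun y => ∑ k, B k y * partialDeriv φ k y + E y * φ y) ∧
      0 ≤ ∫ y, (∑ k, B k y * partialDeriv φ k y + E y * φ y) := by
  have hp1 : 1 ≤ p := le_trans (by exact_mod_cast (by omega : 1 ≤ n)) hp
  have hφ1 : ContDiff ℝ 1 φ := hφ.of_le (by simp)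
  have hint : ∀ {χ : Euc n → ℝ}, ContDiff ℝ ∞ χ → HasCompactSupport χ → tsupport χ ⊆ U →
      Integrable (fun y => ∑ k, B k y * partialDeriv χ k y + E y * χ y) := by
    intro χ h1 h2 h3
    refine (integrable_finsetSum _ fun k _ => ?_).add (hE.integrable_mul_test h1.continuous h2 h3)
    exact ((hB k).locallyIntegrableOn hU hp1).integrable_mul_test
      ((h1.of_le (m := 1) (by simp)).continuous_partialDeriv k) (h2.partialDeriv k)
      ((tsupport_partialDeriv_subset χ k).trans h3)
  refine ⟨hint hφ hc hs, ?_⟩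
  set K := tsupport φ with hK
  have hKZ : IsCompact (K ∩ Z) := by
    -- `Z` is closed only relative to `U`, so compactness is read off from the open set `U \ Z`.
    have : K ∩ Z = K \ (U \ Z) := by
      ext y
      constructor
      · rintro ⟨h1, h2⟩; exact ⟨h1, fun h => h.2 h2⟩
      · rintro ⟨h1, h2⟩
        refine ⟨h1, ?_⟩
        by_contra h
        exact h2 ⟨hs h1, h⟩
    rw [this]; exact hc.diff hUZ
  obtain ⟨hv, η, h1, h2, h3, h4, h5⟩ := exists_cutoff_seq hn hp hKZ (fun h => hfin h K hs hc)
    (fun h => hinf h K hs hc)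
  set I : Euc n → ℝ := fun y => ∑ k, B k y * partialDeriv φ k y + E y * φ y with hI
  have hψ1 : ∀ j, ContDiff ℝ ∞ fun y => (1 - η j y) * φ y := fun j =>
    (contDiff_const.sub (h1 j)).mul hφ
  have hψsub : ∀ j, tsupport (fun y => (1 - η j y) * φ y) ⊆ K := fun j =>
    tsupport_mul_subset_right
  have hψ2 : ∀ j, HasCompactSupport fun y => (1 - η j y) * φ y := fun j => hc.mul_left
  have hψ3 : ∀ j, tsupport (fun y => (1 - η j y) * φ y) ⊆ U \ Z := by
    intro j y hy
    refine ⟨hs (hψsub j hy), fun hyZ => ?_⟩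
    have : ∀ᶠ z in 𝓝 y, η j z = 1 := (h3 j).filter_mono (nhds_le_nhdsSet (show y ∈ K ∩ Z from ⟨hψsub j hy, hyZ⟩))
    refine (notMem_tsupport_iff_eventuallyEq.2 ?_) hy
    filter_upwards [this] with z hz
    simp [hz]
  have hpd : ∀ j k y, partialDeriv (fun y => (1 - η j y) * φ y) k y
      = (1 - η j y) * partialDeriv φ k y - partialDeriv (η j) k y * φ y := by
    intro j k y
    have hd := (h1 j).differentiable (by simp) y
    rw [partialDeriv_mul ((differentiableAt_const _).fun_sub hd) (hφ.differentiable (by simp) y)]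
    rw [partialDeriv_sub (differentiableAt_const _) hd, partialDeriv_const]
    ring
  -- The error produced when the derivative falls on the cutoff.
  set R : ℕ → Euc n → ℝ := fun j y => ∑ k, B k y * φ y * partialDeriv (η j) k y with hR
  have hηint : ∀ j k, Integrable fun y => B k y * φ y * partialDeriv (η j) k y := by
    intro j k
    have := ((hB k).locallyIntegrableOn hU hp1).integrable_mul_test
      (hφ.continuous.mul (((h1 j).of_le (m := 1) (by simp)).continuous_partialDeriv k))
      hc.mul_right ((tsupport_mul_subset_left).trans hs)
    refine this.congr (Eventually.of_forall fun y => ?_)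
    simp only [Pi.mul_apply, mul_assoc]
  have hsplit : ∀ j y, ∑ k, B k y * partialDeriv (fun y => (1 - η j y) * φ y) k y
      + E y * ((1 - η j y) * φ y) = (1 - η j y) * I y - R j y := by
    intro j y
    simp only [hpd, hI, hR, mul_add, Finset.mul_sum]
    rw [← sub_add_eq_add_sub, ← Finset.sum_sub_distrib]
    congr 1
    · exact Finset.sum_congr rfl fun k _ => by ring
    · ring
  have hIint : Integrable I := hint hφ hc hs
  have hlim1 : Tendsto (fun j => ∫ y, (1 - η j y) * I y) atTop (𝓝 (∫ y, I y)) := by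
    refine tendsto_integral_of_dominated_convergence (fun y => ‖I y‖) (fun j => ?_) hIint.norm
      (fun j => ?_) ?_
    · exact ((contDiff_const.sub (h1 j)).continuous.aestronglyMeasurable).mul hIint.1
    · refine Eventually.of_forall fun y => ?_
      rw [norm_mul]
      refine mul_le_of_le_one_left (norm_nonneg _) ?_
      rw [Real.norm_eq_abs, abs_le]
      constructor <;> linarith [(h2 j y).1, (h2 j y).2]
    -- Off the null set `K ∩ Z` a point has positive distance from it and eventually leaves the
    -- supports of the cutoffs.
    · have hae : ∀ᵐ y ∂(volume : Measure (Euc n)), y ∉ K ∩ Z := measure_eq_zero_iff_ae_notMem.1 hv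
      filter_upwards [hae] with y hy
      have hpos' : 0 < Metric.infEDist y (K ∩ Z) := by
        rw [pos_iff_ne_zero, Ne, ← Metric.mem_closure_iff_infEDist_zero]
        rwa [hKZ.isClosed.closure_eq]
      have hev : ∀ᶠ j : ℕ in atTop, ENNReal.ofReal (1 / ((j : ℝ) + 1))
          < Metric.infEDist y (K ∩ Z) := by
        have := (ENNReal.continuous_ofReal.tendsto 0).comp
          (tendsto_one_div_add_atTop_nhds_zero_nat (𝕜 := ℝ))
        rw [ENNReal.ofReal_zero] at this
        exact this.eventually (gt_mem_nhds hpos')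
      refine tendsto_const_nhds.congr' ?_
      filter_upwards [hev] with j hj
      have h0 : η j y = 0 := by
        refine image_eq_zero_of_notMem_tsupport fun h => ?_
        have := Metric.mem_cthickening_iff.1 (h4 j h)
        exact absurd hj (not_lt.2 this)
      simp [h0]
  have hRk : ∀ k, Tendsto (fun j => ∫ y, B k y * φ y * partialDeriv (η j) k y) atTop (𝓝 0) := by
    intro k
    -- Multiplying by `φ` makes the locally `L^p` coefficient globally `L^p`, as the cutoff sequence
    -- requires.
    have hL : MemLp (fun y => B k y * φ y) p volume := by
      have hKm : MeasurableSet K := (isClosed_tsupport φ).measurableSet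
      have hbase : MemLp (K.indicator (B k)) p volume :=
        (memLp_indicator_iff_restrict hKm).2 (hB k K hs hc)
      obtain ⟨b, hb⟩ := hc.exists_bound_of_continuous hφ.continuous
      have heq : (fun y => B k y * φ y) = fun y => K.indicator (B k) y * φ y := by
        funext y
        by_cases hy : y ∈ K
        · rw [Set.indicator_of_mem hy]
        · rw [image_eq_zero_of_notMem_tsupport hy]; simp
      rw [heq]
      refine hbase.of_le_mul (c := b) (hbase.1.mul hφ.continuous.aestronglyMeasurable)
        (Eventually.of_forall fun y => ?_)
      rw [norm_mul, mul_comm]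
      exact mul_le_mul_of_nonneg_right (hb y) (norm_nonneg _)
    have h := h5 _ hL
    rw [tendsto_zero_iff_norm_tendsto_zero]
    have h6 : Tendsto (fun j => (∫⁻ y, ‖B k y * φ y‖ₑ * ‖fderiv ℝ (η j) y‖ₑ).toReal) atTop
        (𝓝 0) := by
      have := (ENNReal.tendsto_toReal ENNReal.zero_ne_top).comp h
      rwa [ENNReal.toReal_zero] at this
    have hev : ∀ᶠ j in atTop, ∫⁻ y, ‖B k y * φ y‖ₑ * ‖fderiv ℝ (η j) y‖ₑ < ⊤ :=
      h.eventually (gt_mem_nhds ENNReal.zero_lt_top)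
    refine tendsto_of_tendsto_of_tendsto_of_le_of_le' tendsto_const_nhds h6
      (Eventually.of_forall fun _ => norm_nonneg _) ?_
    filter_upwards [hev] with j hj
    refine (norm_integral_le_lintegral_norm _).trans (ENNReal.toReal_mono hj.ne ?_)
    refine lintegral_mono fun y => ?_
    rw [ofReal_norm, enorm_mul]
    refine mul_le_mul_right ?_ _
    rw [← ofReal_norm, ← ofReal_norm]
    refine ENNReal.ofReal_le_ofReal ?_
    refine ((fderiv ℝ (η j) y).le_opNorm _).trans ?_
    simp
  have hlim2 : Tendsto (fun j => ∫ y, R j y) atTop (𝓝 0) := by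
    have : Tendsto (fun j => ∑ k, ∫ y, B k y * φ y * partialDeriv (η j) k y) atTop
        (𝓝 (∑ _k : Fin n, 0)) := tendsto_finsetSum _ fun k _ => hRk k
    rw [Finset.sum_const_zero] at this
    refine this.congr fun j => ?_
    rw [integral_finsetSum _ fun k _ => hηint j k]
  have hlim := hlim1.sub hlim2
  rw [sub_zero] at hlim
  refine ge_of_tendsto' hlim fun j => ?_
  have h7 := hpos _ (hψ1 j) (hψ2 j) (hψ3 j)
    (fun y => mul_nonneg (by linarith [(h2 j y).2]) (hφ0 y))
  simp only [hsplit] at h7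
  rwa [integral_sub] at h7
  · exact hIint.bdd_mul (c := 1) (contDiff_const.sub (h1 j)).continuous.aestronglyMeasurable
      (Eventually.of_forall fun y => by
        rw [Real.norm_eq_abs, abs_le]
        constructor <;> linarith [(h2 j y).1, (h2 j y).2])
  · exact integrable_finsetSum _ fun k _ => hηint j k

end removable

lemma HasWeakPartialDeriv.congr {n : ℕ} {U : Set (Euc n)} (hU : IsOpen U) {f f' w w' : Euc n → ℝ}
    {k : Fin n} (h : HasWeakPartialDeriv U f k w) (hf : ∀ y ∈ U, f y = f' y)
    (hw : ∀ y ∈ U, w y = w' y) : HasWeakPartialDeriv U f' k w' := by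
  have key : ∀ {g g' χ : Euc n → ℝ}, (∀ y ∈ U, g y = g' y) → tsupport χ ⊆ U →
      ∫ y, g' y * χ y = ∫ y, g y * χ y := by
    intro g g' χ hg hχ
    congr 1
    funext y
    by_cases hy : y ∈ U
    · rw [hg y hy]
    · simp [image_eq_zero_of_notMem_tsupport fun h => hy (hχ h)]
  have loc : ∀ {g g' : Euc n → ℝ}, (∀ y ∈ U, g y = g' y) → LocallyIntegrableOn g U volume →
      LocallyIntegrableOn g' U volume := by
    intro g g' hg hi
    refine (locallyIntegrableOn_iff hU.isLocallyClosed).2 fun K hKU hK => ?_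
    exact (hi.integrableOn_compact_subset hKU hK).congr_fun (fun y hy => hg y (hKU hy))
      hK.measurableSet
  refine ⟨loc hf h.1, loc hw h.2.1, fun φ h1 h2 h3 => ?_⟩
  rw [key hf ((tsupport_partialDeriv_subset φ k).trans h3), h.2.2 φ h1 h2 h3, key hw h3]

/-! ### Functions in `L^p_loc` -/

section memLpLoc
variable {n : ℕ} {U : Set (Euc n)} {p : ℝ≥0∞} {f g : Euc n → ℝ}

namespace MemLpLocOn

lemma add (hf : MemLpLocOn p U f) (hg : MemLpLocOn p U g) : MemLpLocOn p U fun y => f y + g y :=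
  fun K hKU hK => (hf K hKU hK).add (hg K hKU hK)

lemma sub (hf : MemLpLocOn p U f) (hg : MemLpLocOn p U g) : MemLpLocOn p U fun y => f y - g y :=
  fun K hKU hK => (hf K hKU hK).sub (hg K hKU hK)

lemma neg (hf : MemLpLocOn p U f) : MemLpLocOn p U fun y => - f y :=
  fun K hKU hK => (hf K hKU hK).neg

lemma sum {ι : Type*} {s : Finset ι} {f : ι → Euc n → ℝ} (hf : ∀ i ∈ s, MemLpLocOn p U (f i)) :
    MemLpLocOn p U fun y => ∑ i ∈ s, f i y :=
  fun K hKU hK => memLp_finsetSum s fun i hi => hf i hi K hKU hK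

lemma mono_exponent {q : ℝ≥0∞} (hf : MemLpLocOn p U f) (hqp : q ≤ p) : MemLpLocOn q U f := by
  intro K hKU hK
  have : IsFiniteMeasure (volume.restrict K) := isFiniteMeasure_restrict.2 hK.measure_lt_top.ne
  exact (hf K hKU hK).mono_exponent hqp

lemma mul (hf : MemLpLocOn 2 U f) (hg : MemLpLocOn 2 U g) : MemLpLocOn 1 U fun y => f y * g y :=
  fun K hKU hK => (hg K hKU hK).mul (hf K hKU hK)

lemma continuousOn_mul (hg : ContinuousOn g U) (hf : MemLpLocOn p U f) :
    MemLpLocOn p U fun y => g y * f y := by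
  intro K hKU hK
  obtain ⟨b, hb⟩ := hK.exists_bound_of_continuousOn (hg.mono hKU)
  refine (hf K hKU hK).of_le_mul (c := b)
    (((hg.mono hKU).aestronglyMeasurable hK.measurableSet).mul (hf K hKU hK).1) ?_
  refine (ae_restrict_iff' hK.measurableSet).2 (Filter.Eventually.of_forall fun y hy => ?_)
  rw [norm_mul]
  exact mul_le_mul_of_nonneg_right (hb y hy) (norm_nonneg _)

lemma mul_continuousOn (hf : MemLpLocOn p U f) (hg : ContinuousOn g U) :
    MemLpLocOn p U fun y => f y * g y := by
  simpa only [mul_comm] using hf.continuousOn_mul hg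

end MemLpLocOn

lemma ContinuousOn.memLpLocOn (hf : ContinuousOn f U) : MemLpLocOn p U f := by
  have h1 : MemLpLocOn p U fun _ => (1 : ℝ) := by
    intro K _ hK
    have : IsFiniteMeasure (volume.restrict K) := isFiniteMeasure_restrict.2 hK.measure_lt_top.ne
    exact memLp_const 1
  simpa using h1.continuousOn_mul hf

end memLpLoc

/-! ### The scalar curvature integrand of a weakly differentiable metric -/

section weakMetric
variable {n : ℕ} {U : Set (Euc n)} {G H : Euc n → Matrix (Fin n) (Fin n) ℝ}
  {D : Euc n → Fin n → Fin n → Fin n → ℝ} {p : ℝ≥0∞}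

lemma continuousOn_inv_apply (hGc : ∀ i j, ContinuousOn (fun y => G y i j) U)
    (hGp : ∀ y ∈ U, (G y).PosDef) (i j : Fin n) : ContinuousOn (fun y => (G y)⁻¹ i j) U :=
  contDiffOn_zero.1 (contDiffOn_matrix_inv (fun i j => contDiffOn_zero.2 (hGc i j))
    (fun y hy => (hGp y hy).det_pos.ne') i j)

lemma continuousOn_sqrt_det (hGc : ∀ i j, ContinuousOn (fun y => G y i j) U) :
    ContinuousOn (fun y => Real.sqrt (G y).det) U :=
  Real.continuous_sqrt.comp_continuousOn
    (contDiffOn_zero.1 (contDiffOn_det fun i j => contDiffOn_zero.2 (hGc i j)))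

lemma MemLpLocOn.koszul (hGc : ∀ i j, ContinuousOn (fun y => G y i j) U)
    (hGp : ∀ y ∈ U, (G y).PosDef) (hD : ∀ k i j, MemLpLocOn p U fun y => D y k i j)
    (k i j : Fin n) : MemLpLocOn p U fun y => _root_.koszul (G y)⁻¹ (D y) k i j := by
  unfold _root_.koszul
  exact (MemLpLocOn.sum fun l _ => (((hD i j l).add (hD j i l)).sub (hD l i j)).continuousOn_mul
    (continuousOn_inv_apply hGc hGp k l)).continuousOn_mul continuousOn_const

lemma MemLpLocOn.contractedVector (hGc : ∀ i j, ContinuousOn (fun y => G y i j) U)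
    (hGp : ∀ y ∈ U, (G y).PosDef) {γ : Euc n → Fin n → Fin n → Fin n → ℝ}
    (hγ : ∀ k i j, MemLpLocOn p U fun y => γ y k i j) (k : Fin n) :
    MemLpLocOn p U fun y => _root_.contractedVector (G y)⁻¹ (γ y) k := by
  unfold _root_.contractedVector
  exact MemLpLocOn.sum fun i _ => MemLpLocOn.sum fun j _ =>
    ((hγ k i j).continuousOn_mul (continuousOn_inv_apply hGc hGp i j)).sub
      ((hγ j j i).continuousOn_mul (continuousOn_inv_apply hGc hGp i k))

lemma MemLpLocOn.raisedDeriv (hGc : ∀ i j, ContinuousOn (fun y => G y i j) U)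
    (hGp : ∀ y ∈ U, (G y).PosDef) (hD : ∀ k i j, MemLpLocOn p U fun y => D y k i j)
    (k i j : Fin n) : MemLpLocOn p U fun y => _root_.raisedDeriv (G y)⁻¹ (D y) k i j := by
  unfold _root_.raisedDeriv
  exact (MemLpLocOn.sum fun a _ => MemLpLocOn.sum fun b _ => (hD k a b).continuousOn_mul
    ((continuousOn_inv_apply hGc hGp i a).mul (continuousOn_inv_apply hGc hGp j b))).neg

lemma MemLpLocOn.quadraticPart (hGc : ∀ i j, ContinuousOn (fun y => G y i j) U)
    (hGp : ∀ y ∈ U, (G y).PosDef) {C γ : Euc n → Fin n → Fin n → Fin n → ℝ}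
    (hC : ∀ k i j, MemLpLocOn 2 U fun y => C y k i j)
    (hγ : ∀ k i j, MemLpLocOn 2 U fun y => γ y k i j) :
    MemLpLocOn 1 U fun y => _root_.quadraticPart (G y)⁻¹ (C y) (γ y) := by
  unfold _root_.quadraticPart
  refine ((MemLpLocOn.sum fun k _ => MemLpLocOn.sum fun i _ => MemLpLocOn.sum fun j _ =>
    (hC k i j).mul (hγ k i j)).neg.add (MemLpLocOn.sum fun k _ => MemLpLocOn.sum fun i _ =>
      MemLpLocOn.sum fun j _ => (hC k i k).mul (hγ j j i))).add
    (MemLpLocOn.sum fun i _ => MemLpLocOn.sum fun j _ => ?_)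
  exact (MemLpLocOn.sum fun k _ => MemLpLocOn.sum fun l _ =>
    ((hγ k k l).mul (hγ l i j)).sub ((hγ k j l).mul (hγ l i k))).continuousOn_mul
    (continuousOn_inv_apply hGc hGp i j)

lemma IsSmoothMetricOn.continuousOn_ricciCoord (hU : IsOpen U) (hH : IsSmoothMetricOn U H)
    (i j : Fin n) : ContinuousOn (fun y => ricciCoord H y i j) U := by
  unfold ricciCoord
  have h1 := fun k i j => (hH.contDiffOn_christoffel hU k i j).continuousOn
  have h2 := fun m k i j =>
    (ContDiffOn.partialDeriv hU (hH.contDiffOn_christoffel hU k i j) m).continuousOn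
  exact continuousOn_finsetSum _ fun k _ => ((h2 k k i j).sub (h2 j k i k)).add
    (continuousOn_finsetSum _ fun l _ => ((h1 k k l).mul (h1 l i j)).sub ((h1 k j l).mul (h1 l i k)))

/-- The scalar `F` in coordinates. -/
noncomputable def scalarPart (H G : Euc n → Matrix (Fin n) (Fin n) ℝ)
    (D : Euc n → Fin n → Fin n → Fin n → ℝ) (y : Euc n) : ℝ :=
  ∑ i, ∑ j, (G y)⁻¹ i j * ricciCoord H y i j
    + quadraticPart (G y)⁻¹ (raisedDeriv (G y)⁻¹ (D y)) (koszul (G y)⁻¹ (D y))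

/-- The vector `V^k` in coordinates. -/
noncomputable def vectorPart (G : Euc n → Matrix (Fin n) (Fin n) ℝ)
    (D : Euc n → Fin n → Fin n → Fin n → ℝ) (k : Fin n) (y : Euc n) : ℝ :=
  contractedVector (G y)⁻¹ (koszul (G y)⁻¹ (D y)) k

/-- The logarithmic derivative `½ g^{ij} D_{kij}` of the volume density. -/
noncomputable def logDensityDeriv (G : Euc n → Matrix (Fin n) (Fin n) ℝ)
    (D : Euc n → Fin n → Fin n → Fin n → ℝ) (k : Fin n) (y : Euc n) : ℝ :=
  (1 / 2 : ℝ) * ∑ i, ∑ j, (G y)⁻¹ i j * D y k i j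

/-- Apart from a continuous term, the scalar is quadratic in `D` with continuous coefficients, so
`L²` control of `D` is enough. -/
lemma MemLpLocOn.scalarPart (hU : IsOpen U) (hH : IsSmoothMetricOn U H)
    (hGc : ∀ i j, ContinuousOn (fun y => G y i j) U) (hGp : ∀ y ∈ U, (G y).PosDef)
    (hD : ∀ k i j, MemLpLocOn 2 U fun y => D y k i j) :
    MemLpLocOn 1 U (_root_.scalarPart H G D) := by
  unfold _root_.scalarPart
  refine MemLpLocOn.add (ContinuousOn.memLpLocOn (continuousOn_finsetSum _ fun i _ =>
    continuousOn_finsetSum _ fun j _ => ?_)) ?_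
  · exact (continuousOn_inv_apply hGc hGp i j).mul (hH.continuousOn_ricciCoord hU i j)
  · exact MemLpLocOn.quadraticPart hGc hGp (MemLpLocOn.raisedDeriv hGc hGp hD)
      (MemLpLocOn.koszul hGc hGp hD)

lemma MemLpLocOn.vectorPart (hGc : ∀ i j, ContinuousOn (fun y => G y i j) U)
    (hGp : ∀ y ∈ U, (G y).PosDef) (hD : ∀ k i j, MemLpLocOn p U fun y => D y k i j) (k : Fin n) :
    MemLpLocOn p U (_root_.vectorPart G D k) :=
  MemLpLocOn.contractedVector hGc hGp (MemLpLocOn.koszul hGc hGp hD) k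

lemma MemLpLocOn.logDensityDeriv (hGc : ∀ i j, ContinuousOn (fun y => G y i j) U)
    (hGp : ∀ y ∈ U, (G y).PosDef) (hD : ∀ k i j, MemLpLocOn p U fun y => D y k i j) (k : Fin n) :
    MemLpLocOn p U (_root_.logDensityDeriv G D k) :=
  (MemLpLocOn.sum fun i _ => MemLpLocOn.sum fun j _ => (hD k i j).continuousOn_mul
    (continuousOn_inv_apply hGc hGp i j)).continuousOn_mul continuousOn_const

/-- Contracting with the inverse undoes the lowering of the index, and each of the two terms
contributes the trace of `γ`. Since `A` has disappeared, the connection of `H` enters the weak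
derivative of the density only through its own trace. -/
lemma Matrix.PosDef.half_sum_inv_mul {A : Matrix (Fin n) (Fin n) ℝ} (hA : A.PosDef)
    (γ : Fin n → Fin n → ℝ) :
    (1 / 2 : ℝ) * ∑ i, ∑ j, A⁻¹ i j * (∑ l, γ l i * A l j + ∑ l, γ l j * A i l) = ∑ l, γ l l := by
  have hd : ∀ i l, ∑ j, A⁻¹ i j * A j l = if i = l then 1 else 0 := by
    intro i l
    have := congrFun (congrFun hA.inv_mul i) l
    rwa [Matrix.mul_apply, Matrix.one_apply] at this
  have h1 : ∑ i, ∑ j, A⁻¹ i j * ∑ l, γ l i * A l j = ∑ l, γ l l := by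
    refine Finset.sum_congr rfl fun i _ => ?_
    calc ∑ j, A⁻¹ i j * ∑ l, γ l i * A l j
        = ∑ l, γ l i * ∑ j, A⁻¹ i j * A j l := by
          simp only [Finset.mul_sum]
          rw [Finset.sum_comm]
          refine Finset.sum_congr rfl fun l _ => Finset.sum_congr rfl fun j _ => ?_
          rw [hA.apply_symm l j]; ring
      _ = γ i i := by simp [hd]
  have h2 : ∑ i, ∑ j, A⁻¹ i j * ∑ l, γ l j * A i l = ∑ l, γ l l := by
    rw [Finset.sum_comm, ← h1]
    refine Finset.sum_congr rfl fun j _ => Finset.sum_congr rfl fun i _ => ?_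
    rw [hA.inv_symm i j]
    simp only [hA.apply_symm i]
  simp only [mul_add, Finset.sum_add_distrib]
  rw [h1, h2]; ring

/-- The connection terms of the covariant derivative contract to the trace of `christoffel H`, the
logarithmic derivative of `√det H`; the expression is therefore the logarithmic derivative of the
quotient of the two densities. -/
lemma logDensityDeriv_covDerivCoord {W : Set (Euc n)} (hW : IsOpen W)
    (hH : IsSmoothMetricOn W H) (hG : IsSmoothMetricOn W G) {y : Euc n} (hy : y ∈ W) (k : Fin n) :
    (1 / 2 : ℝ) * ∑ i, ∑ j, (G y)⁻¹ i j * covDerivCoord H G y k i j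
      = (1 / 2 : ℝ) * ∑ i, ∑ j, (G y)⁻¹ i j * partialDeriv (fun z => G z i j) k y
        - ∑ j, christoffel H y j j k := by
  have h := (hG.posDef y hy).half_sum_inv_mul fun l i => christoffel H y l k i
  simp only [covDerivCoord, mul_sub (_ : ℝ) (partialDeriv _ _ _), Finset.sum_sub_distrib]
  rw [mul_sub, h]
  congr 1
  exact Finset.sum_congr rfl fun j _ => hH.christoffel_symm hW hy j k j

/-- The inequality for test functions supported where the metric is smooth. -/
lemma integral_scalar_nonneg_of_smooth {W : Set (Euc n)} (hW : IsOpen W)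
    (hH : IsSmoothMetricOn W H) (hG : IsSmoothMetricOn W G)
    (hD : ∀ᵐ y, y ∈ W → D y = covDerivCoord H G y) {a : ℝ}
    (hR : ∀ y ∈ W, a ≤ ∑ i, ∑ j, (G y)⁻¹ i j * ricciCoord G y i j)
    {ψ : Euc n → ℝ} (hψ : ContDiff ℝ ∞ ψ) (hc : HasCompactSupport ψ) (hs : tsupport ψ ⊆ W)
    (hψ0 : ∀ y, 0 ≤ ψ y) :
    0 ≤ ∫ y, (∑ k, -(vectorPart G D k y * Real.sqrt (G y).det) * partialDeriv ψ k y
      + (scalarPart H G D y - ∑ k, vectorPart G D k y * logDensityDeriv G D k y - a)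
        * Real.sqrt (G y).det * ψ y) := by
  set v : Fin n → Euc n → ℝ := fun k y => contractedVector (G y)⁻¹ (connectionDiff H G y) k with hv
  set σ : Euc n → ℝ := fun y => Real.sqrt (G y).det with hσ
  have hvs : ∀ k, ContDiffOn ℝ ∞ (v k) W := fun k => by
    rw [hv]; unfold contractedVector
    exact ContDiffOn.sum fun i _ => ContDiffOn.sum fun j _ =>
      ((hG.contDiffOn_inv_apply i j).mul (contDiffOn_connectionDiff hW hH hG k i j)).sub
      ((hG.contDiffOn_inv_apply i k).mul (contDiffOn_connectionDiff hW hH hG j j i))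
  have hσs : ContDiffOn ℝ ∞ σ W := hG.contDiffOn_sqrt_det
  have hvσ : ∀ k, ContDiffOn ℝ ∞ (fun y => v k y * σ y) W := fun k => (hvs k).mul hσs
  have htest : ∀ k, ContDiff ℝ ∞ fun y => (v k y * σ y) * ψ y := fun k =>
    ContDiffOn.mul_contDiff_of_tsupport_subset hW (hvσ k) hψ hs
  have htestc : ∀ k, HasCompactSupport fun y => (v k y * σ y) * ψ y := fun k => hc.mul_left
  -- Pointwise the integrand is the curvature term minus the coordinate divergence of `v σ ψ`. The
  -- traces of `christoffel H` coming from `logDensityDeriv` and from the covariant divergence in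
  -- `contracted_ricciCoord` cancel, and the trace of `christoffel G` is the logarithmic derivative
  -- of `σ`.
  have hpt : ∀ᵐ y, (∑ k, -(vectorPart G D k y * σ y) * partialDeriv ψ k y
      + (scalarPart H G D y - ∑ k, vectorPart G D k y * logDensityDeriv G D k y - a) * σ y * ψ y)
      = (∑ i, ∑ j, (G y)⁻¹ i j * ricciCoord G y i j - a) * σ y * ψ y
        - ∑ k, partialDeriv (fun y => (v k y * σ y) * ψ y) k y := by
    filter_upwards [hD] with y hy
    by_cases hyW : y ∈ W
    · have hDy := hy hyW
      have hpd : ∀ k, partialDeriv (fun y => (v k y * σ y) * ψ y) k y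
          = (partialDeriv (v k) k y * σ y + v k y * (σ y * ∑ j, christoffel G y j j k)) * ψ y
            + v k y * σ y * partialDeriv ψ k y := by
        intro k
        rw [partialDeriv_mul ((hvσ k).differentiableAt_of_isOpen hW hyW)
          (hψ.differentiable (by simp) y),
          partialDeriv_mul ((hvs k).differentiableAt_of_isOpen hW hyW)
          (hσs.differentiableAt_of_isOpen hW hyW), hσ, hG.partialDeriv_sqrt_det hW hyW,
          hG.sum_christoffel hW hyW]
      have hvec : ∀ k, vectorPart G D k y = v k y := by
        intro k; simp only [vectorPart, hDy, hv]; rfl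
      have hlog : ∀ k, logDensityDeriv G D k y
          = ∑ j, christoffel G y j j k - ∑ j, christoffel H y j j k := by
        intro k
        rw [← hG.sum_christoffel hW hyW k]
        simp only [logDensityDeriv, hDy]
        exact logDensityDeriv_covDerivCoord hW hH hG hyW k
      have hsc : scalarPart H G D y = ∑ i, ∑ j, (G y)⁻¹ i j * ricciCoord G y i j
          - ∑ k, partialDeriv (v k) k y - ∑ k, (∑ j, christoffel H y j j k) * v k y := by
        rw [contracted_ricciCoord hW hH hG hyW]
        simp only [scalarPart, hDy, hv]
        rw [show koszul (G y)⁻¹ (covDerivCoord H G y) = connectionDiff H G y from rfl]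
        ring
      simp only [hpd, hvec, hlog, hsc]
      rw [Finset.sum_add_distrib, ← Finset.sum_mul, Finset.sum_add_distrib, ← Finset.sum_mul]
      simp only [mul_sub, Finset.sum_sub_distrib, neg_mul, Finset.sum_neg_distrib]
      have e1 : ∑ k, v k y * (σ y * ∑ j, christoffel G y j j k)
          = σ y * ∑ k, v k y * ∑ j, christoffel G y j j k := by
        rw [Finset.mul_sum]; exact Finset.sum_congr rfl fun k _ => by ring
      have e2 : ∑ k, (∑ j, christoffel H y j j k) * v k y
          = ∑ k, v k y * ∑ j, christoffel H y j j k :=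
        Finset.sum_congr rfl fun k _ => mul_comm _ _
      rw [e1, e2]; ring
    · have h0 : ∀ k, partialDeriv (fun y => (v k y * σ y) * ψ y) k y = 0 := fun k =>
        partialDeriv_eq_zero_of_notMem_tsupport
          (fun h => hyW (hs (tsupport_mul_subset_right h))) k
      have h1 : ∀ k, partialDeriv ψ k y = 0 := fun k =>
        partialDeriv_eq_zero_of_notMem_tsupport (fun h => hyW (hs h)) k
      have h2 : ψ y = 0 := image_eq_zero_of_notMem_tsupport fun h => hyW (hs h)
      simp [h0, h1, h2]
  rw [integral_congr_ae hpt]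
  have hRc : ContinuousOn (fun y => (∑ i, ∑ j, (G y)⁻¹ i j * ricciCoord G y i j - a) * σ y) W :=
    ((continuousOn_finsetSum _ fun i _ => continuousOn_finsetSum _ fun j _ =>
      (hG.contDiffOn_inv_apply i j).continuousOn.mul (hG.continuousOn_ricciCoord hW i j)).sub
      continuousOn_const).mul hσs.continuousOn
  have hRi : Integrable fun y =>
      (∑ i, ∑ j, (G y)⁻¹ i j * ricciCoord G y i j - a) * σ y * ψ y :=
    (hRc.locallyIntegrableOn hW.measurableSet).integrable_mul_test hψ.continuous hc hs
  have hpdi : ∀ k, Integrable (partialDeriv (fun y => (v k y * σ y) * ψ y) k) volume := fun k =>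
    (((htest k).of_le (m := 1) (by simp)).continuous_partialDeriv k).integrable_of_hasCompactSupport
      ((htestc k).partialDeriv k)
  rw [integral_sub hRi (integrable_finsetSum _ fun k _ => hpdi k),
    integral_finsetSum _ fun k _ => hpdi k]
  simp only [integral_partialDeriv_eq_zero ((htest _).of_le (m := 1) (by simp)) (htestc _),
    Finset.sum_const_zero, sub_zero]
  refine integral_nonneg fun y => ?_
  by_cases hyW : y ∈ W
  · exact mul_nonneg (mul_nonneg (sub_nonneg.2 (hR y hyW)) (Real.sqrt_nonneg _)) (hψ0 y)
  · have h2 : ψ y = 0 := image_eq_zero_of_notMem_tsupport fun h => hyW (hs h)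
    simp [h2]

/-- The weak derivative of the volume density of `G` with respect to that of `H`. -/
theorem hasWeakPartialDeriv_density (hU : IsOpen U) (hH : IsSmoothMetricOn U H)
    (hGc : ∀ i j, ContinuousOn (fun y => G y i j) U) (hGp : ∀ y ∈ U, (G y).PosDef)
    (hD : ∀ k i j, HasWeakPartialDeriv U (fun y => G y i j) k
      (fun y => D y k i j + ∑ l, christoffel H y l k i * G y l j
        + ∑ l, christoffel H y l k j * G y i l)) (k : Fin n) :
    HasWeakPartialDeriv U (fun y => Real.sqrt ((G y).det / (H y).det)) k
      (fun y => Real.sqrt ((G y).det / (H y).det) * logDensityDeriv G D k y) := by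
  -- The weak chain rule is applied to the entries of `G`, with index type `Fin n × Fin n`; `O` is
  -- the set where the determinant is positive and its root smooth.
  set Φ : (Fin n × Fin n → ℝ) → ℝ := fun m =>
    Real.sqrt (detMultilinear n fun i j => m (i, j)) with hΦ
  set L : (Fin n × Fin n → ℝ) →L[ℝ] (Fin n → Fin n → ℝ) :=
    ContinuousLinearMap.pi fun i => ContinuousLinearMap.pi fun j =>
      ContinuousLinearMap.proj (R := ℝ) (φ := fun _ : Fin n × Fin n => ℝ) (i, j) with hL
  have hdetc : ContDiff ℝ ∞ fun m : Fin n × Fin n → ℝ => detMultilinear n (L m) :=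
    (detMultilinear n).contDiff.comp L.contDiff
  set O : Set (Fin n × Fin n → ℝ) := {m | 0 < detMultilinear n (L m)} with hO
  have hOo : IsOpen O := isOpen_lt continuous_const hdetc.continuous
  have hΦc : ContDiffOn ℝ 1 Φ O :=
    ContDiffOn.sqrt (hdetc.of_le (by simp)).contDiffOn fun m hm => (ne_of_gt hm)
  have hmaps : ∀ y ∈ U, (fun ij : Fin n × Fin n => G y ij.1 ij.2) ∈ O := fun y hy =>
    (hGp y hy).det_pos
  have hch := HasWeakPartialDeriv.comp_contDiffOn hU (ι := Fin n × Fin n)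
    (f := fun ij y => G y ij.1 ij.2) (fun ij => hGc ij.1 ij.2) (fun ij => hD k ij.1 ij.2)
    hOo hΦc hmaps
  have hΦG : ∀ y, Φ (fun ij => G y ij.1 ij.2) = Real.sqrt (G y).det := fun y => rfl
  have hΦd : ∀ y ∈ U, ∀ i j, fderiv ℝ Φ (fun ij => G y ij.1 ij.2) (Pi.single (i, j) 1)
      = Real.sqrt (G y).det * ((1 / 2 : ℝ) * (G y)⁻¹ i j) := by
    intro y hy i j
    have hpos := (hGp y hy).det_pos
    have h1 := (((detMultilinear n).hasFDerivAt (L fun ij => G y ij.1 ij.2)).comp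
      (fun ij : Fin n × Fin n => G y ij.1 ij.2) L.hasFDerivAt).sqrt (ne_of_gt hpos)
    have h2 : fderiv ℝ Φ (fun ij => G y ij.1 ij.2) = _ := h1.fderiv
    rw [h2]
    have h3 : (detMultilinear n).linearDeriv (L fun ij => G y ij.1 ij.2)
        (L (Pi.single (i, j) 1)) = (G y).adjugate j i := by
      rw [linearDeriv_detMultilinear]
      rw [Finset.sum_eq_single i, Finset.sum_eq_single j]
      · simp [hL]; rfl
      · intro b _ hb
        simp [hL, hb]
      · simp
      · intro b _ hb
        refine Finset.sum_eq_zero fun c _ => ?_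
        simp [hL, hb]
      · simp
    have h4 : (G y).adjugate j i = (G y).det * (G y)⁻¹ i j := by
      rw [(hGp y hy).inv_symm, Matrix.inv_def, Ring.inverse_eq_inv', Matrix.smul_apply,
        smul_eq_mul, mul_inv_cancel_left₀ hpos.ne']
    have h5 : Real.sqrt (G y).det ≠ 0 := (Real.sqrt_pos.2 hpos).ne'
    rw [smul_apply, ContinuousLinearMap.comp_apply, h3, h4, smul_eq_mul]
    rw [show ((detMultilinear n) ∘ L) (fun ij : Fin n × Fin n => G y ij.1 ij.2) = (G y).det from rfl]
    nth_rewrite 2 [← Real.mul_self_sqrt hpos.le]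
    field_simp
  -- Dividing by the smooth `√det H` contributes minus the trace of `christoffel H`, which cancels
  -- the trace produced by the connection terms in the weak derivative of `G` (`h3`).
  have hθ : ContDiffOn ℝ ∞ (fun y => (Real.sqrt (H y).det)⁻¹) U :=
    hH.contDiffOn_sqrt_det.inv fun y hy => (Real.sqrt_pos.2 (hH.posDef y hy).det_pos).ne'
  have hfin := hch.contDiffOn_mul hU hθ
  refine hfin.congr hU ?_ ?_
  · intro y hy
    rw [hΦG, Real.sqrt_div (hGp y hy).det_pos.le, div_eq_inv_mul]
  · intro y hy
    have hH0 : Real.sqrt (H y).det ≠ 0 := (Real.sqrt_pos.2 (hH.posDef y hy).det_pos).ne'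
    have h1 : partialDeriv (fun y => (Real.sqrt (H y).det)⁻¹) k y
        = - (Real.sqrt (H y).det)⁻¹ * ∑ j, christoffel H y j k j := by
      have h2 : partialDeriv (fun y => (Real.sqrt (H y).det)⁻¹ * Real.sqrt (H y).det) k y = 0 := by
        rw [partialDeriv_congr hU (g := fun _ => 1) (fun z hz => inv_mul_cancel₀
          (Real.sqrt_pos.2 (hH.posDef z hz).det_pos).ne') hy, partialDeriv_const]
      rw [partialDeriv_mul (hθ.differentiableAt_of_isOpen hU hy)
        (hH.contDiffOn_sqrt_det.differentiableAt_of_isOpen hU hy),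
        hH.partialDeriv_sqrt_det hU hy, hH.sum_christoffel hU hy, ← mul_assoc,
        inv_mul_cancel₀ hH0, one_mul] at h2
      simp only [hH.christoffel_symm hU hy _ k]
      rw [← mul_left_inj' hH0, eq_neg_of_add_eq_zero_left h2, neg_mul, neg_mul, mul_right_comm,
        inv_mul_cancel₀ hH0, one_mul]
    have h3 := (hGp y hy).half_sum_inv_mul fun l i => christoffel H y l k i
    have h4 : ∑ ij : Fin n × Fin n, fderiv ℝ Φ (fun ij => G y ij.1 ij.2) (Pi.single ij 1) *
        (D y k ij.1 ij.2 + ∑ l, christoffel H y l k ij.1 * G y l ij.2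
          + ∑ l, christoffel H y l k ij.2 * G y ij.1 l)
        = Real.sqrt (G y).det * (logDensityDeriv G D k y + ∑ j, christoffel H y j k j) := by
      rw [Fintype.sum_prod_type, ← h3, logDensityDeriv, ← mul_add, ← Finset.sum_add_distrib,
        Finset.mul_sum, Finset.mul_sum]
      refine Finset.sum_congr rfl fun i _ => ?_
      rw [← Finset.sum_add_distrib, Finset.mul_sum, Finset.mul_sum]
      refine Finset.sum_congr rfl fun j _ => ?_
      rw [hΦd y hy]
      set S₁ := ∑ l, christoffel H y l k i * G y l j
      set S₂ := ∑ l, christoffel H y l k j * G y i l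
      ring
    rw [h1, h4, hΦG, Real.sqrt_div (hGp y hy).det_pos.le]
    field_simp
    ring

/-- The scalar curvature inequality in a coordinate domain. -/
theorem integral_scalar_nonneg (hn : 2 ≤ n) (hp : (n : ℝ≥0∞) ≤ p) {Z : Set (Euc n)}
    (hU : IsOpen U) (hUZ : IsOpen (U \ Z))
    (hfin : p ≠ ⊤ → ∀ K ⊆ U, IsCompact K →
      Measure.hausdorffMeasure ((n : ℝ) - p.toReal / (p.toReal - 1)) (K ∩ Z) < ⊤)
    (hinf : p = ⊤ → ∀ K ⊆ U, IsCompact K → Measure.hausdorffMeasure ((n : ℝ) - 1) (K ∩ Z) = 0)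
    (hH : IsSmoothMetricOn U H) (hGc : ∀ i j, ContinuousOn (fun y => G y i j) U)
    (hGp : ∀ y ∈ U, (G y).PosDef) (hG : IsSmoothMetricOn (U \ Z) G)
    (hD : ∀ k i j, HasWeakPartialDeriv U (fun y => G y i j) k
      (fun y => D y k i j + ∑ l, christoffel H y l k i * G y l j
        + ∑ l, christoffel H y l k j * G y i l))
    (hDp : ∀ k i j, MemLpLocOn p U fun y => D y k i j) {a : ℝ}
    (hR : ∀ y ∈ U \ Z, a ≤ ∑ i, ∑ j, (G y)⁻¹ i j * ricciCoord G y i j)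
    {φ : Euc n → ℝ} (hφ : ContDiff ℝ ∞ φ) (hc : HasCompactSupport φ) (hs : tsupport φ ⊆ U)
    (hφ0 : ∀ y, 0 ≤ φ y) :
    Integrable (fun y => ∑ k, -(vectorPart G D k y * Real.sqrt (G y).det) * partialDeriv φ k y
      + (scalarPart H G D y - ∑ k, vectorPart G D k y * logDensityDeriv G D k y - a)
        * Real.sqrt (G y).det * φ y) ∧
    0 ≤ ∫ y, (∑ k, -(vectorPart G D k y * Real.sqrt (G y).det) * partialDeriv φ k y
      + (scalarPart H G D y - ∑ k, vectorPart G D k y * logDensityDeriv G D k y - a)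
        * Real.sqrt (G y).det * φ y) := by
  have h2 : ∀ k i j, MemLpLocOn 2 U fun y => D y k i j := fun k i j =>
    (hDp k i j).mono_exponent (le_trans (by exact_mod_cast hn) hp)
  have hσ := continuousOn_sqrt_det hGc
  refine integral_nonneg_of_removable hn hp hU hUZ hfin hinf
    (fun k => ((MemLpLocOn.vectorPart hGc hGp hDp k).mul_continuousOn hσ).neg)
    (MemLpLocOn.locallyIntegrableOn hU le_rfl (MemLpLocOn.mul_continuousOn
      (((MemLpLocOn.scalarPart hU hH hGc hGp h2).sub (MemLpLocOn.sum fun k _ =>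
        (MemLpLocOn.vectorPart hGc hGp h2 k).mul (MemLpLocOn.logDensityDeriv hGc hGp h2 k))).sub
        continuousOn_const.memLpLocOn) hσ))
    (fun ψ h3 h4 h5 h6 => ?_) hφ hc hs hφ0
  have hHW := hH.mono (Set.sdiff_subset (t := Z))
  refine integral_scalar_nonneg_of_smooth hUZ hHW hG ?_ hR h3 h4 h5 h6
  -- `D` is an arbitrary representative; where `G` is smooth, uniqueness of weak derivatives
  -- identifies it almost everywhere with the classical covariant derivative.
  have hae : ∀ k i j, ∀ᵐ y, y ∈ U \ Z → D y k i j = covDerivCoord H G y k i j := by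
    intro k i j
    have h7 := ((hD k i j).mono (Set.sdiff_subset (t := Z))).ae_eq hUZ
      ((hG.contDiffOn i j).hasWeakPartialDeriv hUZ k)
    filter_upwards [h7] with y hy hyW
    have := hy hyW
    rw [covDerivCoord, ← this]; ring
  have hall : ∀ᵐ y, ∀ k i j, y ∈ U \ Z → D y k i j = covDerivCoord H G y k i j :=
    ae_all_iff.2 fun k => ae_all_iff.2 fun i => ae_all_iff.2 fun j => hae k i j
  filter_upwards [hall] with y hy hyW
  funext k i j
  exact hy k i j hyW

end weakMetric

/-! ### Coordinate changes on a manifold -/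

section charts
open Filter Topology
variable {n : ℕ} {M : Type*} [TopologicalSpace M] [ChartedSpace (Euc n) M]

/-- The coordinate change from the chart at `c` to the chart at `c'`. -/
noncomputable def transition (c c' : M) (y : Euc n) : Euc n :=
  extChartAt (𝓡 n) c' ((extChartAt (𝓡 n) c).symm y)

/-- The domain of the coordinate change from the chart at `c` to the chart at `c'`. -/
def transitionDomain (c c' : M) : Set (Euc n) :=
  (extChartAt (𝓡 n) c).target ∩ (extChartAt (𝓡 n) c).symm ⁻¹' (extChartAt (𝓡 n) c').source

variable {c c' : M} {y : Euc n}

lemma isOpen_chart_target (c : M) : IsOpen (extChartAt (𝓡 n) c).target :=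
  isOpen_extChartAt_target c

lemma isOpen_transitionDomain (c c' : M) : IsOpen (transitionDomain (n := n) c c') :=
  (continuousOn_extChartAt_symm c).isOpen_inter_preimage (isOpen_chart_target c)
    (isOpen_extChartAt_source c')

lemma transitionDomain_subset (c c' : M) :
    transitionDomain (n := n) c c' ⊆ (extChartAt (𝓡 n) c).target := Set.inter_subset_left

lemma mem_transitionDomain {x : M} (hx : x ∈ (extChartAt (𝓡 n) c).source)
    (hx' : x ∈ (extChartAt (𝓡 n) c').source) :
    extChartAt (𝓡 n) c x ∈ transitionDomain (n := n) c c' := by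
  refine ⟨(extChartAt (𝓡 n) c).map_source hx, ?_⟩
  rw [Set.mem_preimage, (extChartAt (𝓡 n) c).left_inv hx]; exact hx'

lemma chart_symm_transition (hy : y ∈ transitionDomain (n := n) c c') :
    (extChartAt (𝓡 n) c').symm (transition c c' y) = (extChartAt (𝓡 n) c).symm y :=
  (extChartAt (𝓡 n) c').left_inv hy.2

lemma transition_mem (hy : y ∈ transitionDomain (n := n) c c') :
    transition c c' y ∈ transitionDomain (n := n) c' c := by
  refine ⟨(extChartAt (𝓡 n) c').map_source hy.2, ?_⟩
  rw [Set.mem_preimage, chart_symm_transition hy]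
  exact (extChartAt (𝓡 n) c).map_target hy.1

lemma transition_transition (hy : y ∈ transitionDomain (n := n) c c') :
    transition c' c (transition c c' y) = y := by
  rw [transition, chart_symm_transition hy]
  exact (extChartAt (𝓡 n) c).right_inv hy.1

variable [IsManifold (𝓡 n) ∞ M]

lemma contDiffOn_transition (c c' : M) :
    ContDiffOn ℝ ∞ (transition c c') (transitionDomain (n := n) c c') := by
  have h := contDiffOn_ext_coord_change (I := 𝓡 n) (n := ∞) c' c
  refine h.mono ?_
  intro y hy
  rw [PartialEquiv.trans_source]
  exact ⟨hy.1, hy.2⟩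

lemma differentiableAt_transition (hy : y ∈ transitionDomain (n := n) c c') :
    DifferentiableAt ℝ (transition c c') y :=
  ((contDiffOn_transition c c').contDiffAt
    ((isOpen_transitionDomain c c').mem_nhds hy)).differentiableAt (by simp)

lemma jacobian_apply {τ : Euc n → Euc n} (hτ : DifferentiableAt ℝ τ y) (a i : Fin n) :
    jacobian τ y a i = fderiv ℝ τ y (EuclideanSpace.single i 1) a :=
  partialDeriv_comp_apply hτ a i

lemma fderiv_transition_comp {c'' : M} (hy : y ∈ transitionDomain (n := n) c c')
    (hy' : y ∈ transitionDomain (n := n) c c'') :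
    fderiv ℝ (transition c c'') y
      = (fderiv ℝ (transition c' c'') (transition c c' y)).comp (fderiv ℝ (transition c c') y) := by
  have h1 : transition c' c'' ∘ transition c c' =ᶠ[𝓝 y] transition c c'' := by
    filter_upwards [(isOpen_transitionDomain c c').mem_nhds hy] with z hz
    rw [Function.comp_apply, transition, chart_symm_transition hz, transition]
  have h2 : transition c c' y ∈ transitionDomain (n := n) c' c'' := by
    refine ⟨(transition_mem hy).1, ?_⟩
    rw [Set.mem_preimage, chart_symm_transition hy]
    exact hy'.2
  rw [← h1.fderiv_eq]
  exact fderiv_comp y (differentiableAt_transition h2) (differentiableAt_transition hy)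

omit [IsManifold (𝓡 n) ∞ M] in
lemma fderiv_transition_self (hy : y ∈ (extChartAt (𝓡 n) c).target) :
    fderiv ℝ (transition c c) y = ContinuousLinearMap.id ℝ (Euc n) := by
  have h1 : transition c c =ᶠ[𝓝 y] id := by
    filter_upwards [(isOpen_chart_target c).mem_nhds hy] with z hz
    exact (extChartAt (𝓡 n) c).right_inv hz
  rw [h1.fderiv_eq]; exact fderiv_id

lemma jacobian_mul_jacobian (hy : y ∈ transitionDomain (n := n) c c') :
    jacobian (transition c' c) (transition c c' y) * jacobian (transition c c') y = 1 := by
  have hyc : y ∈ transitionDomain (n := n) c c := ⟨hy.1, (extChartAt (𝓡 n) c).map_target hy.1⟩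
  have h := fderiv_transition_comp hy hyc
  rw [fderiv_transition_self hy.1] at h
  ext a i
  have h2 := congrArg (fun L : Euc n →L[ℝ] Euc n => L (EuclideanSpace.single i 1) a) h
  simp only [ContinuousLinearMap.comp_apply] at h2
  rw [euc_eq_sum (fderiv ℝ (transition c c') y (EuclideanSpace.single i 1)), map_sum] at h2
  rw [Matrix.mul_apply, Matrix.one_apply]
  simp only [jacobian_apply (differentiableAt_transition hy),
    jacobian_apply (differentiableAt_transition (transition_mem hy))]
  rw [ContinuousLinearMap.id_apply] at h2
  simp only [map_smul, WithLp.ofLp_sum, Finset.sum_apply, WithLp.ofLp_smul, Pi.smul_apply,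
    smul_eq_mul, PiLp.single_apply] at h2
  rw [h2]
  exact Finset.sum_congr rfl fun b _ => mul_comm _ _

lemma isUnit_det_jacobian (hy : y ∈ transitionDomain (n := n) c c') :
    IsUnit (jacobian (transition c c') y).det :=
  Matrix.isUnit_det_of_left_inverse (jacobian_mul_jacobian hy)

/-- The derivative of the inverse chart, read in the model space. -/
noncomputable def chartDeriv (c : M) (y : Euc n) : Euc n →L[ℝ] Euc n :=
  mfderiv 𝓘(ℝ, Euc n) (𝓡 n) (extChartAt (𝓡 n) c).symm y

lemma contMDiffOn_chart_inverse (c : M) :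
    ContMDiffOn 𝓘(ℝ, Euc n) (𝓡 n) ∞ (extChartAt (𝓡 n) c).symm (extChartAt (𝓡 n) c).target :=
  contMDiffOn_extChartAt_symm c

lemma mdifferentiableAt_chart_symm (hy : y ∈ (extChartAt (𝓡 n) c).target) :
    MDifferentiableAt 𝓘(ℝ, Euc n) (𝓡 n) (extChartAt (𝓡 n) c).symm y :=
  ((contMDiffOn_chart_inverse c).contMDiffAt
    ((isOpen_chart_target c).mem_nhds hy)).mdifferentiableAt (by simp)

/-- The tangent space at `x` is modelled through the chart centred at `x`, so the derivative of an
inverse chart is, in the model space, that of the transition to the chart at the image point. -/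
lemma chartDeriv_eq (hy : y ∈ (extChartAt (𝓡 n) c).target) :
    chartDeriv c y = fderiv ℝ (transition c ((extChartAt (𝓡 n) c).symm y)) y := by
  have h := (mdifferentiableAt_chart_symm hy).mfderiv
  refine h.trans ?_
  rw [show Set.range (𝓘(ℝ, Euc n)) = Set.univ from ModelWithCorners.range_eq_univ _,
    fderivWithin_univ]
  rfl

lemma chartDeriv_comp (hy : y ∈ transitionDomain (n := n) c c') :
    chartDeriv c y = (chartDeriv c' (transition c c' y)).comp (fderiv ℝ (transition c c') y) := by
  rw [chartDeriv_eq hy.1, chartDeriv_eq (transition_mem hy).1, chart_symm_transition hy]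
  exact fderiv_transition_comp hy ⟨hy.1, mem_extChartAt_source _⟩

/-- The vector `∂ᵢ`, read in the model space. -/
noncomputable def coordVec' (c : M) (y : Euc n) (i : Fin n) : Euc n := coordVec c y i

lemma coordVec'_eq_sum (hy : y ∈ transitionDomain (n := n) c c') (i : Fin n) :
    coordVec' c y i
      = ∑ a, jacobian (transition c c') y a i • coordVec' c' (transition c c' y) a := by
  have h : coordVec' c y i = chartDeriv c y (EuclideanSpace.single i 1) := rfl
  rw [h, chartDeriv_comp hy, ContinuousLinearMap.comp_apply,
    euc_eq_sum (fderiv ℝ (transition c c') y (EuclideanSpace.single i 1)), map_sum]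
  refine Finset.sum_congr rfl fun a _ => ?_
  rw [map_smul, jacobian_apply (differentiableAt_transition hy)]
  rfl

/-- The transition from a chart to itself is the identity. Consequently a field prescribed by
components in the chart centred at each point does have these components there. -/
lemma coordVec'_self (c : M) (i : Fin n) :
    coordVec' c (extChartAt (𝓡 n) c c) i = EuclideanSpace.single i 1 := by
  have h : coordVec' c (extChartAt (𝓡 n) c c) i
    = chartDeriv c (extChartAt (𝓡 n) c c) (EuclideanSpace.single i 1) := rfl
  have hc := mem_extChartAt_target (I := 𝓡 n) c
  rw [h, chartDeriv_eq hc, extChartAt_to_inv, fderiv_transition_self hc]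
  rfl

/-- A covector field, read in the model space. -/
def CovectorField.toModel (α : CovectorField n M) (x : M) : Euc n →L[ℝ] ℝ := α x

/-- A field of bilinear forms, read in the model space. -/
def BilinField.toModel (T : BilinField n M) (x : M) : Euc n →L[ℝ] Euc n →L[ℝ] ℝ := T x

/-- A field of trilinear forms, read in the model space. -/
def TrilinField.toModel (D : TrilinField n M) (x : M) :
    Euc n →L[ℝ] Euc n →L[ℝ] Euc n →L[ℝ] ℝ := D x

omit [IsManifold (𝓡 n) ∞ M] in
lemma comp₁_eq (α : CovectorField n M) (c : M) (y : Euc n) (k : Fin n) :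
    comp₁ α c y k = α.toModel ((extChartAt (𝓡 n) c).symm y) (coordVec' c y k) := rfl

lemma comp₁_transform (α : CovectorField n M) (hy : y ∈ transitionDomain (n := n) c c')
    (k : Fin n) :
    comp₁ α c y k
      = ∑ a, jacobian (transition c c') y a k * comp₁ α c' (transition c c' y) a := by
  simp only [comp₁_eq, chart_symm_transition hy]
  rw [coordVec'_eq_sum hy, map_sum]
  simp only [map_smul, smul_eq_mul]

lemma comp₂_transform (T : BilinField n M) (hy : y ∈ transitionDomain (n := n) c c') :
    comp₂ T c y = (jacobian (transition c c') y).transpose * comp₂ T c' (transition c c' y)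
      * jacobian (transition c c') y := by
  ext i j
  have h : ∀ (c : M) (y : Euc n) (i j : Fin n), comp₂ T c y i j
    = T.toModel ((extChartAt (𝓡 n) c).symm y) (coordVec' c y i) (coordVec' c y j) :=
    fun _ _ _ _ => rfl
  simp only [Matrix.mul_apply, Matrix.transpose_apply, h, chart_symm_transition hy]
  rw [coordVec'_eq_sum hy i, coordVec'_eq_sum hy j]
  simp only [map_sum, map_smul, sum_apply, smul_apply, smul_eq_mul, Finset.sum_mul]
  refine Finset.sum_congr rfl fun a _ => ?_
  rw [Finset.mul_sum]
  exact Finset.sum_congr rfl fun b _ => by ring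

omit [TopologicalSpace M] [ChartedSpace (Euc n) M] [IsManifold (𝓡 n) ∞ M] in
lemma trilinear_sum_apply (L : Euc n →L[ℝ] Euc n →L[ℝ] Euc n →L[ℝ] ℝ) (r s t : Fin n → ℝ)
    (v w z : Fin n → Euc n) :
    L (∑ a, r a • v a) (∑ a, s a • w a) (∑ a, t a • z a)
      = ∑ a, r a * ∑ b, s b * ∑ d, t d * L (v a) (w b) (z d) := by
  have e1 : ∀ w' z', L (∑ a, r a • v a) w' z' = ∑ a, r a * L (v a) w' z' := by
    intro w' z'
    let ℓ : Euc n →ₗ[ℝ] ℝ := IsLinearMap.mk' (fun v => L v w' z')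
      ⟨fun x y => congrArg (fun T => T w' z') (L.toLinearMap.map_add x y),
        fun c x => congrArg (fun T => T w' z') (L.toLinearMap.map_smul c x)⟩
    change ℓ (∑ a, r a • v a) = ∑ a, r a * ℓ (v a)
    rw [map_sum]
    exact Finset.sum_congr rfl fun a _ => map_smul _ _ _
  have e2 : ∀ v' z', L v' (∑ a, s a • w a) z' = ∑ a, s a * L v' (w a) z' := by
    intro v' z'
    let ℓ : Euc n →ₗ[ℝ] ℝ := IsLinearMap.mk' (fun w => L v' w z')
      ⟨fun x y => congrArg (fun T => T z') ((L v').toLinearMap.map_add x y),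
        fun c x => congrArg (fun T => T z') ((L v').toLinearMap.map_smul c x)⟩
    change ℓ (∑ a, s a • w a) = ∑ a, s a * ℓ (w a)
    rw [map_sum]
    exact Finset.sum_congr rfl fun a _ => map_smul _ _ _
  rw [e1]
  refine Finset.sum_congr rfl fun a _ => ?_
  rw [e2]
  congr 1
  refine Finset.sum_congr rfl fun b _ => ?_
  rw [map_sum]
  congr 1
  exact Finset.sum_congr rfl fun d _ => map_smul _ _ _

lemma comp₃_transform (D : TrilinField n M) (hy : y ∈ transitionDomain (n := n) c c')
    (k i j : Fin n) :
    comp₃ D c y k i j = ∑ a, jacobian (transition c c') y a k *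
      ∑ b, jacobian (transition c c') y b i * ∑ d, jacobian (transition c c') y d j *
        comp₃ D c' (transition c c' y) a b d := by
  have h : ∀ (c : M) (y : Euc n) (k i j : Fin n), comp₃ D c y k i j
    = D.toModel ((extChartAt (𝓡 n) c).symm y) (coordVec' c y k) (coordVec' c y i)
      (coordVec' c y j) := fun _ _ _ _ _ => rfl
  simp only [h, chart_symm_transition hy]
  rw [coordVec'_eq_sum hy k, coordVec'_eq_sum hy i, coordVec'_eq_sum hy j]
  generalize D.toModel ((extChartAt (𝓡 n) c).symm y) = L
  exact trilinear_sum_apply L _ _ _ _ _ _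

/-- The coordinate field is the tangent map of the smooth inverse chart applied to a constant
section. -/
lemma contMDiffOn_coordVec (c : M) (i : Fin n) :
    ContMDiffOn 𝓘(ℝ, Euc n) (𝓡 n).tangent ∞
      (fun y => (⟨(extChartAt (𝓡 n) c).symm y, coordVec c y i⟩ : TangentBundle (𝓡 n) M))
      (extChartAt (𝓡 n) c).target := by
  have h1 := (contMDiffOn_chart_inverse (n := n) c).contMDiffOn_tangentMapWithin (m := ∞)
    (by simp) (isOpen_chart_target c).uniqueMDiffOn
  have h2 : ContMDiffOn 𝓘(ℝ, Euc n) 𝓘(ℝ, Euc n).tangent ∞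
      (fun y => (⟨y, EuclideanSpace.single i (1 : ℝ)⟩ : TangentBundle 𝓘(ℝ, Euc n) (Euc n)))
      (extChartAt (𝓡 n) c).target := by
    intro y hy
    rw [contMDiffWithinAt_totalSpace]
    refine ⟨contMDiffWithinAt_id, ?_⟩
    refine (contMDiffWithinAt_const (c := EuclideanSpace.single i (1 : ℝ))).congr ?_ ?_
    · intro z _; simp
    · simp
  have h3 := h1.comp h2 (fun y hy => hy)
  refine h3.congr fun y hy => ?_
  rw [Function.comp_apply, tangentMapWithin,
    mfderivWithin_of_isOpen (isOpen_chart_target c) hy]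
  rfl

/-- The components of a smooth field of bilinear forms are smooth. -/
lemma contDiffOn_comp₂ {T : BilinField n M} {m : WithTop ℕ∞} (hm : m ≤ (∞ : WithTop ℕ∞)) {O : Set M}
    (hT : ContMDiffOn (𝓡 n) ((𝓡 n).prod 𝓘(ℝ, Euc n →L[ℝ] Euc n →L[ℝ] ℝ)) m
      (fun x : M => TotalSpace.mk' (Euc n →L[ℝ] Euc n →L[ℝ] ℝ)
        (E := fun x : M => TangentSpace (𝓡 n) x →L[ℝ] TangentSpace (𝓡 n) x →L[ℝ] ℝ)
        x (T x)) O) (c : M) (i j : Fin n) :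
    ContDiffOn ℝ m (fun y => comp₂ T c y i j)
      ((extChartAt (𝓡 n) c).target ∩ (extChartAt (𝓡 n) c).symm ⁻¹' O) := by
  rw [← contMDiffOn_iff_contDiffOn]
  intro y hy
  have hc := ((contMDiffOn_chart_inverse (n := n) c).of_le hm).mono
    (Set.inter_subset_left (t := (extChartAt (𝓡 n) c).symm ⁻¹' O))
  have hv := fun i => ((contMDiffOn_coordVec (n := n) c i).of_le hm).mono
    (Set.inter_subset_left (t := (extChartAt (𝓡 n) c).symm ⁻¹' O))
  have : ContMDiffWithinAt 𝓘(ℝ, Euc n) ((𝓡 n).prod 𝓘(ℝ)) m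
      (fun y ↦ TotalSpace.mk' ℝ (E := Bundle.Trivial M ℝ) ((extChartAt (𝓡 n) c).symm y)
        (T _ (coordVec c y i) (coordVec c y j)))
      ((extChartAt (𝓡 n) c).target ∩ (extChartAt (𝓡 n) c).symm ⁻¹' O) y := by
    apply ContMDiffWithinAt.clm_bundle_apply₂ (F₁ := Euc n) (F₂ := Euc n)
    · exact (hT _ hy.2).comp y (hc y hy) (fun z hz => hz.2)
    · exact hv i y hy
    · exact hv j y hy
  simp only [contMDiffWithinAt_totalSpace] at this
  exact this.2

/-- In the frame of the chart centred at the base point, the coefficients are the image of `v` under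
an invertible Jacobian. -/
lemma coordVec'_injective (hy : y ∈ (extChartAt (𝓡 n) c).target) {v : Fin n → ℝ} (hv : v ≠ 0) :
    ∑ i, v i • coordVec' c y i ≠ 0 := by
  set x := (extChartAt (𝓡 n) c).symm y with hx
  have hd : y ∈ transitionDomain (n := n) c x := ⟨hy, mem_extChartAt_source x⟩
  have hτ : transition c x y = extChartAt (𝓡 n) x x := rfl
  have h1 : ∀ a, (∑ i, v i • coordVec' c y i) a
      = (jacobian (transition c x) y).mulVec v a := by
    intro a
    rw [Matrix.mulVec, dotProduct]
    simp only [coordVec'_eq_sum hd, hτ, coordVec'_self, WithLp.ofLp_sum, Finset.sum_apply,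
      WithLp.ofLp_smul, Pi.smul_apply, smul_eq_mul, PiLp.single_apply]
    refine Finset.sum_congr rfl fun i _ => ?_
    simp [mul_comm]
  intro h0
  apply hv
  have h2 : (jacobian (transition c x) y).mulVec v = 0 := by
    funext a
    rw [← h1, h0]; rfl
  have hu : IsUnit (jacobian (transition c x) y) :=
    (Matrix.isUnit_iff_isUnit_det _).2 (isUnit_det_jacobian hd)
  exact Matrix.mulVec_injective_of_isUnit hu (by rw [h2, Matrix.mulVec_zero])

/-- The component matrix of a Riemannian metric is positive definite. -/
lemma posDef_comp₂ {T : BilinField n M} (hsymm : ∀ x v w, T x v w = T x w v)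
    (hpos : ∀ x v, v ≠ 0 → 0 < T x v v) (hy : y ∈ (extChartAt (𝓡 n) c).target) :
    (comp₂ T c y).PosDef := by
  refine Matrix.PosDef.of_dotProduct_mulVec_pos ?_ fun v hv => ?_
  · ext i j
    simp only [Matrix.conjTranspose_apply, star_trivial]
    exact hsymm _ _ _
  · have h := hpos ((extChartAt (𝓡 n) c).symm y) (∑ i, v i • coordVec' c y i)
      (coordVec'_injective hy hv)
    have e : T ((extChartAt (𝓡 n) c).symm y) (∑ i, v i • coordVec' c y i)
        (∑ i, v i • coordVec' c y i) = dotProduct (star v) ((comp₂ T c y).mulVec v) := by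
      change T.toModel ((extChartAt (𝓡 n) c).symm y) (∑ i, v i • coordVec' c y i)
        (∑ i, v i • coordVec' c y i) = _
      simp only [map_sum, map_smul, sum_apply, smul_apply, smul_eq_mul, dotProduct, Matrix.mulVec,
        star_trivial]
      simp only [Finset.mul_sum]
      rw [Finset.sum_comm]
      refine Finset.sum_congr rfl fun i _ => Finset.sum_congr rfl fun j _ => ?_
      have : comp₂ T c y i j = T.toModel ((extChartAt (𝓡 n) c).symm y) (coordVec' c y i)
        (coordVec' c y j) := rfl
      rw [this]; ring
    rwa [e] at h

end charts

/-! ### The Riemannian measure in charts -/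

section volume
open Filter Topology
variable {n : ℕ} {M : Type*} [TopologicalSpace M] [ChartedSpace (Euc n) M]

lemma jacobian_det_eq {τ : Euc n → Euc n} {y : Euc n} (hτ : DifferentiableAt ℝ τ y) :
    (fderiv ℝ τ y).det = (jacobian τ y).det := by
  have h : jacobian τ y = LinearMap.toMatrix (EuclideanSpace.basisFun (Fin n) ℝ).toBasis
      (EuclideanSpace.basisFun (Fin n) ℝ).toBasis (fderiv ℝ τ y : Euc n →ₗ[ℝ] Euc n) := by
    ext a i
    rw [LinearMap.toMatrix_apply]
    simp only [OrthonormalBasis.coe_toBasis, EuclideanSpace.basisFun_apply,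
      OrthonormalBasis.coe_toBasis_repr_apply, EuclideanSpace.basisFun_repr]
    exact partialDeriv_comp_apply hτ a i
  rw [h, LinearMap.det_toMatrix]

variable [MeasurableSpace M]

/-- The coordinate volume of the chart at `c`. -/
noncomputable def chartVolume (T : BilinField n M) (c : M) : Measure M :=
  Measure.map (extChartAt (𝓡 n) c).symm
    ((volume.restrict (extChartAt (𝓡 n) c).target).withDensity
      fun y => ENNReal.ofReal (Real.sqrt (comp₂ T c y).det))

lemma riemannianVolume_eq_iSup (T : BilinField n M) :
    riemannianVolume T = ⨆ c, chartVolume T c := rfl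

variable [BorelSpace M]

lemma aemeasurable_chart_symm (c : M) :
    AEMeasurable (extChartAt (𝓡 n) c).symm (volume.restrict (extChartAt (𝓡 n) c).target) :=
  (continuousOn_extChartAt_symm c).aemeasurable (isOpen_chart_target c).measurableSet

lemma aemeasurable_chart_symm' (c : M) (f : Euc n → ℝ≥0∞) :
    AEMeasurable (extChartAt (𝓡 n) c).symm
      ((volume.restrict (extChartAt (𝓡 n) c).target).withDensity f) :=
  (aemeasurable_chart_symm c).mono_ac (withDensity_absolutelyContinuous _ _)

lemma chartVolume_apply (T : BilinField n M) (c : M) {B : Set M} (hB : MeasurableSet B) :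
    chartVolume T c B = ∫⁻ y in (extChartAt (𝓡 n) c).target ∩ (extChartAt (𝓡 n) c).symm ⁻¹' B,
      ENNReal.ofReal (Real.sqrt (comp₂ T c y).det) := by
  rw [chartVolume, Measure.map_apply_of_aemeasurable (aemeasurable_chart_symm' c _) hB,
    withDensity_apply', Measure.restrict_restrict' (isOpen_chart_target c).measurableSet,
    Set.inter_comm]

lemma chartVolume_restrict_source (T : BilinField n M) (c : M) :
    (chartVolume T c).restrict (extChartAt (𝓡 n) c).source = chartVolume T c := by
  have hS : MeasurableSet (extChartAt (𝓡 n) c).source := (isOpen_extChartAt_source c).measurableSet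
  ext B hB
  rw [Measure.restrict_apply hB, chartVolume_apply T c (hB.inter hS), chartVolume_apply T c hB]
  congr 2
  ext y
  constructor
  · rintro ⟨h1, h2, _⟩; exact ⟨h1, h2⟩
  · rintro ⟨h1, h2⟩; exact ⟨h1, h2, (extChartAt (𝓡 n) c).map_target h1⟩

lemma aemeasurable_chart (T : BilinField n M) (c : M) :
    AEMeasurable (extChartAt (𝓡 n) c) (chartVolume T c) := by
  rw [← chartVolume_restrict_source]
  exact (continuousOn_extChartAt c).aemeasurable (isOpen_extChartAt_source c).measurableSet

lemma map_chart_chartVolume (T : BilinField n M) (c : M) :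
    Measure.map (extChartAt (𝓡 n) c) (chartVolume T c)
      = (volume.restrict (extChartAt (𝓡 n) c).target).withDensity
        fun y => ENNReal.ofReal (Real.sqrt (comp₂ T c y).det) := by
  have h2 := aemeasurable_chart T c
  rw [chartVolume] at h2 ⊢
  rw [AEMeasurable.map_map_of_aemeasurable h2 (aemeasurable_chart_symm' c _)]
  refine (Measure.map_congr ?_).trans Measure.map_id
  refine (withDensity_absolutelyContinuous _ _).ae_le
    ((ae_restrict_iff' (isOpen_chart_target c).measurableSet).2 (Eventually.of_forall
      fun y hy => ?_))
  exact (extChartAt (𝓡 n) c).right_inv hy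

lemma measurableSet_inter_preimage_chart_symm (c : M) {B : Set M} (hB : MeasurableSet B) :
    MeasurableSet ((extChartAt (𝓡 n) c).target ∩ (extChartAt (𝓡 n) c).symm ⁻¹' B) := by
  have h := (isOpen_chart_target (n := n) c).measurableSet.subtype_image
    ((continuousOn_iff_continuous_domRestrict.1
      (continuousOn_extChartAt_symm (I := 𝓡 n) c)).measurable hB)
  convert h using 1
  ext y
  simp only [Set.mem_inter_iff, Set.mem_preimage, Set.mem_image, Set.domRestrict_apply,
    Subtype.exists, exists_and_right, exists_eq_right]
  constructor
  · rintro ⟨h1, h2⟩; exact ⟨h1, h2⟩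
  · rintro ⟨h1, h2⟩; exact ⟨h1, h2⟩

variable [IsManifold (𝓡 n) ∞ M]

/-- Change of variables: the Gram determinant acquires the square of the Jacobian determinant, whose
root is the Jacobian factor of the integral. This agreement on overlaps lets the coordinate volumes
be glued. -/
lemma chartVolume_restrict_comm (T : BilinField n M) (c c' : M) :
    (chartVolume T c').restrict (extChartAt (𝓡 n) c).source
      = (chartVolume T c).restrict (extChartAt (𝓡 n) c').source := by
  have hS : ∀ c : M, MeasurableSet (extChartAt (𝓡 n) c).source := fun c =>
    (isOpen_extChartAt_source c).measurableSet
  ext B hB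
  rw [Measure.restrict_apply hB, Measure.restrict_apply hB, chartVolume_apply T c' (hB.inter (hS c)),
    chartVolume_apply T c (hB.inter (hS c'))]
  set E := (extChartAt (𝓡 n) c).target ∩
    (extChartAt (𝓡 n) c).symm ⁻¹' (B ∩ (extChartAt (𝓡 n) c').source) with hE
  have hEd : ∀ y ∈ E, y ∈ transitionDomain (n := n) c c' := fun y hy => ⟨hy.1, hy.2.2⟩
  have hEm : MeasurableSet E := measurableSet_inter_preimage_chart_symm c (hB.inter (hS c'))
  have himg : (extChartAt (𝓡 n) c').target ∩
      (extChartAt (𝓡 n) c').symm ⁻¹' (B ∩ (extChartAt (𝓡 n) c).source) = transition c c' '' E := by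
    ext z
    constructor
    · rintro ⟨h1, h2, h3⟩
      have hz : z ∈ transitionDomain (n := n) c' c := ⟨h1, h3⟩
      refine ⟨transition c' c z, ⟨(transition_mem hz).1, ?_⟩, transition_transition hz⟩
      rw [Set.mem_preimage, chart_symm_transition hz]
      exact ⟨h2, (extChartAt (𝓡 n) c').map_target h1⟩
    · rintro ⟨y, hy, rfl⟩
      have hyd := hEd y hy
      refine ⟨(transition_mem hyd).1, ?_⟩
      rw [Set.mem_preimage, chart_symm_transition hyd]
      exact ⟨hy.2.1, (extChartAt (𝓡 n) c).map_target hy.1⟩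
  rw [himg, lintegral_image_eq_lintegral_abs_det_fderiv_mul volume hEm
    (fun y hy => (differentiableAt_transition (hEd y hy)).hasFDerivAt.hasFDerivWithinAt)]
  · refine setLIntegral_congr_fun hEm fun y hy => ?_
    have hyd := hEd y hy
    rw [jacobian_det_eq (differentiableAt_transition hyd), comp₂_transform T hyd, Matrix.det_mul,
      Matrix.det_mul, Matrix.det_transpose, mul_right_comm, ← sq, Real.sqrt_mul (sq_nonneg _),
      Real.sqrt_sq_eq_abs, ENNReal.ofReal_mul (abs_nonneg _)]
  · intro y hy z hz h
    rw [← transition_transition (hEd y hy), h, transition_transition (hEd z hz)]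

variable [SecondCountableTopology M]

/-- On a chart domain the Riemannian measure is the coordinate volume. -/
theorem riemannianVolume_restrict_source (T : BilinField n M) (c : M) :
    (riemannianVolume T).restrict (extChartAt (𝓡 n) c).source = chartVolume T c := by
  have hS : ∀ c : M, MeasurableSet (extChartAt (𝓡 n) c).source := fun c =>
    (isOpen_extChartAt_source c).measurableSet
  obtain ⟨s, hs, hsU⟩ := TopologicalSpace.countable_cover_nhds
    (fun x : M => extChartAt_source_mem_nhds (I := 𝓡 n) x)
  have hne : s.Nonempty := by
    by_contra h
    rw [Set.not_nonempty_iff_eq_empty.1 h] at hsU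
    have : c ∈ (Set.univ : Set M) := trivial
    rw [← hsU] at this
    simp at this
  obtain ⟨e, rfl⟩ := hs.exists_eq_range hne
  rw [Set.biUnion_range] at hsU
  set A : ℕ → Set M := disjointed fun i => (extChartAt (𝓡 n) (e i)).source with hA
  have hAm : ∀ i, MeasurableSet (A i) := MeasurableSet.disjointed fun i => hS _
  have hAd : Pairwise (Function.onFun Disjoint A) := disjoint_disjointed _
  have hAU : ⋃ i, A i = Set.univ := by rw [hA, iUnion_disjointed, hsU]
  have hAs : ∀ i, A i ⊆ (extChartAt (𝓡 n) (e i)).source := fun i => disjointed_subset _ i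
  have hdec : ∀ c', Measure.sum (fun i => (chartVolume T c').restrict (A i)) = chartVolume T c' := by
    intro c'
    rw [← Measure.restrict_iUnion hAd hAm, hAU, Measure.restrict_univ]
  have hpart : ∀ c' i, (chartVolume T c').restrict (A i)
      = ((chartVolume T (e i)).restrict (A i)).restrict (extChartAt (𝓡 n) c').source := by
    intro c' i
    rw [← Measure.restrict_restrict_of_subset (hAs i), chartVolume_restrict_comm,
      Measure.restrict_comm (hAm i)]
  -- The coordinate volumes are glued along disjoint pieces of a countable cover by chart domains.
  -- Agreement on overlaps shows that `μ'` dominates every coordinate volume, hence their supremum,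
  -- and restricts to the right one on each chart domain.
  set μ' : Measure M := Measure.sum fun i => (chartVolume T (e i)).restrict (A i) with hμ'
  have hle : riemannianVolume T ≤ μ' := by
    rw [riemannianVolume_eq_iSup]
    refine iSup_le fun c' => ?_
    rw [← hdec c']
    refine Measure.le_iff.2 fun B hB => ?_
    rw [Measure.sum_apply _ hB, hμ', Measure.sum_apply _ hB]
    refine ENNReal.tsum_le_tsum fun i => ?_
    rw [hpart]
    exact Measure.restrict_apply_le _ _
  apply le_antisymm
  · refine (Measure.restrict_mono subset_rfl hle).trans_eq ?_
    rw [hμ', Measure.restrict_sum _ (hS c)]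
    simp only [← hpart c]
    exact hdec c
  · rw [← chartVolume_restrict_source]
    exact Measure.restrict_mono subset_rfl (le_iSup (fun c => chartVolume T c) c)

/-- Countably many chart domains cover `M`, and in each the measure has a density with respect to
Lebesgue measure. -/
lemma ae_riemannianVolume {T : BilinField n M} {P : M → Prop}
    (h : ∀ c : M, ∀ᵐ y, y ∈ (extChartAt (𝓡 n) c).target → P ((extChartAt (𝓡 n) c).symm y)) :
    ∀ᵐ x ∂(riemannianVolume T), P x := by
  obtain ⟨s, hs, hsU⟩ := TopologicalSpace.countable_cover_nhds
    (fun x : M => extChartAt_source_mem_nhds (I := 𝓡 n) x)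
  have key : ∀ c : M, ∀ᵐ x ∂(riemannianVolume T), x ∈ (extChartAt (𝓡 n) c).source → P x := by
    intro c
    have hS : MeasurableSet (extChartAt (𝓡 n) c).source :=
      (isOpen_extChartAt_source c).measurableSet
    rw [← ae_restrict_iff' hS, riemannianVolume_restrict_source]
    have h1 : ∀ᵐ y ∂((volume.restrict (extChartAt (𝓡 n) c).target).withDensity
        fun y => ENNReal.ofReal (Real.sqrt (comp₂ T c y).det)), P ((extChartAt (𝓡 n) c).symm y) :=
      (withDensity_absolutelyContinuous _ _).ae_le
        ((ae_restrict_iff' (isOpen_chart_target c).measurableSet).2 (h c))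
    rw [← map_chart_chartVolume] at h1
    have h4 := ae_of_ae_map (aemeasurable_chart T c) h1
    have h5 : ∀ᵐ x ∂(chartVolume T c), x ∈ (extChartAt (𝓡 n) c).source := by
      rw [← chartVolume_restrict_source]
      exact ae_restrict_mem hS
    filter_upwards [h4, h5] with x hx hx'
    rwa [(extChartAt (𝓡 n) c).left_inv hx'] at hx
  have := (ae_ball_iff hs).2 fun c _ => key c
  filter_upwards [this] with x hx
  have hxU : x ∈ ⋃ c ∈ s, (extChartAt (𝓡 n) c).source := by rw [hsU]; trivial
  obtain ⟨c, hc, hxc⟩ := Set.mem_iUnion₂.1 hxU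
  exact hx c hc hxc

/-- Integrals of functions supported in a chart domain. -/
lemma integral_riemannianVolume {T : BilinField n M} {c : M}
    (hT : ∀ i j, ContinuousOn (fun y => comp₂ T c y i j) (extChartAt (𝓡 n) c).target)
    {f : M → ℝ} (hf : ∀ x ∉ (extChartAt (𝓡 n) c).source, f x = 0)
    (hi : IntegrableOn (fun y => f ((extChartAt (𝓡 n) c).symm y) * Real.sqrt (comp₂ T c y).det)
      (extChartAt (𝓡 n) c).target) :
    Integrable f (riemannianVolume T) ∧ ∫ x, f x ∂(riemannianVolume T)
      = ∫ y in (extChartAt (𝓡 n) c).target,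
        f ((extChartAt (𝓡 n) c).symm y) * Real.sqrt (comp₂ T c y).det := by
  have hS : MeasurableSet (extChartAt (𝓡 n) c).source :=
    (isOpen_extChartAt_source c).measurableSet
  have hTm : MeasurableSet (extChartAt (𝓡 n) c).target := (isOpen_chart_target c).measurableSet
  have hσc : ContinuousOn (fun y => Real.sqrt (comp₂ T c y).det) (extChartAt (𝓡 n) c).target :=
    continuousOn_sqrt_det hT
  have hσ : AEMeasurable (fun y => (Real.sqrt (comp₂ T c y).det).toNNReal)
      (volume.restrict (extChartAt (𝓡 n) c).target) :=
    (hσc.aemeasurable hTm).real_toNNReal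
  set ν := (volume.restrict (extChartAt (𝓡 n) c).target).withDensity
    fun y => ENNReal.ofReal (Real.sqrt (comp₂ T c y).det) with hν
  have hν' : ν = (volume.restrict (extChartAt (𝓡 n) c).target).withDensity
    fun y => ((Real.sqrt (comp₂ T c y).det).toNNReal : ℝ≥0∞) := rfl
  have hsm : ∀ y, (Real.sqrt (comp₂ T c y).det).toNNReal • f ((extChartAt (𝓡 n) c).symm y)
      = f ((extChartAt (𝓡 n) c).symm y) * Real.sqrt (comp₂ T c y).det := by
    intro y
    rw [NNReal.smul_def, Real.coe_toNNReal _ (Real.sqrt_nonneg _), smul_eq_mul, mul_comm]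
  have hi1 : Integrable (f ∘ (extChartAt (𝓡 n) c).symm) ν := by
    rw [hν', integrable_withDensity_iff_integrable_smul₀ hσ]
    simp only [Function.comp_apply, hsm]
    exact hi
  -- Measurability of `f` on `M` is not assumed; it is recovered by composing its coordinate
  -- expression with the chart.
  have hmeas : AEStronglyMeasurable f (chartVolume T c) := by
    have h1 := hi1.1
    rw [hν, ← map_chart_chartVolume] at h1
    refine (h1.comp_aemeasurable (aemeasurable_chart T c)).congr ?_
    have h5 : ∀ᵐ x ∂(chartVolume T c), x ∈ (extChartAt (𝓡 n) c).source := by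
      rw [← chartVolume_restrict_source]
      exact ae_restrict_mem hS
    filter_upwards [h5] with x hx
    simp only [Function.comp_apply]
    rw [(extChartAt (𝓡 n) c).left_inv hx]
  have hint : Integrable f (chartVolume T c) :=
    (integrable_map_measure hmeas (aemeasurable_chart_symm' c _)).2 hi1
  have hrs := riemannianVolume_restrict_source T c
  constructor
  · refine (integrableOn_iff_integrable_of_support_subset (s := (extChartAt (𝓡 n) c).source)
      fun x hx => ?_).1 ?_
    · by_contra h; exact hx (hf x h)
    · rw [IntegrableOn, hrs]; exact hint
  · rw [← setIntegral_eq_integral_of_forall_compl_eq_zero (s := (extChartAt (𝓡 n) c).source)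
      (fun x hx => hf x hx), hrs, chartVolume, integral_map (aemeasurable_chart_symm' c _) hmeas]
    change ∫ y, f ((extChartAt (𝓡 n) c).symm y) ∂ν = _
    rw [hν', integral_withDensity_eq_integral_smul₀ hσ]
    simp only [hsm]

end volume

/-! ### Charts are locally Lipschitz for the Riemannian distance -/

section lipschitz
open Filter Topology Set
open scoped NNReal
variable {n : ℕ} {M : Type*} [EMetricSpace M] [ChartedSpace (Euc n) M] [IsManifold (𝓡 n) ∞ M]
  [RiemannianBundle (fun x : M => TangentSpace (𝓡 n) x)]
  [IsContMDiffRiemannianBundle (𝓡 n) ∞ (Euc n) (fun x : M => TangentSpace (𝓡 n) x)]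

/-- The derivative of a chart, read in the model space. -/
noncomputable def chartMDeriv (x y : M) (v : TangentSpace (𝓡 n) y) : Euc n :=
  mfderiv (𝓡 n) 𝓘(ℝ, Euc n) (extChartAt (𝓡 n) x) y v

lemma eventually_enorm_chartMDeriv_le (x : M) :
    ∃ C : ℝ≥0, ∀ᶠ y in 𝓝 x, ∀ v : TangentSpace (𝓡 n) y, ‖chartMDeriv x y v‖ₑ ≤ C * ‖v‖ₑ := by
  have : IsContinuousRiemannianBundle (Euc n) (fun x : M => TangentSpace (𝓡 n) x) := by
    obtain ⟨g, hg, h⟩ := IsContMDiffRiemannianBundle.exists_contMDiff (IB := 𝓡 n) (n := ∞)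
      (F := Euc n) (E := fun x : M => TangentSpace (𝓡 n) x)
    exact ⟨g, hg.continuous, h⟩
  obtain ⟨C, C_pos, hC⟩ := eventually_enorm_mfderiv_extChartAt_lt (𝓡 n) x
  refine ⟨C, ?_⟩
  filter_upwards [hC] with y hy v
  let _ := normedAddCommGroupTangentSpaceVectorSpace (E := Euc n) (extChartAt (𝓡 n) x y)
  let _ := normedSpaceTangentSpaceVectorSpace (E := Euc n) (extChartAt (𝓡 n) x y)
  exact (ContinuousLinearMap.le_opENorm (mfderiv (𝓡 n) 𝓘(ℝ, Euc n) (extChartAt (𝓡 n) x) y) v).trans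
    (mul_le_mul_left hy.le _)

variable [IsRiemannianManifold (𝓡 n) M]

/-- Points near `x` are joined by paths hardly longer than their distance, which stay where the
derivative of the chart is bounded by `C`; integrating along such a path bounds the displacement in
the chart by `C` times its length. -/
lemma exists_lipschitzOnWith_chart_self (x : M) :
    ∃ C : ℝ≥0, ∃ s ∈ 𝓝 x, LipschitzOnWith C (extChartAt (𝓡 n) x) s := by
  obtain ⟨C, hC⟩ := eventually_enorm_chartMDeriv_le (n := n) x
  have hu : {y | ∀ v : TangentSpace (𝓡 n) y, ‖chartMDeriv x y v‖ₑ ≤ C * ‖v‖ₑ}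
      ∩ (chartAt (Euc n) x).source ∈ 𝓝 x := inter_mem hC (chart_source_mem_nhds (Euc n) x)
  obtain ⟨r, hr, hru⟩ := EMetric.mem_nhds_iff.1 hu
  refine ⟨C, Metric.eball x (r / 2 / 2), Metric.eball_mem_nhds x (ENNReal.half_pos (ENNReal.half_pos hr.ne').ne'), ?_⟩
  intro y hy z hz
  have h4 : r / 2 / 2 + r / 2 / 2 = r / 2 := ENNReal.add_halves _
  have hyz : edist y z < r / 2 := by
    calc edist y z ≤ edist y x + edist z x := edist_triangle_right y z x
      _ < r / 2 / 2 + r / 2 / 2 := ENNReal.add_lt_add hy hz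
      _ = r / 2 := h4
  -- Two points in the ball of radius `r / 4` are at distance less than `r / 2`; a path from the
  -- first of length below `b < r / 2` stays in the ball of radius `r`, where the derivative bound
  -- holds. Afterwards `b` decreases to the distance.
  have key : ∀ b, edist y z < b → b < r / 2 →
      edist (extChartAt (𝓡 n) x y) (extChartAt (𝓡 n) x z) ≤ C * b := by
    intro b hb hbr
    rw [IsRiemannianManifold.out (I := 𝓡 n) y z] at hb
    obtain ⟨γ, hγy, hγz, hγs, hγ, -⟩ := exists_lt_locally_constant_of_riemannianEDist_lt hb zero_lt_one
    have hmem : ∀ t ∈ Icc (0 : ℝ) 1, γ t ∈ Metric.eball x r := by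
      intro t ht
      have h1 : edist y (γ t) ≤ pathELength (𝓡 n) γ 0 1 := by
        rw [IsRiemannianManifold.out (I := 𝓡 n) y (γ t)]
        exact (riemannianEDist_le_pathELength hγs.contMDiffOn hγy rfl ht.1).trans
          (pathELength_mono le_rfl ht.2)
      have h2 : edist (γ t) x < r / 2 + r / 2 / 2 := by
        calc edist (γ t) x ≤ edist (γ t) y + edist y x := edist_triangle _ _ _
          _ < r / 2 + r / 2 / 2 := by
            refine ENNReal.add_lt_add ?_ hy
            rw [edist_comm]
            exact h1.trans_lt (hγ.trans hbr)
      refine h2.trans_le ?_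
      calc r / 2 + r / 2 / 2 ≤ r / 2 + r / 2 := by
            gcongr; exact ENNReal.half_le_self
        _ = r := ENNReal.add_halves r
    have hsrc : ∀ t ∈ Icc (0 : ℝ) 1, γ t ∈ (chartAt (Euc n) x).source := fun t ht =>
      (hru (hmem t ht)).2
    have hbd : ∀ t ∈ Icc (0 : ℝ) 1, ∀ v : TangentSpace (𝓡 n) (γ t),
        ‖chartMDeriv x (γ t) v‖ₑ ≤ C * ‖v‖ₑ := fun t ht => (hru (hmem t ht)).1
    set γ' : ℝ → Euc n := extChartAt (𝓡 n) x ∘ γ with hγ'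
    have hγ's : ContMDiffOn 𝓘(ℝ) 𝓘(ℝ, Euc n) 1 γ' (Icc 0 1) :=
      contMDiffOn_extChartAt.comp (t := (chartAt (Euc n) x).source) hγs.contMDiffOn hsrc
    have hlen : ‖γ' 1 - γ' 0‖ₑ ≤ ∫⁻ t in Icc (0 : ℝ) 1, ‖derivWithin γ' (Icc 0 1) t‖ₑ := by
      apply enorm_sub_le_lintegral_derivWithin_Icc_of_contDiffOn_Icc _ zero_le_one
      rwa [← contMDiffOn_iff_contDiffOn]
    have hder : ∀ t ∈ Icc (0 : ℝ) 1, derivWithin γ' (Icc 0 1) t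
        = chartMDeriv x (γ t) (mfderivWithin 𝓘(ℝ) (𝓡 n) γ (Icc 0 1) t (1 : ℝ)) := by
      intro t ht
      have : mfderivWithin 𝓘(ℝ) 𝓘(ℝ, Euc n) γ' (Icc 0 1) t =
          (mfderiv (𝓡 n) 𝓘(ℝ, Euc n) (extChartAt (𝓡 n) x) (γ t)) ∘L
            (mfderivWithin 𝓘(ℝ) (𝓡 n) γ (Icc 0 1) t) := by
        apply mfderiv_comp_mfderivWithin
        · exact mdifferentiableAt_extChartAt (hsrc t ht)
        · exact (hγs.mdifferentiable one_ne_zero).mdifferentiableOn _ ht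
        · rw [uniqueMDiffWithinAt_iff_uniqueDiffWithinAt]
          exact uniqueDiffOn_Icc zero_lt_one _ ht
      rw [← fderivWithin_derivWithin, ← mfderivWithin_eq_fderivWithin]
      exact congr($this (1 : ℝ))
    calc edist (extChartAt (𝓡 n) x y) (extChartAt (𝓡 n) x z)
        = ‖γ' 1 - γ' 0‖ₑ := by
          rw [edist_comm, edist_eq_enorm_sub, hγ', Function.comp_apply, Function.comp_apply, hγy, hγz]
      _ ≤ ∫⁻ t in Icc (0 : ℝ) 1, ‖derivWithin γ' (Icc 0 1) t‖ₑ := hlen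
      _ ≤ ∫⁻ t in Icc (0 : ℝ) 1, C * ‖mfderivWithin 𝓘(ℝ) (𝓡 n) γ (Icc 0 1) t (1 : ℝ)‖ₑ := by
          refine setLIntegral_mono' measurableSet_Icc fun t ht => ?_
          rw [hder t ht]
          exact hbd t ht _
      _ = C * pathELength (𝓡 n) γ 0 1 := by
          rw [lintegral_const_mul' _ _ ENNReal.coe_ne_top,
            pathELength_eq_lintegral_mfderivWithin_Icc]
          rfl
      _ ≤ C * b := by gcongr
  have hev : ∀ᶠ b in 𝓝[>] (edist y z), edist (extChartAt (𝓡 n) x y) (extChartAt (𝓡 n) x z)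
      ≤ C * b := by
    filter_upwards [self_mem_nhdsWithin, mem_nhdsWithin_of_mem_nhds (gt_mem_nhds hyz)] with b h1 h2
    exact key b h1 h2
  have hne : (𝓝[>] (edist y z)).NeBot := nhdsGT_neBot_of_exists_gt ⟨_, hyz⟩
  have hlim : Tendsto (fun b : ℝ≥0∞ => (C : ℝ≥0∞) * b) (𝓝[>] (edist y z)) (𝓝 (C * edist y z)) :=
    (ENNReal.Tendsto.const_mul tendsto_id (Or.inr ENNReal.coe_ne_top)).mono_left nhdsWithin_le_nhds
  exact ge_of_tendsto hlim hev

/-- Near `x` the chart at `c` is the chart at `x` followed by a `C¹`, hence locally Lipschitz,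
transition. -/
lemma exists_lipschitzOnWith_chart {c x : M} (hx : x ∈ (extChartAt (𝓡 n) c).source) :
    ∃ C : ℝ≥0, ∃ s ∈ 𝓝 x, LipschitzOnWith C (extChartAt (𝓡 n) c) s := by
  obtain ⟨C, s, hs, hC⟩ := exists_lipschitzOnWith_chart_self (n := n) x
  have hd : extChartAt (𝓡 n) x x ∈ transitionDomain (n := n) x c :=
    mem_transitionDomain (mem_extChartAt_source x) hx
  have hsm : ContDiffAt ℝ 1 (transition x c) (extChartAt (𝓡 n) x x) :=
    ((contDiffOn_transition x c).contDiffAt ((isOpen_transitionDomain x c).mem_nhds hd)).of_le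
      (by simp)
  obtain ⟨C', t, ht, hC'⟩ := hsm.exists_lipschitzOnWith
  refine ⟨C' * C, s ∩ (extChartAt (𝓡 n) x ⁻¹' t ∩ (extChartAt (𝓡 n) x).source),
    inter_mem hs (inter_mem ((continuousAt_extChartAt x).preimage_mem_nhds ht)
      (extChartAt_source_mem_nhds x)), ?_⟩
  have h := hC'.comp (hC.mono (inter_subset_left (t := extChartAt (𝓡 n) x ⁻¹' t ∩
    (extChartAt (𝓡 n) x).source))) (fun y hy => hy.2.1)
  intro y hy z hz
  have e : ∀ w ∈ (extChartAt (𝓡 n) x).source,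
      (transition x c ∘ extChartAt (𝓡 n) x) w = extChartAt (𝓡 n) c w := by
    intro w hw
    rw [Function.comp_apply, transition, (extChartAt (𝓡 n) x).left_inv hw]
  rw [← e y hy.2.2, ← e z hz.2.2]
  exact h hy hz

variable [MeasurableSpace M] [BorelSpace M]

/-- Chart images of compact pieces of a set of finite (zero) Hausdorff measure have finite (zero)
Hausdorff measure. -/
lemma exists_hausdorffMeasure_chart_le {d : ℝ} (hd : 0 ≤ d) (S : Set M) (c : M) {K : Set (Euc n)}
    (hK : IsCompact K) (hKc : K ⊆ (extChartAt (𝓡 n) c).target) :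
    ∃ C : ℝ≥0, Measure.hausdorffMeasure d (K ∩ (extChartAt (𝓡 n) c).symm ⁻¹' S)
      ≤ C * Measure.hausdorffMeasure d S := by
  have hloc : ∀ y ∈ K, ∃ t ∈ 𝓝[K] y, ∃ C : ℝ≥0,
      Measure.hausdorffMeasure d (t ∩ K ∩ (extChartAt (𝓡 n) c).symm ⁻¹' S)
        ≤ C * Measure.hausdorffMeasure d S := by
    intro y hy
    have hyc := hKc hy
    obtain ⟨C, s, hs, hC⟩ := exists_lipschitzOnWith_chart (n := n)
      ((extChartAt (𝓡 n) c).map_target hyc)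
    refine ⟨(extChartAt (𝓡 n) c).symm ⁻¹' s, mem_nhdsWithin_of_mem_nhds
      ((continuousAt_extChartAt_symm'' hyc).preimage_mem_nhds hs), C ^ d, ?_⟩
    have hsub : (extChartAt (𝓡 n) c).symm ⁻¹' s ∩ K ∩ (extChartAt (𝓡 n) c).symm ⁻¹' S
        ⊆ extChartAt (𝓡 n) c '' (s ∩ S) := by
      rintro z ⟨⟨h1, h2⟩, h3⟩
      exact ⟨_, ⟨h1, h3⟩, (extChartAt (𝓡 n) c).right_inv (hKc h2)⟩
    calc _ ≤ Measure.hausdorffMeasure d (extChartAt (𝓡 n) c '' (s ∩ S)) := measure_mono hsub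
      _ ≤ (C : ℝ≥0∞) ^ d * Measure.hausdorffMeasure d (s ∩ S) :=
          (hC.mono inter_subset_left).hausdorffMeasure_image_le hd
      _ ≤ (C ^ d : ℝ≥0) * Measure.hausdorffMeasure d S := by
          rw [ENNReal.coe_rpow_of_nonneg _ hd]
          gcongr
          exact inter_subset_right
  -- The bound is local by the Lipschitz property and passes to finite unions with the constants
  -- added, so compactness makes it global on `K`.
  refine hK.induction_on (p := fun t => ∃ C : ℝ≥0,
      Measure.hausdorffMeasure d (t ∩ K ∩ (extChartAt (𝓡 n) c).symm ⁻¹' S)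
        ≤ C * Measure.hausdorffMeasure d S) ?_ ?_ ?_ hloc |>.imp fun C hC => by
    rwa [inter_self] at hC
  · exact ⟨0, by simp⟩
  · rintro s t hst ⟨C, hC⟩
    refine ⟨C, (measure_mono ?_).trans hC⟩
    gcongr
  · rintro s t ⟨C, hC⟩ ⟨C', hC'⟩
    refine ⟨C + C', ?_⟩
    rw [union_inter_distrib_right, union_inter_distrib_right, ENNReal.coe_add, add_mul]
    exact (measure_union_le _ _).trans (add_le_add hC hC')

end lipschitz

/-! ### Invariance of the contractions under a change of basis -/

section invariance
variable {n : ℕ} {A A' P Q : Matrix (Fin n) (Fin n) ℝ}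

lemma sum_mul_eq_of_transform (hA : P * A * P.transpose = A') {X X' : Fin n → Fin n → ℝ}
    (hX : ∀ i j, X i j = ∑ a, P a i * ∑ b, P b j * X' a b) :
    ∑ i, ∑ j, A i j * X i j = ∑ a, ∑ b, A' a b * X' a b := by
  have h1 : ∀ a b, A' a b = ∑ i, ∑ j, P a i * A i j * P b j := by
    intro a b
    rw [← hA, Matrix.mul_apply, Finset.sum_comm]
    refine Finset.sum_congr rfl fun j _ => ?_
    rw [Matrix.mul_apply, Finset.sum_mul]
    rfl
  simp only [hX, h1, Finset.mul_sum, Finset.sum_mul]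
  rw [sum_rotate₄, sum_rotate₄]
  exact sum_congr₄ fun _ _ _ _ => by ring

/-- The matrices `(γ_k)^i_j = γ^i_{kj}` of a connection. -/
def connectionMatrix (γ : Fin n → Fin n → Fin n → ℝ) (k : Fin n) : Matrix (Fin n) (Fin n) ℝ :=
  Matrix.of fun i j => γ i k j

lemma trace_connectionMatrix_mul (γ : Fin n → Fin n → Fin n → ℝ) (i j : Fin n) :
    (connectionMatrix γ i * connectionMatrix γ j).trace = ∑ k, ∑ l, γ k i l * γ l j k := by
  simp [Matrix.trace, Matrix.mul_apply, connectionMatrix]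

lemma trace_connectionMatrix (γ : Fin n → Fin n → Fin n → ℝ) (i : Fin n) :
    (connectionMatrix γ i).trace = ∑ k, γ k i k := by
  simp [Matrix.trace, connectionMatrix]

/-- The quadratic part of `F`, in terms of the connection matrices. -/
lemma quadraticPart_eq (hA : ∀ i j, A i j = A j i) {γ C : Fin n → Fin n → Fin n → ℝ}
    (hγ : ∀ k i j, γ k i j = γ k j i)
    (hC : ∀ k i j, C k i j = -(∑ l, γ i k l * A l j + ∑ l, γ j k l * A i l)) :
    quadraticPart A C γ = ∑ i, ∑ j, A i j * ((connectionMatrix γ i * connectionMatrix γ j).trace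
      - (connectionMatrix γ i).trace * (connectionMatrix γ j).trace) := by
  simp only [trace_connectionMatrix_mul, trace_connectionMatrix]
  unfold quadraticPart
  -- The first sum gives `tr(γ_i γ_j)` twice and the last takes one away; the remaining term of the
  -- last cancels against part of the second, whose other part leaves minus the product of traces.
  have q1 : ∑ k, ∑ i, ∑ j, ∑ l, γ i k l * A l j * γ k i j
      = ∑ i, ∑ j, ∑ k, ∑ l, A i j * (γ k i l * γ l j k) := by
    rw [sum_rotate₄, sum_swap₃₄, sum_swap₂₃, sum_swap₃₄]
    exact sum_congr₄ fun i j k l => by rw [hγ k l i, hγ l k j]; ring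
  have q2 : ∑ k, ∑ i, ∑ j, ∑ l, γ j k l * A i l * γ k i j
      = ∑ i, ∑ j, ∑ k, ∑ l, A i j * (γ k i l * γ l j k) := by
    rw [sum_rotate₄, sum_swap₂₃, sum_swap₃₄]
    exact sum_congr₄ fun i j k l => by rw [hγ k l i, hA j i]; ring
  have q4 : ∑ i, ∑ j, ∑ k, ∑ l, A i j * (γ k j l * γ l i k)
      = ∑ i, ∑ j, ∑ k, ∑ l, A i j * (γ k i l * γ l j k) := by
    rw [sum_swap₃₄]
    exact sum_congr₄ fun i j k l => by ring
  have w1 : ∑ k, ∑ i, ∑ j, ∑ l, γ i k l * A l k * γ j j i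
      = ∑ i, ∑ j, ∑ k, ∑ l, A i j * (γ k k l * γ l i j) := by
    rw [sum_rotate₄, sum_swap₃₄]
    exact sum_congr₄ fun i j k l => by rw [hγ l j i]; ring
  have w2 : ∑ k, ∑ i, ∑ j, ∑ l, γ k k l * A i l * γ j j i
      = ∑ i, ∑ j, ∑ k, ∑ l, A i j * (γ k i k * γ l j l) := by
    rw [sum_rotate₄, sum_swap₂₃]
    exact sum_congr₄ fun i j k l => by rw [hγ k k i, hγ l l j, hA j i]; ring
  simp only [hC, neg_mul, Finset.sum_neg_distrib, add_mul, mul_sub, Finset.sum_mul,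
    Finset.sum_add_distrib, Finset.sum_sub_distrib, Finset.mul_sum]
  rw [q1, q2, q4, w1, w2]
  have e : ∑ i, ∑ j, ∑ l, ∑ k, A i j * (γ k i k * γ l j l)
      = ∑ i, ∑ j, ∑ k, ∑ l, A i j * (γ k i k * γ l j l) := sum_swap₃₄ _
  simp only [e]
  ring

/-- `V · α` in terms of the connection matrices. -/
lemma sum_contractedVector_mul (γ : Fin n → Fin n → Fin n → ℝ) (hγ : ∀ k i j, γ k i j = γ k j i)
    (α : Fin n → ℝ) :
    ∑ k, contractedVector A γ k * α k = ∑ i, ∑ j, A i j *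
      (Matrix.vecMul α (connectionMatrix γ i) j - (connectionMatrix γ i).trace * α j) := by
  simp only [trace_connectionMatrix]
  simp only [Matrix.vecMul, dotProduct, connectionMatrix, Matrix.of_apply]
  unfold contractedVector
  simp only [mul_sub, Finset.sum_sub_distrib, sub_mul, Finset.sum_mul, Finset.mul_sum]
  congr 1
  · rw [Finset.sum_comm_cycle, Finset.sum_comm_cycle]
    exact Finset.sum_congr rfl fun _ _ => Finset.sum_congr rfl fun _ _ =>
      Finset.sum_congr rfl fun _ _ => by ring
  · rw [Finset.sum_comm]
    exact Finset.sum_congr rfl fun i _ => Finset.sum_congr rfl fun k _ =>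
      Finset.sum_congr rfl fun j _ => by rw [hγ j j i]; ring

variable {D D' : Fin n → Fin n → Fin n → ℝ}

/-- The tensor `γ` is a one-form with values in endomorphisms: its matrices are conjugated by the
change of basis while the form index contracts with `P`. -/
lemma connectionMatrix_transform (hQP : Q * P = 1) (hA : A = Q * A' * Q.transpose)
    (hD : ∀ k i j, D k i j = ∑ a, P a k * ∑ b, P b i * ∑ d, P d j * D' a b d) (k : Fin n) :
    connectionMatrix (koszul A D) k
      = ∑ a, P a k • (Q * connectionMatrix (koszul A' D') a * P) := by
  set L : Fin n → Matrix (Fin n) (Fin n) ℝ := fun k =>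
    Matrix.of fun l j => D k j l + D j k l - D l k j with hL
  set L' : Fin n → Matrix (Fin n) (Fin n) ℝ := fun k =>
    Matrix.of fun l j => D' k j l + D' j k l - D' l k j with hL'
  have h1 : ∀ k, connectionMatrix (koszul A D) k = (1 / 2 : ℝ) • (A * L k) := fun k => by
    ext i j
    simp [connectionMatrix, koszul, Matrix.mul_apply, hL]
  have h2 : ∀ k, connectionMatrix (koszul A' D') k = (1 / 2 : ℝ) • (A' * L' k) := fun k => by
    ext i j
    simp [connectionMatrix, koszul, Matrix.mul_apply, hL']
  have h3 : L k = ∑ a, P a k • (P.transpose * L' a * P) := by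
    ext l j
    have e : ∀ a, (P.transpose * L' a * P) l j = ∑ b, P b j * ∑ d, P d l * L' a d b := by
      intro a
      rw [Matrix.mul_apply]
      refine Finset.sum_congr rfl fun b _ => ?_
      rw [Matrix.mul_apply, mul_comm]
      rfl
    have e2 : D j k l = ∑ a, P a k * ∑ b, P b j * ∑ d, P d l * D' b a d := by
      rw [hD]
      simp only [Finset.mul_sum]
      rw [Finset.sum_comm]
      exact Finset.sum_congr rfl fun _ _ => Finset.sum_congr rfl fun _ _ =>
        Finset.sum_congr rfl fun _ _ => by ring
    have e3 : D l k j = ∑ a, P a k * ∑ b, P b j * ∑ d, P d l * D' d a b := by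
      rw [hD]
      simp only [Finset.mul_sum]
      rw [Finset.sum_comm]
      refine Finset.sum_congr rfl fun _ _ => ?_
      rw [Finset.sum_comm]
      exact Finset.sum_congr rfl fun _ _ => Finset.sum_congr rfl fun _ _ => by ring
    rw [Matrix.sum_apply]
    simp only [Matrix.smul_apply, smul_eq_mul, e]
    simp only [hL, hL', Matrix.of_apply, mul_add, mul_sub, Finset.sum_add_distrib,
      Finset.sum_sub_distrib]
    rw [hD k j l, e2, e3]
  rw [h1, h3, Matrix.mul_sum, Finset.smul_sum]
  refine Finset.sum_congr rfl fun a _ => ?_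
  have hT : Q.transpose * P.transpose = 1 := by
    rw [← Matrix.transpose_mul, mul_eq_one_comm.1 hQP, Matrix.transpose_one]
  rw [h2, hA, Matrix.mul_smul, Matrix.mul_smul, Matrix.smul_mul, smul_comm]
  congr 2
  calc Q * A' * Q.transpose * (P.transpose * L' a * P)
      = Q * A' * (Q.transpose * P.transpose) * L' a * P := by simp only [Matrix.mul_assoc]
    _ = Q * (A' * L' a) * P := by rw [hT, Matrix.mul_one]; simp only [Matrix.mul_assoc]

variable {γ γ' : Fin n → Fin n → Fin n → ℝ}

/-- Conjugation drops out of traces, leaving only the form indices; for this reason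
`quadraticPart_eq` rewrites the quadratic part through traces. -/
lemma trace_mul_transform (hPQ : P * Q = 1)
    (hγ : ∀ k, connectionMatrix γ k = ∑ a, P a k • (Q * connectionMatrix γ' a * P)) (i j : Fin n) :
    (connectionMatrix γ i * connectionMatrix γ j).trace
      = ∑ a, P a i * ∑ b, P b j * (connectionMatrix γ' a * connectionMatrix γ' b).trace := by
  rw [hγ, hγ, Matrix.sum_mul, Matrix.trace_sum]
  refine Finset.sum_congr rfl fun a _ => ?_
  rw [Matrix.smul_mul, Matrix.trace_smul, Matrix.mul_sum, Matrix.trace_sum, smul_eq_mul]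
  congr 1
  refine Finset.sum_congr rfl fun b _ => ?_
  rw [Matrix.mul_smul, Matrix.trace_smul, smul_eq_mul]
  congr 1
  calc (Q * connectionMatrix γ' a * P * (Q * connectionMatrix γ' b * P)).trace
      = (Q * (connectionMatrix γ' a * (P * Q) * connectionMatrix γ' b * P)).trace := by
        simp only [Matrix.mul_assoc]
    _ = (connectionMatrix γ' a * (P * Q) * connectionMatrix γ' b * (P * Q)).trace := by
        rw [Matrix.trace_mul_comm]; simp only [Matrix.mul_assoc]
    _ = _ := by rw [hPQ, Matrix.mul_one, Matrix.mul_one]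

lemma trace_transform (hPQ : P * Q = 1)
    (hγ : ∀ k, connectionMatrix γ k = ∑ a, P a k • (Q * connectionMatrix γ' a * P)) (i : Fin n) :
    (connectionMatrix γ i).trace = ∑ a, P a i * (connectionMatrix γ' a).trace := by
  rw [hγ, Matrix.trace_sum]
  refine Finset.sum_congr rfl fun a _ => ?_
  rw [Matrix.trace_smul, smul_eq_mul, Matrix.mul_assoc, Matrix.trace_mul_comm, Matrix.mul_assoc,
    hPQ, Matrix.mul_one]

lemma vecMul_transform (hPQ : P * Q = 1)
    (hγ : ∀ k, connectionMatrix γ k = ∑ a, P a k • (Q * connectionMatrix γ' a * P))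
    {α α' : Fin n → ℝ} (hα : ∀ k, α k = ∑ a, P a k * α' a) (i j : Fin n) :
    Matrix.vecMul α (connectionMatrix γ i) j
      = ∑ a, P a i * ∑ b, P b j * Matrix.vecMul α' (connectionMatrix γ' a) b := by
  have hα' : α = Matrix.vecMul α' P := by
    ext k
    rw [hα, Matrix.vecMul, dotProduct]
    exact Finset.sum_congr rfl fun _ _ => mul_comm _ _
  rw [hγ]
  have h1 : Matrix.vecMul α (∑ a, P a i • (Q * connectionMatrix γ' a * P))
      = ∑ a, P a i • Matrix.vecMul α (Q * connectionMatrix γ' a * P) := by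
    ext k
    simp only [Matrix.vecMul, dotProduct, Matrix.sum_apply, Finset.sum_apply, Pi.smul_apply,
      Matrix.smul_apply, smul_eq_mul, Finset.mul_sum]
    rw [Finset.sum_comm]
    exact Finset.sum_congr rfl fun _ _ => Finset.sum_congr rfl fun _ _ => by ring
  rw [h1, Finset.sum_apply]
  refine Finset.sum_congr rfl fun a _ => ?_
  rw [Pi.smul_apply, smul_eq_mul, hα', Matrix.vecMul_vecMul, ← Matrix.mul_assoc, ← Matrix.mul_assoc,
    hPQ, Matrix.one_mul, ← Matrix.vecMul_vecMul]
  congr 1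
  rw [Matrix.vecMul, dotProduct]
  exact Finset.sum_congr rfl fun _ _ => mul_comm _ _

/-- The quadratic part of `F` is invariant under a change of basis. -/
lemma quadraticPart_transform (hQP : Q * P = 1) (hA : A = Q * A' * Q.transpose)
    {G G' : Matrix (Fin n) (Fin n) ℝ} (hGA : G * A = 1) (hGA' : G' * A' = 1)
    (hAs : ∀ i j, A i j = A j i) (hAs' : ∀ i j, A' i j = A' j i)
    (hD : ∀ k i j, D k i j = ∑ a, P a k * ∑ b, P b i * ∑ d, P d j * D' a b d)
    (hDs : ∀ k i j, D k i j = D k j i) (hDs' : ∀ k i j, D' k i j = D' k j i) :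
    quadraticPart A (raisedDeriv A D) (koszul A D)
      = quadraticPart A' (raisedDeriv A' D') (koszul A' D') := by
  have hPQ : P * Q = 1 := mul_eq_one_comm.1 hQP
  have hγ := connectionMatrix_transform hQP hA hD
  have hA' : P * A * P.transpose = A' := by
    rw [hA]
    calc P * (Q * A' * Q.transpose) * P.transpose
        = (P * Q) * A' * (P * Q).transpose := by
          rw [Matrix.transpose_mul]; simp only [Matrix.mul_assoc]
      _ = A' := by rw [hPQ]; simp
  -- Metric compatibility of the difference tensor: `D` is the sum of the lowered `γ` in both slots,
  -- and raising both indices with a minus sign gives the form required by `quadraticPart_eq`.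
  have hC : ∀ {A G : Matrix (Fin n) (Fin n) ℝ} {D : Fin n → Fin n → Fin n → ℝ}, G * A = 1 →
      (∀ i j, A i j = A j i) → (∀ k i j, D k i j = D k j i) → ∀ k i j, raisedDeriv A D k i j
        = -(∑ l, koszul A D i k l * A l j + ∑ l, koszul A D j k l * A i l) := by
    intro A G D hGA hAs hDs k i j
    have hAG : A * G = 1 := mul_eq_one_comm.1 hGA
    unfold raisedDeriv koszul
    congr 1
    have e1 : ∑ l, (1 / 2 * ∑ m, A i m * (D k l m + D l k m - D m k l)) * A l j
        = ∑ a, ∑ b, (1 / 2 * (A i a * A j b * (D k b a + D b k a - D a k b))) := by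
      rw [Finset.sum_comm]
      refine Finset.sum_congr rfl fun l _ => ?_
      simp only [Finset.mul_sum, Finset.sum_mul]
      exact Finset.sum_congr rfl fun m _ => by rw [hAs l j]; ring
    have e2 : ∑ l, (1 / 2 * ∑ m, A j m * (D k l m + D l k m - D m k l)) * A i l
        = ∑ a, ∑ b, (1 / 2 * (A i a * A j b * (D k a b + D a k b - D b k a))) := by
      refine Finset.sum_congr rfl fun l _ => ?_
      simp only [Finset.mul_sum, Finset.sum_mul]
      exact Finset.sum_congr rfl fun m _ => by ring
    rw [e1, e2]
    simp only [← Finset.sum_add_distrib]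
    exact Finset.sum_congr rfl fun a _ => Finset.sum_congr rfl fun b _ => by
      rw [hDs k b a]; ring
  rw [quadraticPart_eq hAs (koszul_symm A hDs) (hC hGA hAs hDs),
    quadraticPart_eq hAs' (koszul_symm A' hDs') (hC hGA' hAs' hDs')]
  refine sum_mul_eq_of_transform hA' fun i j => ?_
  rw [trace_mul_transform hPQ hγ, trace_transform hPQ hγ, trace_transform hPQ hγ, Finset.sum_mul]
  simp only [mul_sub, Finset.sum_sub_distrib, Finset.mul_sum]
  congr 1
  exact Finset.sum_congr rfl fun _ _ => Finset.sum_congr rfl fun _ _ => by ring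

/-- The pairing `V · α` is invariant under a change of basis. -/
lemma sum_contractedVector_transform (hQP : Q * P = 1) (hA : A = Q * A' * Q.transpose)
    (hD : ∀ k i j, D k i j = ∑ a, P a k * ∑ b, P b i * ∑ d, P d j * D' a b d)
    (hDs : ∀ k i j, D k i j = D k j i) (hDs' : ∀ k i j, D' k i j = D' k j i)
    {α α' : Fin n → ℝ} (hα : ∀ k, α k = ∑ a, P a k * α' a) :
    ∑ k, contractedVector A (koszul A D) k * α k
      = ∑ k, contractedVector A' (koszul A' D') k * α' k := by
  have hPQ : P * Q = 1 := mul_eq_one_comm.1 hQP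
  have hγ := connectionMatrix_transform hQP hA hD
  have hA' : P * A * P.transpose = A' := by
    rw [hA]
    calc P * (Q * A' * Q.transpose) * P.transpose
        = (P * Q) * A' * (P * Q).transpose := by
          rw [Matrix.transpose_mul]; simp only [Matrix.mul_assoc]
      _ = A' := by rw [hPQ]; simp
  rw [sum_contractedVector_mul _ (koszul_symm A hDs),
    sum_contractedVector_mul _ (koszul_symm A' hDs')]
  refine sum_mul_eq_of_transform hA' fun i j => ?_
  rw [vecMul_transform hPQ hγ hα, trace_transform hPQ hγ, hα, Finset.sum_mul]
  simp only [mul_sub, Finset.sum_sub_distrib, Finset.mul_sum]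
  congr 1
  exact Finset.sum_congr rfl fun _ _ => Finset.sum_congr rfl fun _ _ => by ring

/-- `½ g^{ij} D_{kij}` is a covector. -/
lemma half_sum_transform (hQP : Q * P = 1) (hA : A = Q * A' * Q.transpose)
    (hD : ∀ k i j, D k i j = ∑ a, P a k * ∑ b, P b i * ∑ d, P d j * D' a b d) (k : Fin n) :
    (1 / 2 : ℝ) * ∑ i, ∑ j, A i j * D k i j
      = ∑ a, P a k * ((1 / 2 : ℝ) * ∑ i, ∑ j, A' i j * D' a i j) := by
  have hPQ : P * Q = 1 := mul_eq_one_comm.1 hQP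
  have hA' : P * A * P.transpose = A' := by
    rw [hA]
    calc P * (Q * A' * Q.transpose) * P.transpose
        = (P * Q) * A' * (P * Q).transpose := by
          rw [Matrix.transpose_mul]; simp only [Matrix.mul_assoc]
      _ = A' := by rw [hPQ]; simp
  rw [sum_mul_eq_of_transform hA' (X' := fun b d => ∑ a, P a k * D' a b d) fun i j => ?_]
  · simp only [Finset.mul_sum]
    rw [Finset.sum_comm_cycle]
    exact Finset.sum_congr rfl fun _ _ => Finset.sum_congr rfl fun _ _ =>
      Finset.sum_congr rfl fun _ _ => by ring
  · rw [hD]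
    simp only [Finset.mul_sum]
    rw [Finset.sum_comm]
    refine Finset.sum_congr rfl fun _ _ => ?_
    rw [Finset.sum_comm]
    exact Finset.sum_congr rfl fun _ _ => Finset.sum_congr rfl fun _ _ => by ring

end invariance

/-! ### The distributional scalar curvature in charts -/

section chartFormula
open Filter Topology
variable {n : ℕ} {M : Type*} [TopologicalSpace M] [ChartedSpace (Euc n) M] {c c' : M} {y : Euc n}

/-- The covector field with given components at the centre of every chart. -/
noncomputable def covectorOfComponents (β : M → Euc n → Fin n → ℝ) : CovectorField n M := fun x =>
  (∑ k, β x (extChartAt (𝓡 n) x x) k • EuclideanSpace.proj k : Euc n →L[ℝ] ℝ)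

lemma mem_transitionDomain_symm (hy : y ∈ (extChartAt (𝓡 n) c).target) :
    y ∈ transitionDomain (n := n) c ((extChartAt (𝓡 n) c).symm y) :=
  ⟨hy, mem_extChartAt_source _⟩

variable [IsManifold (𝓡 n) ∞ M]

/-- The field is defined at each point by components in the chart centred there; the transformation
law `hβ` carries them to every other chart. -/
lemma comp₁_covectorOfComponents {β : M → Euc n → Fin n → ℝ}
    (hβ : ∀ (c c' : M) (y : Euc n), y ∈ transitionDomain (n := n) c c' → ∀ k,
      β c y k = ∑ a, jacobian (transition c c') y a k * β c' (transition c c' y) a)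
    (hy : y ∈ (extChartAt (𝓡 n) c).target) (k : Fin n) :
    comp₁ (covectorOfComponents β) c y k = β c y k := by
  have hd := mem_transitionDomain_symm hy
  rw [comp₁_transform _ hd, hβ _ _ _ hd]
  refine Finset.sum_congr rfl fun a _ => ?_
  congr 1
  set x := (extChartAt (𝓡 n) c).symm y with hx
  have hτ : transition c x y = extChartAt (𝓡 n) x x := rfl
  rw [hτ, comp₁_eq, coordVec'_self, (extChartAt (𝓡 n) x).left_inv (mem_extChartAt_source x)]
  change (∑ k, β x (extChartAt (𝓡 n) x x) k • EuclideanSpace.proj k : Euc n →L[ℝ] ℝ)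
    (EuclideanSpace.single a 1) = _
  have h1 : ∀ b : Fin n, (EuclideanSpace.proj b : Euc n →L[ℝ] ℝ) (EuclideanSpace.single a 1)
      = if b = a then 1 else 0 := fun b => PiLp.single_apply 2 (𝕜 := ℝ) a 1 b
  simp only [sum_apply, smul_apply, h1, smul_eq_mul, mul_ite, mul_one, mul_zero]
  simp

lemma transition_jacobian_left (hy : y ∈ transitionDomain (n := n) c c') :
    (jacobian (transition c c') y)⁻¹ * jacobian (transition c c') y = 1 :=
  Matrix.nonsing_inv_mul _ (isUnit_det_jacobian hy)

lemma comp₂_inv_transform (T : BilinField n M) (hy : y ∈ transitionDomain (n := n) c c') :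
    (comp₂ T c y)⁻¹ = (jacobian (transition c c') y)⁻¹ * (comp₂ T c' (transition c c' y))⁻¹
      * ((jacobian (transition c c') y)⁻¹).transpose := by
  rw [comp₂_transform T hy, Matrix.mul_inv_rev, Matrix.mul_inv_rev, Matrix.transpose_nonsing_inv,
    Matrix.mul_assoc]

/-- Both determinants change by the same squared Jacobian determinant, which cancels in the
quotient. -/
lemma volumeDensity_chart (h g : BilinField n M) (hy : y ∈ (extChartAt (𝓡 n) c).target) :
    volumeDensity h g ((extChartAt (𝓡 n) c).symm y)
      = Real.sqrt ((comp₂ g c y).det / (comp₂ h c y).det) := by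
  have hd := mem_transitionDomain_symm hy
  set x := (extChartAt (𝓡 n) c).symm y with hx
  have hτ : transition c x y = extChartAt (𝓡 n) x x := rfl
  have hJ := (isUnit_det_jacobian hd).ne_zero
  rw [volumeDensity, comp₂_transform h hd, comp₂_transform g hd, hτ]
  simp only [Matrix.det_mul, Matrix.det_transpose]
  congr 1
  rw [mul_assoc, mul_assoc, mul_div_mul_left _ _ hJ, mul_div_mul_right _ _ hJ]

lemma logDensityDeriv_transform (g : BilinField n M) (D : TrilinField n M)
    (hy : y ∈ transitionDomain (n := n) c c') (k : Fin n) :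
    logDensityDeriv (comp₂ g c) (comp₃ D c) k y = ∑ a, jacobian (transition c c') y a k *
      logDensityDeriv (comp₂ g c') (comp₃ D c') a (transition c c' y) :=
  half_sum_transform (transition_jacobian_left hy) (comp₂_inv_transform g hy)
    (comp₃_transform D hy) k

lemma contDiffOn_comp_chart_symm {u : M → ℝ} (hu : ContMDiff (𝓡 n) 𝓘(ℝ) ∞ u) (c : M) :
    ContDiffOn ℝ ∞ (fun y => u ((extChartAt (𝓡 n) c).symm y)) (extChartAt (𝓡 n) c).target :=
  contMDiffOn_iff_contDiffOn.1 (hu.comp_contMDiffOn (contMDiffOn_chart_inverse c))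

lemma partialDeriv_comp_chart_symm_transform {u : M → ℝ} (hu : ContMDiff (𝓡 n) 𝓘(ℝ) ∞ u)
    (hy : y ∈ transitionDomain (n := n) c c') (k : Fin n) :
    partialDeriv (fun z => u ((extChartAt (𝓡 n) c).symm z)) k y
      = ∑ a, jacobian (transition c c') y a k *
        partialDeriv (fun z => u ((extChartAt (𝓡 n) c').symm z)) a (transition c c' y) := by
  have h1 : (fun z => u ((extChartAt (𝓡 n) c).symm z))
      =ᶠ[𝓝 y] fun z => u ((extChartAt (𝓡 n) c').symm (transition c c' z)) := by
    filter_upwards [(isOpen_transitionDomain c c').mem_nhds hy] with z hz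
    rw [chart_symm_transition hz]
  rw [h1.partialDeriv_eq, partialDeriv_comp (f := fun z => u ((extChartAt (𝓡 n) c').symm z))
    (((contDiffOn_comp_chart_symm hu c').differentiableAt_of_isOpen (isOpen_chart_target c')
      (transition_mem hy).1)) (differentiableAt_transition hy)]
  rfl

/-- Symmetry is available for almost every `y` in one fixed chart, whereas the integrand uses the
chart centred at the varying point; tensoriality transfers it pointwise, with no further exceptional
set. -/
lemma comp₃_symm_of_chart {D : TrilinField n M} (hy : y ∈ (extChartAt (𝓡 n) c).target)
    (hD : ∀ k i j, comp₃ D c y k i j = comp₃ D c y k j i) (k i j : Fin n) :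
    comp₃ D ((extChartAt (𝓡 n) c).symm y) (transition c ((extChartAt (𝓡 n) c).symm y) y) k i j
      = comp₃ D ((extChartAt (𝓡 n) c).symm y) (transition c ((extChartAt (𝓡 n) c).symm y) y)
        k j i := by
  have hd := mem_transitionDomain_symm hy
  have ht := transition_mem hd
  rw [comp₃_transform D ht, comp₃_transform D ht, transition_transition hd]
  refine Finset.sum_congr rfl fun a _ => ?_
  congr 1
  simp only [Finset.mul_sum]
  rw [Finset.sum_comm]
  exact Finset.sum_congr rfl fun b _ => Finset.sum_congr rfl fun d _ => by rw [hD]; ring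

/-- Two metrics on `M` (a smooth one and a continuous one), in terms of their components. -/
structure IsMetricPair (h g : BilinField n M) : Prop where
  smooth : ∀ c : M, IsSmoothMetricOn (extChartAt (𝓡 n) c).target (comp₂ h c)
  continuousOn : ∀ (c : M) (i j : Fin n),
    ContinuousOn (fun y => comp₂ g c y i j) (extChartAt (𝓡 n) c).target
  posDef : ∀ (c : M), ∀ y ∈ (extChartAt (𝓡 n) c).target, (comp₂ g c y).PosDef

variable {h g : BilinField n M} {D : TrilinField n M}

-- The weak covariant derivative may be any trilinear field with the right weak equations, hence is
-- symmetric only almost everywhere, by uniqueness of weak derivatives applied to `g_{ij} = g_{ji}`.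
-- The invariance proofs for `V` and `F` use this symmetry.
omit [IsManifold (𝓡 n) ∞ M] in
lemma HasWeakCovDeriv.ae_symm (hp : IsMetricPair h g) (hD : HasWeakCovDeriv h g D) (c : M) :
    ∀ᵐ y, y ∈ (extChartAt (𝓡 n) c).target → ∀ k i j, comp₃ D c y k i j = comp₃ D c y k j i := by
  have hU := isOpen_chart_target (n := n) c
  have key : ∀ k i j, ∀ᵐ y, y ∈ (extChartAt (𝓡 n) c).target →
      comp₃ D c y k i j = comp₃ D c y k j i := by
    intro k i j
    have h1 := (hD c k i j).congr hU (f' := fun y => comp₂ g c y j i)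
      (fun y hy => (hp.posDef c y hy).apply_symm i j) (fun y _ => rfl)
    filter_upwards [h1.ae_eq hU (hD c k j i)] with y hy hyU
    have e := hy hyU
    have e1 : ∑ l, christoffel (comp₂ h c) y l k i * comp₂ g c y l j
        = ∑ l, christoffel (comp₂ h c) y l k i * comp₂ g c y j l :=
      Finset.sum_congr rfl fun l _ => by rw [(hp.posDef c y hyU).apply_symm l j]
    have e2 : ∑ l, christoffel (comp₂ h c) y l k j * comp₂ g c y l i
        = ∑ l, christoffel (comp₂ h c) y l k j * comp₂ g c y i l :=
      Finset.sum_congr rfl fun l _ => by rw [(hp.posDef c y hyU).apply_symm l i]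
    rw [e1, e2] at e
    linarith
  have := ae_all_iff.2 fun k => ae_all_iff.2 fun i => ae_all_iff.2 fun j => key k i j
  filter_upwards [this] with y hy hyU k i j
  exact hy k i j hyU

/-- The differential of `u dμ_g/dμ_h`. -/
noncomputable def densityDifferential (h g : BilinField n M) (D : TrilinField n M) (u : M → ℝ) :
    CovectorField n M :=
  covectorOfComponents fun c y k => Real.sqrt ((comp₂ g c y).det / (comp₂ h c y).det) *
    (partialDeriv (fun z => u ((extChartAt (𝓡 n) c).symm z)) k y
      + u ((extChartAt (𝓡 n) c).symm y) * logDensityDeriv (comp₂ g c) (comp₃ D c) k y)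

lemma comp₁_densityDifferential {u : M → ℝ} (hu : ContMDiff (𝓡 n) 𝓘(ℝ) ∞ u)
    (hy : y ∈ (extChartAt (𝓡 n) c).target) (k : Fin n) :
    comp₁ (densityDifferential h g D u) c y k
      = Real.sqrt ((comp₂ g c y).det / (comp₂ h c y).det) *
        (partialDeriv (fun z => u ((extChartAt (𝓡 n) c).symm z)) k y
          + u ((extChartAt (𝓡 n) c).symm y) * logDensityDeriv (comp₂ g c) (comp₃ D c) k y) := by
  refine comp₁_covectorOfComponents (fun c c' y hy k => ?_) hy k
  rw [← volumeDensity_chart h g hy.1, ← volumeDensity_chart h g (transition_mem hy).1,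
    chart_symm_transition hy, partialDeriv_comp_chart_symm_transform hu hy,
    logDensityDeriv_transform g D hy, Finset.mul_sum, ← Finset.sum_add_distrib, Finset.mul_sum]
  exact Finset.sum_congr rfl fun a _ => by ring

/-- The weak differential of `u dμ_g/dμ_h` exists. -/
theorem hasWeakDifferential_densityDifferential (hp : IsMetricPair h g)
    (hD : HasWeakCovDeriv h g D) {u : M → ℝ} (hu : ContMDiff (𝓡 n) 𝓘(ℝ) ∞ u) :
    HasWeakDifferential (fun x => u x * volumeDensity h g x) (densityDifferential h g D u) := by
  intro c k
  have hU := isOpen_chart_target (n := n) c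
  have h1 := hasWeakPartialDeriv_density hU (hp.smooth c) (hp.continuousOn c) (hp.posDef c)
    (D := comp₃ D c) (fun k i j => hD c k i j) k
  refine (h1.contDiffOn_mul hU (contDiffOn_comp_chart_symm hu c)).congr hU (fun y hy => ?_)
    (fun y hy => ?_)
  · exact congrArg _ (volumeDensity_chart h g hy).symm
  · rw [comp₁_densityDifferential hu hy]; ring

/-- `weakDifferential` is obtained by choice, so it is compared with the explicit differential
through uniqueness, up to a null set in each chart. -/
lemma comp₁_weakDifferential_ae (hp : IsMetricPair h g) (hD : HasWeakCovDeriv h g D) {u : M → ℝ}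
    (hu : ContMDiff (𝓡 n) 𝓘(ℝ) ∞ u) (c : M) :
    ∀ᵐ y, y ∈ (extChartAt (𝓡 n) c).target → ∀ k,
      comp₁ (weakDifferential n fun x => u x * volumeDensity h g x) c y k
      = Real.sqrt ((comp₂ g c y).det / (comp₂ h c y).det) *
        (partialDeriv (fun z => u ((extChartAt (𝓡 n) c).symm z)) k y
          + u ((extChartAt (𝓡 n) c).symm y) * logDensityDeriv (comp₂ g c) (comp₃ D c) k y) := by
  have hα := hasWeakDifferential_densityDifferential hp hD hu
  have hex : ∃ α : CovectorField n M, HasWeakDifferential (fun x => u x * volumeDensity h g x) α :=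
    ⟨_, hα⟩
  have hw : HasWeakDifferential (fun x => u x * volumeDensity h g x)
      (weakDifferential n fun x => u x * volumeDensity h g x) := by
    rw [weakDifferential, dif_pos hex]; exact hex.choose_spec
  have := ae_all_iff.2 fun k => (hw c k).ae_eq (isOpen_chart_target c) (hα c k)
  filter_upwards [this] with y hy hyU k
  rw [hy k hyU, comp₁_densityDifferential hu hyU]

lemma scalarPart_transform (hp : IsMetricPair h g) (hy : y ∈ transitionDomain (n := n) c c')
    (hs : ∀ k i j, comp₃ D c y k i j = comp₃ D c y k j i)
    (hs' : ∀ k i j, comp₃ D c' (transition c c' y) k i j = comp₃ D c' (transition c c' y) k j i) :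
    scalarPart (comp₂ h c) (comp₂ g c) (comp₃ D c) y
      = scalarPart (comp₂ h c') (comp₂ g c') (comp₃ D c') (transition c c' y) := by
  have hG := hp.posDef c y hy.1
  have hG' := hp.posDef c' _ (transition_mem hy).1
  unfold scalarPart
  congr 1
  · exact contracted_ricciCoord_transform (isOpen_transitionDomain c c')
      (isOpen_transitionDomain c' c) (contDiffOn_transition c c') (fun z hz => transition_mem hz)
      (fun z hz => isUnit_det_jacobian hz) ((hp.smooth c).mono Set.inter_subset_left)
      ((hp.smooth c').mono Set.inter_subset_left) (fun z hz => comp₂_transform h hz) hy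
      (fun z hz => comp₂_transform g hz)
  · exact quadraticPart_transform (transition_jacobian_left hy) (comp₂_inv_transform g hy)
      hG.mul_inv hG'.mul_inv hG.inv_symm hG'.inv_symm (comp₃_transform D hy) hs hs'

lemma sum_vectorPart_transform (α : CovectorField n M) (hy : y ∈ transitionDomain (n := n) c c')
    (hs : ∀ k i j, comp₃ D c y k i j = comp₃ D c y k j i)
    (hs' : ∀ k i j, comp₃ D c' (transition c c' y) k i j = comp₃ D c' (transition c c' y) k j i) :
    ∑ k, vectorPart (comp₂ g c) (comp₃ D c) k y * comp₁ α c y k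
      = ∑ k, vectorPart (comp₂ g c') (comp₃ D c') k (transition c c' y)
        * comp₁ α c' (transition c c' y) k :=
  sum_contractedVector_transform (transition_jacobian_left hy) (comp₂_inv_transform g hy)
    (comp₃_transform D hy) hs hs' (comp₁_transform α hy)

lemma scalarCurvature_chart {O : Set M} (hO : IsOpen O)
    (hg : ∀ c : M, IsSmoothMetricOn
      ((extChartAt (𝓡 n) c).target ∩ (extChartAt (𝓡 n) c).symm ⁻¹' O) (comp₂ g c))
    (hy : y ∈ (extChartAt (𝓡 n) c).target ∩ (extChartAt (𝓡 n) c).symm ⁻¹' O) :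
    scalarCurvature g ((extChartAt (𝓡 n) c).symm y)
      = ∑ i, ∑ j, (comp₂ g c y)⁻¹ i j * ricciCoord (comp₂ g c) y i j := by
  set x := (extChartAt (𝓡 n) c).symm y with hx
  have hV : ∀ c c' : M, IsOpen (transitionDomain (n := n) c c' ∩ (extChartAt (𝓡 n) c).symm ⁻¹' O) := by
    intro c c'
    have := ((continuousOn_extChartAt_symm (I := 𝓡 n) c).mono
      (transitionDomain_subset c c')).isOpen_inter_preimage (isOpen_transitionDomain c c') hO
    exact this
  have hd : y ∈ transitionDomain (n := n) c x := mem_transitionDomain_symm hy.1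
  have hsub : ∀ c c' : M, transitionDomain (n := n) c c' ∩ (extChartAt (𝓡 n) c).symm ⁻¹' O
      ⊆ (extChartAt (𝓡 n) c).target ∩ (extChartAt (𝓡 n) c).symm ⁻¹' O := fun c c' z hz =>
    ⟨hz.1.1, hz.2⟩
  have h1 := contracted_ricciCoord_transform (hV c x) (hV x c)
    ((contDiffOn_transition c x).mono Set.inter_subset_left)
    (fun z hz => ⟨transition_mem hz.1, by
      rw [Set.mem_preimage, chart_symm_transition hz.1]; exact hz.2⟩)
    (fun z hz => isUnit_det_jacobian hz.1) ((hg c).mono (hsub c x)) ((hg x).mono (hsub x c))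
    (fun z hz => comp₂_transform g hz.1) ⟨hd, hy.2⟩ (fun z hz => comp₂_transform g hz.1)
  exact h1.symm

omit [IsManifold (𝓡 n) ∞ M] in
lemma distScalarIntegrand_eq (h g : BilinField n M) (u : M → ℝ) (x : M) :
    distScalarIntegrand h g u x
      = -(∑ k, vectorPart (comp₂ g x) (comp₃ (weakCovDeriv h g) x) k (extChartAt (𝓡 n) x x) *
          comp₁ (weakDifferential n fun z => u z * volumeDensity h g z) x
            (extChartAt (𝓡 n) x x) k)
        + scalarPart (comp₂ h x) (comp₂ g x) (comp₃ (weakCovDeriv h g) x) (extChartAt (𝓡 n) x x)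
          * (u x * volumeDensity h g x) := by
  have h1 : scalarF h g (weakCovDeriv h g) x (extChartAt (𝓡 n) x x)
      = scalarPart (comp₂ h x) (comp₂ g x) (comp₃ (weakCovDeriv h g) x)
        (extChartAt (𝓡 n) x x) := by
    unfold scalarPart quadraticPart
    rw [← add_assoc, ← add_assoc, ← sub_eq_add_neg]
    rfl
  rw [distScalarIntegrand, h1]
  rfl

/-- The integrand of the distributional scalar curvature, in a chart. -/
theorem distScalarIntegrand_chart_ae (hp : IsMetricPair h g)
    (hD : HasWeakCovDeriv h g (weakCovDeriv h g)) {u : M → ℝ}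
    (hu : ContMDiff (𝓡 n) 𝓘(ℝ) ∞ u) (c : M) :
    ∀ᵐ y, y ∈ (extChartAt (𝓡 n) c).target →
      distScalarIntegrand h g u ((extChartAt (𝓡 n) c).symm y)
        = Real.sqrt ((comp₂ g c y).det / (comp₂ h c y).det) *
        (∑ k, -vectorPart (comp₂ g c) (comp₃ (weakCovDeriv h g) c) k y *
            partialDeriv (fun z => u ((extChartAt (𝓡 n) c).symm z)) k y
          + (scalarPart (comp₂ h c) (comp₂ g c) (comp₃ (weakCovDeriv h g) c) y
            - ∑ k, vectorPart (comp₂ g c) (comp₃ (weakCovDeriv h g) c) k y *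
              logDensityDeriv (comp₂ g c) (comp₃ (weakCovDeriv h g) c) k y)
            * u ((extChartAt (𝓡 n) c).symm y)) := by
  filter_upwards [hD.ae_symm hp c, comp₁_weakDifferential_ae hp hD hu c] with y hs hα hy
  -- The integrand at this point is written in the chart centred there; the pairing and the scalar
  -- are now moved to the fixed chart at `c`.
  have hd := mem_transitionDomain_symm hy
  have hs' := comp₃_symm_of_chart hy (hs hy)
  rw [distScalarIntegrand_eq]
  have e1 := sum_vectorPart_transform (g := g)
    (weakDifferential n fun z => u z * volumeDensity h g z) hd (hs hy) hs'
  have e2 := scalarPart_transform hp hd (hs hy) hs'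
  have hτ : transition c ((extChartAt (𝓡 n) c).symm y) y
    = extChartAt (𝓡 n) ((extChartAt (𝓡 n) c).symm y) ((extChartAt (𝓡 n) c).symm y) := rfl
  rw [hτ] at e1 e2
  rw [← e1, ← e2, volumeDensity_chart h g hy]
  simp only [hα hy]
  rw [mul_add, Finset.mul_sum, ← Finset.sum_neg_distrib, sub_mul, mul_sub, Finset.sum_mul,
    Finset.mul_sum, add_sub, add_sub_right_comm, ← Finset.sum_sub_distrib]
  congr 1
  · exact Finset.sum_congr rfl fun k _ => by ring
  · ring

end chartFormula

/-! ### Localisation of the distributional scalar curvature -/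

section localisation
open Filter Topology
variable {n : ℕ} {M : Type*} [TopologicalSpace M] [ChartedSpace (Euc n) M]

/-- A function on `M`, read in the chart at `c` and extended by zero. -/
noncomputable def chartExtension (f : M → ℝ) (c : M) : Euc n → ℝ :=
  (extChartAt (𝓡 n) c).target.indicator fun y => f ((extChartAt (𝓡 n) c).symm y)

lemma chartExtension_eventuallyEq {f : M → ℝ} {c : M} {y : Euc n}
    (hy : y ∈ (extChartAt (𝓡 n) c).target) :
    chartExtension f c =ᶠ[𝓝 y] fun z => f ((extChartAt (𝓡 n) c).symm z) := by
  filter_upwards [(isOpen_chart_target c).mem_nhds hy] with z hz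
  rw [chartExtension, Set.indicator_of_mem hz]

lemma isCompact_chart_image {f : M → ℝ} (hc : HasCompactSupport f) {c : M}
    (hs : tsupport f ⊆ (extChartAt (𝓡 n) c).source) :
    IsCompact (extChartAt (𝓡 n) c '' tsupport f) :=
  IsCompact.image_of_continuousOn hc ((continuousOn_extChartAt c).mono hs)

lemma chart_image_subset {f : M → ℝ} {c : M}
    (hs : tsupport f ⊆ (extChartAt (𝓡 n) c).source) :
    extChartAt (𝓡 n) c '' tsupport f ⊆ (extChartAt (𝓡 n) c).target := by
  rintro _ ⟨x, hx, rfl⟩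
  exact (extChartAt (𝓡 n) c).map_source (hs hx)

lemma support_chartExtension_subset (f : M → ℝ) (c : M) :
    Function.support (chartExtension (n := n) f c) ⊆ extChartAt (𝓡 n) c '' tsupport f := by
  intro y hy
  by_cases hyt : y ∈ (extChartAt (𝓡 n) c).target
  · rw [Function.mem_support, chartExtension, Set.indicator_of_mem hyt] at hy
    exact ⟨_, subset_tsupport f hy, (extChartAt (𝓡 n) c).right_inv hyt⟩
  · rw [Function.mem_support, chartExtension, Set.indicator_of_notMem hyt] at hy
    exact absurd rfl hy

lemma tsupport_chartExtension_subset {f : M → ℝ} (hc : HasCompactSupport f) {c : M}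
    (hs : tsupport f ⊆ (extChartAt (𝓡 n) c).source) :
    tsupport (chartExtension (n := n) f c) ⊆ extChartAt (𝓡 n) c '' tsupport f :=
  closure_minimal (support_chartExtension_subset f c) (isCompact_chart_image hc hs).isClosed

lemma hasCompactSupport_chartExtension {f : M → ℝ} (hc : HasCompactSupport f) {c : M}
    (hs : tsupport f ⊆ (extChartAt (𝓡 n) c).source) :
    HasCompactSupport (chartExtension (n := n) f c) :=
  (isCompact_chart_image hc hs).of_isClosed_subset (isClosed_tsupport _)
    (tsupport_chartExtension_subset hc hs)

variable [IsManifold (𝓡 n) ∞ M]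

lemma contDiff_chartExtension {f : M → ℝ} (hf : ContMDiff (𝓡 n) 𝓘(ℝ) ∞ f)
    (hc : HasCompactSupport f) {c : M} (hs : tsupport f ⊆ (extChartAt (𝓡 n) c).source) :
    ContDiff ℝ ∞ (chartExtension (n := n) f c) := by
  rw [contDiff_iff_contDiffAt]
  intro y
  by_cases hy : y ∈ (extChartAt (𝓡 n) c).target
  · exact ((contDiffOn_comp_chart_symm hf c).contDiffAt
      ((isOpen_chart_target c).mem_nhds hy)).congr_of_eventuallyEq (chartExtension_eventuallyEq hy)
  · have h1 : chartExtension (n := n) f c =ᶠ[𝓝 y] 0 :=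
      notMem_tsupport_iff_eventuallyEq.1 fun h =>
        hy (chart_image_subset hs (tsupport_chartExtension_subset hc hs h))
    exact (contDiffAt_const (c := (0 : ℝ))).congr_of_eventuallyEq h1

variable {h g : BilinField n M} [MeasurableSpace M] [BorelSpace M] [SecondCountableTopology M]

/-- The chosen weak differential need not vanish at every point off the support of `u`; the chart
formula does vanish there, so the exceptional set is null. -/
lemma distScalarIntegrand_ae_eq_zero (hp : IsMetricPair h g)
    (hD : HasWeakCovDeriv h g (weakCovDeriv h g)) {u : M → ℝ}
    (hu : ContMDiff (𝓡 n) 𝓘(ℝ) ∞ u) :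
    ∀ᵐ x ∂(riemannianVolume h), x ∉ tsupport u → distScalarIntegrand h g u x = 0 := by
  refine ae_riemannianVolume fun c => ?_
  filter_upwards [distScalarIntegrand_chart_ae hp hD hu c] with y hy hyt hyu
  rw [hy hyt]
  have h1 : (fun z => u ((extChartAt (𝓡 n) c).symm z)) =ᶠ[𝓝 y] fun _ => 0 :=
    (continuousAt_extChartAt_symm'' hyt).eventually (notMem_tsupport_iff_eventuallyEq.1 hyu)
  simp only [h1.partialDeriv_eq, h1.eq_of_nhds, partialDeriv_const, mul_zero, Finset.sum_const_zero,
    add_zero]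

/-- The distributional scalar curvature, on test functions supported in a chart domain. -/
theorem distScalar_local (hn : 2 ≤ n) {p : ℝ≥0∞} (hp : (n : ℝ≥0∞) ≤ p) (hgh : IsMetricPair h g)
    (hD : HasWeakCovDeriv h g (weakCovDeriv h g))
    (hDp : ∀ (c : M) (k i j : Fin n), MemLpLocOn p (extChartAt (𝓡 n) c).target
      fun y => comp₃ (weakCovDeriv h g) c y k i j)
    {S : Set M} (hS : IsClosed S)
    (hg : ∀ c : M, IsSmoothMetricOn
      ((extChartAt (𝓡 n) c).target ∩ (extChartAt (𝓡 n) c).symm ⁻¹' Sᶜ) (comp₂ g c))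
    (hfin : p ≠ ⊤ → ∀ c : M, ∀ K ⊆ (extChartAt (𝓡 n) c).target, IsCompact K →
      Measure.hausdorffMeasure ((n : ℝ) - p.toReal / (p.toReal - 1))
        (K ∩ (extChartAt (𝓡 n) c).symm ⁻¹' S) < ⊤)
    (hinf : p = ⊤ → ∀ c : M, ∀ K ⊆ (extChartAt (𝓡 n) c).target, IsCompact K →
      Measure.hausdorffMeasure ((n : ℝ) - 1) (K ∩ (extChartAt (𝓡 n) c).symm ⁻¹' S) = 0)
    {a : ℝ} (hR : ∀ x ∉ S, a ≤ scalarCurvature g x)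
    {f : M → ℝ} (hf : ContMDiff (𝓡 n) 𝓘(ℝ) ∞ f) (hfc : HasCompactSupport f) {c : M}
    (hfs : tsupport f ⊆ (extChartAt (𝓡 n) c).source) (hf0 : ∀ x, 0 ≤ f x) :
    Integrable (distScalarIntegrand h g f) (riemannianVolume h) ∧
      Integrable f (riemannianVolume g) ∧
      0 ≤ ∫ x, distScalarIntegrand h g f x ∂(riemannianVolume h)
        - a * ∫ x, f x ∂(riemannianVolume g) := by
  set U := (extChartAt (𝓡 n) c).target with hUdef
  set φ : Euc n → ℝ := chartExtension f c with hφdef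
  have hU : IsOpen U := isOpen_chart_target c
  have hUZ : U \ (extChartAt (𝓡 n) c).symm ⁻¹' S
      = U ∩ (extChartAt (𝓡 n) c).symm ⁻¹' Sᶜ := rfl
  have hφU : ∀ y ∈ U, φ y = f ((extChartAt (𝓡 n) c).symm y) := fun y hy =>
    (chartExtension_eventuallyEq hy).eq_of_nhds
  have hφs : tsupport φ ⊆ U :=
    (tsupport_chartExtension_subset hfc hfs).trans (chart_image_subset hfs)
  have hφ := contDiff_chartExtension hf hfc hfs
  have hφ0 : ∀ y, 0 ≤ φ y := fun y => Set.indicator_nonneg (fun z _ => hf0 _) y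
  have hφz : ∀ y ∉ U, φ y = 0 := fun y hy => Set.indicator_of_notMem hy _
  obtain ⟨hi, hpos⟩ := integral_scalar_nonneg hn hp hU
    (hUZ ▸ (continuousOn_extChartAt_symm c).isOpen_inter_preimage hU hS.isOpen_compl)
    (fun hp => hfin hp c) (fun hp => hinf hp c) (hgh.smooth c) (hgh.continuousOn c) (hgh.posDef c)
    (hUZ ▸ hg c) (D := comp₃ (weakCovDeriv h g) c) (fun k i j => hD c k i j) (hDp c) (a := a)
    (fun y hy => by
      rw [← scalarCurvature_chart hS.isOpen_compl hg hy]; exact hR _ hy.2)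
    hφ (hasCompactSupport_chartExtension hfc hfs) hφs hφ0
  set I : Euc n → ℝ := fun y =>
    ∑ k, -(vectorPart (comp₂ g c) (comp₃ (weakCovDeriv h g) c) k y * Real.sqrt (comp₂ g c y).det)
        * partialDeriv φ k y
      + (scalarPart (comp₂ h c) (comp₂ g c) (comp₃ (weakCovDeriv h g) c) y
        - ∑ k, vectorPart (comp₂ g c) (comp₃ (weakCovDeriv h g) c) k y
          * logDensityDeriv (comp₂ g c) (comp₃ (weakCovDeriv h g) c) k y - a)
        * Real.sqrt (comp₂ g c y).det * φ y with hI
  have hIz : ∀ y ∉ U, I y = 0 := by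
    intro y hy
    have h1 : ∀ k, partialDeriv φ k y = 0 := fun k =>
      partialDeriv_eq_zero_of_notMem_tsupport (fun h => hy (hφs h)) k
    simp only [hI, h1, hφz y hy, mul_zero, Finset.sum_const_zero, add_zero]
  have hσ : ContinuousOn (fun y => Real.sqrt (comp₂ g c y).det) U :=
    continuousOn_sqrt_det (hgh.continuousOn c)
  -- the volume integral
  have hJ : Integrable fun y => φ y * Real.sqrt (comp₂ g c y).det := by
    refine (integrableOn_iff_integrable_of_support_subset (s := tsupport φ) fun y hy => ?_).1 ?_
    · exact subset_tsupport φ fun h => hy (by simp [h])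
    · exact (hφ.continuous.continuousOn.mul (hσ.mono hφs)).integrableOn_compact
        (hasCompactSupport_chartExtension hfc hfs)
  have hfsrc : ∀ x ∉ (extChartAt (𝓡 n) c).source, f x = 0 := fun x hx =>
    image_eq_zero_of_notMem_tsupport fun h => hx (hfs h)
  have hJU : ∀ y ∈ U, f ((extChartAt (𝓡 n) c).symm y) * Real.sqrt (comp₂ g c y).det
      = φ y * Real.sqrt (comp₂ g c y).det := fun y hy => by rw [hφU y hy]
  obtain ⟨hfi, hfint⟩ := integral_riemannianVolume (T := g) (c := c) (hgh.continuousOn c) hfsrc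
    (hJ.integrableOn.congr_fun (fun y hy => (hJU y hy).symm) hU.measurableSet)
  rw [setIntegral_congr_fun hU.measurableSet hJU,
    setIntegral_eq_integral_of_forall_compl_eq_zero fun y hy => by rw [hφz y hy, zero_mul]] at hfint
  -- the curvature integral
  set R : M → ℝ := (extChartAt (𝓡 n) c).source.indicator (distScalarIntegrand h g f) with hRdef
  -- Truncating to the chart domain changes the integrand only on a null set and supplies the exact
  -- vanishing outside the domain that `integral_riemannianVolume` asks for.
  have hRae : R =ᵐ[riemannianVolume h] distScalarIntegrand h g f := by
    filter_upwards [distScalarIntegrand_ae_eq_zero hgh hD hf] with x hx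
    by_cases hxs : x ∈ (extChartAt (𝓡 n) c).source
    · rw [hRdef, Set.indicator_of_mem hxs]
    · rw [hRdef, Set.indicator_of_notMem hxs, hx fun h => hxs (hfs h)]
  have hRU : ∀ᵐ y, y ∈ U → R ((extChartAt (𝓡 n) c).symm y) * Real.sqrt (comp₂ h c y).det
      = I y + a * (φ y * Real.sqrt (comp₂ g c y).det) := by
    filter_upwards [distScalarIntegrand_chart_ae hgh hD hf c] with y hy hyU
    rw [hRdef, Set.indicator_of_mem ((extChartAt (𝓡 n) c).map_target hyU), hy hyU]
    have hH := ((hgh.smooth c).posDef y hyU).det_pos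
    have hG := (hgh.posDef c y hyU).det_pos
    -- The density of `g` relative to `h` times the coordinate density of `h` is the coordinate
    -- density of `g`, the volume factor of `I`.
    have e : Real.sqrt ((comp₂ g c y).det / (comp₂ h c y).det) * Real.sqrt (comp₂ h c y).det
        = Real.sqrt (comp₂ g c y).det := by
      rw [← Real.sqrt_mul (div_nonneg hG.le hH.le), div_mul_cancel₀ _ hH.ne']
    have e2 : ∀ k, partialDeriv (fun z => f ((extChartAt (𝓡 n) c).symm z)) k y
        = partialDeriv φ k y := fun k =>
      ((chartExtension_eventuallyEq hyU).partialDeriv_eq k).symm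
    rw [mul_right_comm, e, ← hφU y hyU]
    simp only [e2, hI]
    rw [mul_add, Finset.mul_sum, add_assoc]
    congr 1
    · exact Finset.sum_congr rfl fun k _ => by ring
    · ring
  have hRi : IntegrableOn (fun y => R ((extChartAt (𝓡 n) c).symm y) * Real.sqrt (comp₂ h c y).det)
      U :=
    ((hi.add (hJ.const_mul a)).integrableOn).congr
      ((ae_restrict_iff' hU.measurableSet).2 (hRU.mono fun y hy hyU => (hy hyU).symm))
  obtain ⟨hR1, hR2⟩ := integral_riemannianVolume (T := h) (c := c)
    (fun i j => ((hgh.smooth c).contDiffOn i j).continuousOn)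
    (fun x hx => Set.indicator_of_notMem hx _) hRi
  rw [setIntegral_congr_ae hU.measurableSet hRU,
    setIntegral_eq_integral_of_forall_compl_eq_zero fun y hy => by
      rw [hIz y hy, hφz y hy, zero_mul, mul_zero, add_zero],
    integral_add hi (hJ.const_mul a), integral_const_mul] at hR2
  refine ⟨hR1.congr hRae, hfi, ?_⟩
  rw [← integral_congr_ae hRae, hR2, hfint]
  linarith

/-- Pointwise additivity is not automatic, since the weak differential of each function is chosen
separately; the chart formula, valid almost everywhere, is linear in the test function. -/
lemma distScalarIntegrand_sum_ae (hp : IsMetricPair h g)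
    (hD : HasWeakCovDeriv h g (weakCovDeriv h g)) {ι : Type*} (s : Finset ι) {f : ι → M → ℝ}
    (hf : ∀ i, ContMDiff (𝓡 n) 𝓘(ℝ) ∞ (f i)) {u : M → ℝ} (hu : ContMDiff (𝓡 n) 𝓘(ℝ) ∞ u)
    (hsum : ∀ x, u x = ∑ i ∈ s, f i x) :
    distScalarIntegrand h g u =ᵐ[riemannianVolume h]
      fun x => ∑ i ∈ s, distScalarIntegrand h g (f i) x := by
  refine ae_riemannianVolume fun c => ?_
  have hall := (ae_ball_iff s.countable_toSet).2 fun i _ =>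
    distScalarIntegrand_chart_ae hp hD (hf i) c
  filter_upwards [distScalarIntegrand_chart_ae hp hD hu c, hall] with y hy hi hyt
  have h1 : ∀ k, partialDeriv (fun z => u ((extChartAt (𝓡 n) c).symm z)) k y
      = ∑ i ∈ s, partialDeriv (fun z => f i ((extChartAt (𝓡 n) c).symm z)) k y := by
    intro k
    simp only [hsum]
    exact partialDeriv_sum (fun i _ => (contDiffOn_comp_chart_symm (hf i)
      c).differentiableAt_of_isOpen (isOpen_chart_target c) hyt) k
  rw [hy hyt, Finset.sum_congr rfl fun i his => hi i his hyt, ← Finset.mul_sum,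
    Finset.sum_add_distrib, ← Finset.mul_sum, ← hsum]
  congr 2
  simp only [h1, Finset.mul_sum]
  rw [Finset.sum_comm]

/-- The distributional scalar curvature is bounded below, on all test functions. -/
theorem distScalar_global [T2Space M] (hn : 2 ≤ n) {p : ℝ≥0∞} (hp : (n : ℝ≥0∞) ≤ p)
    (hgh : IsMetricPair h g) (hD : HasWeakCovDeriv h g (weakCovDeriv h g))
    (hDp : ∀ (c : M) (k i j : Fin n), MemLpLocOn p (extChartAt (𝓡 n) c).target
      fun y => comp₃ (weakCovDeriv h g) c y k i j)
    {S : Set M} (hS : IsClosed S)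
    (hg : ∀ c : M, IsSmoothMetricOn
      ((extChartAt (𝓡 n) c).target ∩ (extChartAt (𝓡 n) c).symm ⁻¹' Sᶜ) (comp₂ g c))
    (hfin : p ≠ ⊤ → ∀ c : M, ∀ K ⊆ (extChartAt (𝓡 n) c).target, IsCompact K →
      Measure.hausdorffMeasure ((n : ℝ) - p.toReal / (p.toReal - 1))
        (K ∩ (extChartAt (𝓡 n) c).symm ⁻¹' S) < ⊤)
    (hinf : p = ⊤ → ∀ c : M, ∀ K ⊆ (extChartAt (𝓡 n) c).target, IsCompact K →
      Measure.hausdorffMeasure ((n : ℝ) - 1) (K ∩ (extChartAt (𝓡 n) c).symm ⁻¹' S) = 0)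
    {a : ℝ} (hR : ∀ x ∉ S, a ≤ scalarCurvature g x)
    {u : M → ℝ} (hu : ContMDiff (𝓡 n) 𝓘(ℝ) ∞ u) (huc : HasCompactSupport u)
    (hu0 : ∀ x, 0 ≤ u x) :
    Integrable (distScalarIntegrand h g u) (riemannianVolume h) ∧
      Integrable u (riemannianVolume g) ∧
      0 ≤ ∫ x, distScalarIntegrand h g u x ∂(riemannianVolume h)
        - a * ∫ x, u x ∂(riemannianVolume g) := by
  have : LocallyCompactSpace M := ChartedSpace.locallyCompactSpace (Euc n) M
  obtain ⟨χ, hχ⟩ := SmoothPartitionOfUnity.exists_isSubordinate_chartAt_source (𝓡 n) M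
  -- Local finiteness and compactness of the support leave finitely many pieces `χ i * u`, each
  -- smooth, nonnegative and supported in one chart domain.
  have hfinite : {i | (Function.support (χ i) ∩ tsupport u).Nonempty}.Finite :=
    χ.locallyFinite.finite_nonempty_inter_compact huc
  set s := hfinite.toFinset with hs
  set f : M → M → ℝ := fun i x => χ i x * u x with hf
  have hfsm : ∀ i, ContMDiff (𝓡 n) 𝓘(ℝ) ∞ (f i) := fun i => (χ i).contMDiff.mul hu
  have hzero : ∀ i ∉ s, ∀ x, f i x = 0 := by
    intro i hi x
    by_contra hne
    apply hi
    rw [hs, Set.Finite.mem_toFinset]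
    exact ⟨x, left_ne_zero_of_mul hne, subset_tsupport u (right_ne_zero_of_mul hne)⟩
  have hsum : ∀ x, u x = ∑ i ∈ s, f i x := by
    intro x
    have h1 := χ.sum_eq_one (Set.mem_univ x)
    have h2 : ∑ᶠ i, f i x = ∑ i ∈ s, f i x := by
      refine finsum_eq_sum_of_support_subset _ fun i hi => ?_
      by_contra h
      exact hi (hzero i h x)
    rw [← h2, ← finsum_mul, h1, one_mul]
  have hloc := fun i => distScalar_local hn hp hgh hD hDp hS hg hfin hinf hR (hfsm i)
    (HasCompactSupport.mul_left huc) (c := i) (by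
      rw [extChartAt_source]
      exact (tsupport_mul_subset_left).trans (hχ i)) (fun x => mul_nonneg (χ.nonneg i x) (hu0 x))
  have hae := distScalarIntegrand_sum_ae hgh hD s hfsm hu hsum
  have hI := integrable_finsetSum s fun i _ => (hloc i).1
  have hJ := integrable_finsetSum s fun i _ => (hloc i).2.1
  refine ⟨hI.congr hae.symm, hJ.congr (Eventually.of_forall fun x => (hsum x).symm), ?_⟩
  rw [integral_congr_ae hae, integral_congr_ae (Eventually.of_forall hsum),
    integral_finsetSum s fun i _ => (hloc i).1, integral_finsetSum s fun i _ => (hloc i).2.1,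
    Finset.mul_sum, ← Finset.sum_sub_distrib]
  exact Finset.sum_nonneg fun i _ => (hloc i).2.2

end localisation

/-! ### The background metric and g in charts -/

section metricTensor
variable {n : ℕ} {M : Type*} [TopologicalSpace M] [ChartedSpace (Euc n) M] [IsManifold (𝓡 n) ∞ M]

omit [IsManifold (𝓡 n) ∞ M] in
/-- The weak covariant derivative of a metric in `W^{1,p}_loc` is in `L^p_loc`. -/
lemma MemW1pLoc.weakCovDeriv {h g : BilinField n M} {p : ℝ≥0∞} (hg : MemW1pLoc h g p) :
    HasWeakCovDeriv h g (weakCovDeriv h g) ∧ ∀ (c : M) (k i j : Fin n),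
      MemLpLocOn p (extChartAt (𝓡 n) c).target fun y => comp₃ (_root_.weakCovDeriv h g) c y k i j := by
  obtain ⟨-, D, hD, hDp⟩ := hg
  have hex : ∃ D : TrilinField n M, HasWeakCovDeriv h g D := ⟨D, hD⟩
  have hw : HasWeakCovDeriv h g (_root_.weakCovDeriv h g) := by
    rw [_root_.weakCovDeriv, dif_pos hex]; exact hex.choose_spec
  refine ⟨hw, fun c k i j K hK hKc => (memLp_congr_ae ?_).1 (hDp c k i j K hK hKc)⟩
  refine (ae_restrict_iff' hKc.measurableSet).2 ?_
  filter_upwards [(hD c k i j).ae_eq (isOpen_chart_target c) (hw c k i j)] with y hy hyK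
  have := hy (hK hyK)
  linarith

variable [RiemannianBundle (fun x : M => TangentSpace (𝓡 n) x)]
  [IsContMDiffRiemannianBundle (𝓡 n) ∞ (Euc n) (fun x : M => TangentSpace (𝓡 n) x)]

lemma contMDiff_metricTensor : ContMDiff (𝓡 n) ((𝓡 n).prod 𝓘(ℝ, Euc n →L[ℝ] Euc n →L[ℝ] ℝ)) ∞
    (fun x : M => TotalSpace.mk' (Euc n →L[ℝ] Euc n →L[ℝ] ℝ)
      (E := fun x : M => TangentSpace (𝓡 n) x →L[ℝ] TangentSpace (𝓡 n) x →L[ℝ] ℝ)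
      x (metricTensor n M x)) := by
  obtain ⟨g, hg, hgi⟩ := IsContMDiffRiemannianBundle.exists_contMDiff (IB := 𝓡 n) (n := ∞)
    (F := Euc n) (E := fun x : M => TangentSpace (𝓡 n) x)
  have e : metricTensor n M = g := by
    funext x
    ext v w
    exact hgi x v w
  rw [e]; exact hg

lemma isMetricPair_metricTensor
    (g : ContinuousRiemannianMetric (Euc n) (fun x : M => TangentSpace (𝓡 n) x)) :
    IsMetricPair (metricTensor n M) g.inner where
  smooth c := by
    refine ⟨fun i j => ?_, fun y hy => posDef_comp₂ (fun x v w => RiemannianMetric.symm _ x v w)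
      (fun x v hv => RiemannianMetric.pos _ x v hv) hy⟩
    have := contDiffOn_comp₂ (T := metricTensor n M) le_rfl (O := Set.univ)
      contMDiff_metricTensor.contMDiffOn c i j
    rwa [Set.preimage_univ, Set.inter_univ] at this
  continuousOn c i j := by
    have := contDiffOn_comp₂ (T := g.inner) (m := 0) (by simp) (O := Set.univ)
      (contMDiff_zero_iff.2 g.continuous).contMDiffOn c i j
    rw [Set.preimage_univ, Set.inter_univ] at this
    exact contDiffOn_zero.1 this
  posDef c y hy := posDef_comp₂ g.symm g.pos hy

end metricTensor

/-! ### The main theorem -/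

theorem mainTheorem7 (n : ℕ) (hn : 2 ≤ n)
    (M : Type*) [EMetricSpace M] [ChartedSpace (Euc n) M] [IsManifold (𝓡 n) ∞ M]
    [SecondCountableTopology M] [MeasurableSpace M] [BorelSpace M]
    -- `h`: the smooth background Riemannian metric of `M`; `edist` is its distance
    [RiemannianBundle (fun x : M => TangentSpace (𝓡 n) x)]
    [IsContMDiffRiemannianBundle (𝓡 n) ∞ (Euc n) (fun x : M => TangentSpace (𝓡 n) x)]
    [IsRiemannianManifold (𝓡 n) M]
    (p : ℝ≥0∞) (hp : (n : ℝ≥0∞) ≤ p)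
    (g : ContinuousRiemannianMetric (Euc n) (fun x : M => TangentSpace (𝓡 n) x))
    (hg : MemW1pLoc (metricTensor n M) g.inner p)
    (S : Set M) (hS : IsClosed S)
    (hsmooth : ContMDiffOn (𝓡 n) ((𝓡 n).prod 𝓘(ℝ, Euc n →L[ℝ] Euc n →L[ℝ] ℝ)) ∞
      (fun x : M => TotalSpace.mk' (Euc n →L[ℝ] Euc n →L[ℝ] ℝ)
        (E := fun x : M => TangentSpace (𝓡 n) x →L[ℝ] TangentSpace (𝓡 n) x →L[ℝ] ℝ)
        x (g.inner x)) Sᶜ)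
    (hfin : p ≠ ⊤ → Measure.hausdorffMeasure ((n : ℝ) - p.toReal / (p.toReal - 1)) S < ⊤)
    (hinf : p = ⊤ → Measure.hausdorffMeasure ((n : ℝ) - 1) S = 0)
    (a : ℝ) (hR : ∀ x ∉ S, a ≤ scalarCurvature g.inner x)
    (u : M → ℝ) (hu : ContMDiff (𝓡 n) 𝓘(ℝ) ∞ u) (hu_supp : HasCompactSupport u)
    (hu_nonneg : ∀ x, 0 ≤ u x) :
    (∃ α : CovectorField n M,
      HasWeakDifferential (fun x => u x * volumeDensity (metricTensor n M) g.inner x) α) ∧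
    Integrable (distScalarIntegrand (metricTensor n M) g.inner u)
      (riemannianVolume (metricTensor n M)) ∧
    Integrable u (riemannianVolume g.inner) ∧
    0 ≤ distScalarCurvature (metricTensor n M) g.inner u
      - a * ∫ x, u x ∂(riemannianVolume g.inner) := by
  have hgh := isMetricPair_metricTensor g
  obtain ⟨hD, hDp⟩ := hg.weakCovDeriv
  refine ⟨⟨_, hasWeakDifferential_densityDifferential hgh hD hu⟩, ?_⟩
  refine distScalar_global hn hp hgh hD hDp hS (fun c => ⟨fun i j =>
    contDiffOn_comp₂ le_rfl hsmooth c i j, fun y hy => posDef_comp₂ g.symm g.pos hy.1⟩)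
    (fun htop c K hK hKc => ?_) (fun htop c K hK hKc => ?_) hR hu hu_supp hu_nonneg
  · have hp2 : (2 : ℝ) ≤ p.toReal := by
      have h2 : (2 : ℝ≥0∞) ≤ p := le_trans (by exact_mod_cast hn) hp
      simpa using (ENNReal.toReal_le_toReal (by simp) htop).2 h2
    -- Since `p ≥ 2`, the conjugate exponent is at most `2 ≤ n`, so the dimension is nonnegative, as
    -- the Hausdorff bound for Lipschitz images requires.
    have hd : (0 : ℝ) ≤ n - p.toReal / (p.toReal - 1) := by
      have h1 : p.toReal / (p.toReal - 1) ≤ 2 := by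
        rw [div_le_iff₀ (by linarith)]; linarith
      have h3 : (2 : ℝ) ≤ n := by exact_mod_cast hn
      linarith
    obtain ⟨C, hC⟩ := exists_hausdorffMeasure_chart_le hd S c hKc hK
    exact hC.trans_lt (ENNReal.mul_lt_top ENNReal.coe_lt_top (hfin htop))
  · have hd : (0 : ℝ) ≤ n - 1 := by
      have h3 : (2 : ℝ) ≤ n := by exact_mod_cast hn
      linarith
    obtain ⟨C, hC⟩ := exists_hausdorffMeasure_chart_le hd S c hKc hK
    rw [hinf htop, mul_zero] at hC
    exact le_antisymm hC zero_le
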